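/- Conventions. Let $1<\alpha\le 2$ and $z^{\langle\beta\rangle}=|z|^{\beta-1}\overline z$ for $z\in\mathbb C$, $\beta>0$. A random vector $X$ in a Euclidean space is symmetric $\alpha$-stable (S$\alpha$S) if there is a finite symmetric measure $\Gamma_X$ on the unit sphere with $E e^{i\langle t,X\rangle}=\exp\{-\int|\langle t,x\rangle|^\alpha d\Gamma_X(x)\}$ for all $t$; for a complex S$\alpha$S variable $X$ put $\|X\|_\alpha^\alpha=[X,X]_\alpha=\int|x_1+ix_2|^\alpha d\Gamma_X(x_1,x_2)$. A complex process is S$\alpha$S if the real and imaginary parts of any finitely many of its values are jointly S$\alpha$S. The sequence $\{\xi_n,n\in\mathbb Z\}$ is harmonizable S$\alpha$S if $\xi_n=\int_{-\pi}^{\pi}e^{in\theta}dZ(\theta)$, where $Z$ is a complex S$\alpha$S process on $[-\pi,\pi]$ with independent increments and with finite spectral measure $\mu$, that is, $\mu((s,t])=\|Z(t)-Z(s)\|_\alpha^\alpha$; the integral $\int u\,dZ$, $u\in L^\alpha(\mu)$, is the $\|\cdot\|_\alpha$-limit of the integrals of step functions converging to $u$ in $L^\alpha(\mu)$. $L^\alpha(f)$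 denotes $L^\alpha(f\,d\theta)$ on $(-\pi,\pi]$. $H^-(\xi)$ is the $\|\cdot\|_\alpha$-closed linear span of $\xi_k$, $k=-1,-2,\dots$. An optimal linear estimate of $A\xi$ is an element $\hat A\xi$ of $H^-(\xi)$ that minimizes $\|A\xi-\zeta\|_\alpha$ over $\zeta\in H^-(\xi)$. Statement. Let $\{\xi_k,k\in\mathbb Z\}$ be a harmonizable S$\alpha$S sequence whose spectral measure is absolutely continuous, $d\mu=f\,d\theta$, with a density $f>0$ almost everywhere on $(-\pi,\pi]$ satisfying the minimality condition $$\int_{-\pi}^{\pi} f(\theta)^{-1/(\alpha-1)}\,d\theta<\infty .$$ Let $a_0,a_1,\dots$ be complex numbers with $\sum_j|a_j|<\infty$, and $A(e^{i\theta})=\sum_{j\ge0}a_je^{ij\theta}$. Then the series $A\xi=\sum_{j=0}^\infty a_j\xi_j$ converges in $\|\cdot\|_\alpha$, $A\xi=\int_{-\pi}^{\pi}A(e^{i\theta})\,dZ(\theta)$, and there is an almost surely unique optimal linear estimate $\hat A\xi$ of $A\xi$ from the observations $\xi_k$, $k=-1,-2,\dots$. There is exactly one sequence of complex coefficients $c_j$,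 $j=0,1,\dots$, that is the sequence of Fourier coefficients of an integrable function $C(e^{i\theta})$ with Fourier series $\sum_{j\ge0}c_je^{ij\theta}$ for which the function $$h(\theta)=A(e^{i\theta})-\bigl(\overline{C(e^{i\theta})}\bigr)^{\langle 1/(\alpha-1)\rangle}f(\theta)^{-1/(\alpha-1)}$$ belongs to $L^\alpha(f)$ and satisfies the system of equations $$\int_{-\pi}^{\pi}e^{-ik\theta}\Bigl(A(e^{i\theta})-\bigl(\overline{C(e^{i\theta})}\bigr)^{\langle 1/(\alpha-1)\rangle}f(\theta)^{-1/(\alpha-1)}\Bigr)d\theta=0,\qquad k=0,1,\dots .$$ With these coefficients, $$\hat A\xi=\int_{-\pi}^{\pi}h(\theta)\,dZ(\theta),$$ the spectral characteristic $h$ is determined by $\hat A\xi$ up to a null set, and the error of the optimal estimate is finite and given by $$\|A\xi-\hat A\xi\|_\alpha^\alpha=\int_{-\pi}^{\pi}\Bigl|\bigl(\overline{C(e^{i\theta})}\bigr)^{\langle 1/(\alpha-1)\rangle}f(\theta)^{-1/(\alpha-1)}\Bigr|^\alpha f(\theta)\,d\theta .$$ -/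

import Mathlib

open MeasureTheory ProbabilityTheory Filter Topology
open scoped ENNReal ComplexConjugate

noncomputable section

namespace StableExtrapolation

/-- The signed power `z^{<β>} = |z|^{β-1} * conj z` of a complex number. -/
def spow (z : ℂ) (β : ℝ) : ℂ := ((‖z‖ ^ (β - 1) : ℝ) : ℂ) * conj z

section Stable

variable {Ω : Type*} [MeasurableSpace Ω]

/-- `Γ` is a spectral measure of the symmetric `α`-stable random vector `X` with values in the
Euclidean space `E`: a finite symmetric measure, carried by the unit sphere, such that
`E exp(i⟨t, X⟩) = exp(-∫ |⟨t, x⟩|^α dΓ(x))` for all `t`. For `E = ℂ` the inner product is the one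
of the plane, so that this describes the pair `(Re X, Im X)`. -/
structure IsStableSpectralMeasure {E : Type*} [NormedAddCommGroup E] [InnerProductSpace ℝ E]
    [MeasurableSpace E] (α : ℝ) (P : Measure Ω) (X : Ω → E) (Γ : Measure E) : Prop where
  aemeasurable : AEMeasurable X P
  finite : IsFiniteMeasure Γ
  sphere : Γ (Metric.sphere (0 : E) 1)ᶜ = 0
  symmetric : Γ.map (fun x => -x) = Γ
  charFun_eq : ∀ t : E,
    charFun (P.map X) t = Complex.exp (-((∫ x, |inner ℝ t x| ^ α ∂Γ : ℝ) : ℂ))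

/-- `‖X‖_α^α = [X, X]_α = ∫ |x₁ + i x₂|^α dΓ_X(x)` for a complex symmetric `α`-stable random
variable `X`. This integral does not depend on the choice of the spectral measure `Γ_X`; the value
is `∞` if `X` is not symmetric `α`-stable. -/
def stableNormPow (α : ℝ) (P : Measure Ω) (X : Ω → ℂ) : ℝ≥0∞ :=
  ⨅ (Γ : Measure ℂ) (_ : IsStableSpectralMeasure α P X Γ), ∫⁻ x, ‖x‖ₑ ^ α ∂Γ

/-- A complex process is symmetric `α`-stable if (the real and imaginary parts of) any finitely
many of its values are jointly symmetric `α`-stable. -/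
def IsStableProcess {T : Type*} (α : ℝ) (P : Measure Ω) (Z : T → Ω → ℂ) : Prop :=
  ∀ (n : ℕ) (t : Fin n → T), ∃ Γ : Measure (EuclideanSpace ℂ (Fin n)),
    IsStableSpectralMeasure α P
      (fun ω => (WithLp.toLp 2 (fun i => Z (t i) ω) : EuclideanSpace ℂ (Fin n))) Γ

/-- The closed interval `[-π, π]`. -/
abbrev Circ : Type := Set.Icc (-Real.pi) Real.pi

/-- The step function equal to `a k` on `(t k, t (k+1)]` for `k < n` (and to `0` elsewhere). -/
def stepFun (n : ℕ) (t : ℕ → Circ) (a : ℕ → ℂ) (θ : ℝ) : ℂ :=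
  ∑ k ∈ Finset.range n, (Set.Ioc (t k : ℝ) (t (k + 1) : ℝ)).indicator (fun _ => a k) θ

/-- The integral of a step function with respect to `Z`. -/
def stepIntegral (Z : Circ → Ω → ℂ) (n : ℕ) (t : ℕ → Circ) (a : ℕ → ℂ) (ω : Ω) : ℂ :=
  ∑ k ∈ Finset.range n, a k * (Z (t (k + 1)) ω - Z (t k) ω)

/-- `Y = ∫ u dZ`: `u ∈ L^α(μ)`, and `Y` is the limit in the norm `‖·‖_α` of the integrals of step
functions that converge to `u` in `L^α(μ)`. -/
def IsStableIntegral (α : ℝ) (P : Measure Ω) (Z : Circ → Ω → ℂ) (μ : Measure ℝ) (u : ℝ → ℂ)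
    (Y : Ω → ℂ) : Prop :=
  MemLp u (ENNReal.ofReal α) μ ∧
    ∃ (n : ℕ → ℕ) (t : ℕ → ℕ → Circ) (a : ℕ → ℕ → ℂ),
      (∀ m, Monotone (t m)) ∧
      Tendsto (fun m => eLpNorm (fun θ => stepFun (n m) (t m) (a m) θ - u θ)
        (ENNReal.ofReal α) μ) atTop (𝓝 0) ∧
      Tendsto (fun m => stableNormPow α P
        (fun ω => Y ω - stepIntegral Z (n m) (t m) (a m) ω)) atTop (𝓝 0)

/-- `ξ` is a harmonizable symmetric `α`-stable sequence: `ξ_n = ∫ e^{inθ} dZ(θ)`, where `Z` is a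
symmetric `α`-stable process on `[-π, π]` with independent increments and with the finite
spectral measure `μ`, that is, `μ((s, t]) = ‖Z(t) - Z(s)‖_α^α`. -/
structure IsHarmonizable (α : ℝ) (P : Measure Ω) (ξ : ℤ → Ω → ℂ) (Z : Circ → Ω → ℂ)
    (μ : Measure ℝ) : Prop where
  stable : IsStableProcess α P Z
  indep : HasIndepIncrements Z P
  finite : IsFiniteMeasure μ
  carrier : μ (Set.Ioc (-Real.pi) Real.pi)ᶜ = 0
  spectral : ∀ s t : Circ, s ≤ t →
    μ (Set.Ioc (s : ℝ) (t : ℝ)) = stableNormPow α P (fun ω => Z t ω - Z s ω)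
  representation : ∀ n : ℤ,
    IsStableIntegral α P Z μ (fun θ => Complex.exp (Complex.I * n * θ)) (ξ n)

/-- The absolutely continuous measure on `(-π, π]` with the density `f`. -/
def densityMeasure (f : ℝ → ℝ) : Measure ℝ :=
  (volume.restrict (Set.Ioc (-Real.pi) Real.pi)).withDensity (fun θ => ENNReal.ofReal (f θ))

/-- `Y = ∑_{j ≥ 0} a_j ξ_j`, the series converging in the norm `‖·‖_α`. -/
def IsFunctional (α : ℝ) (P : Measure Ω) (ξ : ℤ → Ω → ℂ) (a : ℕ → ℂ) (Y : Ω → ℂ) : Prop :=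
  Tendsto (fun n : ℕ => stableNormPow α P
    (fun ω => Y ω - ∑ j ∈ Finset.range n, a j * ξ (j : ℤ) ω)) atTop (𝓝 0)

/-- `H⁻(ξ)`: the closure in the norm `‖·‖_α` of the linear span of the `ξ_k`, `k = -1, -2, …`. -/
def pastSpace (α : ℝ) (P : Measure Ω) (ξ : ℤ → Ω → ℂ) : Set (Ω → ℂ) :=
  {Y | ∀ ε : ℝ≥0∞, 0 < ε → ∃ L ∈ Submodule.span ℂ {X : Ω → ℂ | ∃ k : ℤ, k < 0 ∧ X = ξ k},
    stableNormPow α P (fun ω => Y ω - L ω) < ε}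

/-- `Y` is an optimal linear estimate of `X` from the `ξ_k`, `k = -1, -2, …`: a best approximation
of `X` in `H⁻(ξ)`. -/
def IsOptimalEstimate (α : ℝ) (P : Measure Ω) (ξ : ℤ → Ω → ℂ) (X Y : Ω → ℂ) : Prop :=
  Y ∈ pastSpace α P ξ ∧ ∀ W ∈ pastSpace α P ξ,
    stableNormPow α P (fun ω => X ω - Y ω) ≤ stableNormPow α P (fun ω => X ω - W ω)

end Stable

/-- `A(e^{iθ}) = ∑_{j ≥ 0} a_j e^{ijθ}` (used for absolutely summable coefficients). -/
def symbolA (a : ℕ → ℂ) (θ : ℝ) : ℂ := ∑' j : ℕ, a j * Complex.exp (Complex.I * j * θ)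

/-- The function `C` on `(-π, π]` is integrable and has the Fourier series
`∑_{j ≥ 0} c_j e^{ijθ}`. -/
structure HasAnalyticSeries (c : ℕ → ℂ) (C : ℝ → ℂ) : Prop where
  integrable : IntegrableOn C (Set.Ioc (-Real.pi) Real.pi)
  coeff : ∀ j : ℕ, (1 / (2 * Real.pi) : ℂ) *
    ∫ θ in (-Real.pi)..Real.pi, C θ * Complex.exp (-(Complex.I * j * θ)) = c j
  coeff_neg : ∀ j : ℕ, 0 < j →
    ∫ θ in (-Real.pi)..Real.pi, C θ * Complex.exp (Complex.I * j * θ) = 0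

/-- `A(e^{iθ}) - h(θ) = (conj C(e^{iθ}))^{<1/(α-1)>} f(θ)^{-1/(α-1)}`. -/
def errorChar (α : ℝ) (f : ℝ → ℝ) (C : ℝ → ℂ) (θ : ℝ) : ℂ :=
  spow (conj (C θ)) (1 / (α - 1)) * ((f θ ^ (-1 / (α - 1)) : ℝ) : ℂ)

/-- `h = A - (conj C)^{<1/(α-1)>} f^{-1/(α-1)}`. -/
def spectralChar (α : ℝ) (f : ℝ → ℝ) (a : ℕ → ℂ) (C : ℝ → ℂ) (θ : ℝ) : ℂ :=
  symbolA a θ - errorChar α f C θ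

/-- The coefficients `c_j`, with `C(e^{iθ}) = ∑_{j ≥ 0} c_j e^{ijθ}`, are such that
`h = A - (conj C)^{<1/(α-1)>} f^{-1/(α-1)}` belongs to `L^α(f)`, and they solve the system
`∫ e^{-ikθ} h(θ) dθ = 0`, `k = 0, 1, …`. -/
structure SolvesSystem (α : ℝ) (f : ℝ → ℝ) (a : ℕ → ℂ) (c : ℕ → ℂ) (C : ℝ → ℂ) : Prop where
  series : HasAnalyticSeries c C
  memLp : MemLp (spectralChar α f a C) (ENNReal.ofReal α) (densityMeasure f)
  system : ∀ k : ℕ, ∫ θ in (-Real.pi)..Real.pi,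
    Complex.exp (-(Complex.I * θ * k)) * spectralChar α f a C θ = 0

end StableExtrapolation

end

/-!
The prediction problem is transferred to `L^α(f)` and solved there.

*From random variables to functions.* The increments of `Z` are independent and stable, so the
integral of a step function is stable, and its norm `‖·‖_α` is the norm of the step function in
`L^α(μ)`. To pass to the limit, one needs that `‖·‖_α` is well behaved although it is only defined
on stable variables: the total mass of a spectral measure is determined by the law, being a multiple
of the mean over the circle of the exponent (`IsStableSpectralMeasure.mass_unique`); convergence in
`‖·‖_α` implies convergence in probability (`tendstoInMeasure_of_stableNormPow`), conversely a
sequence of stable variables which tends to `0` in probability tends to `0` in `‖·‖_α`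
(`tendsto_scale_zero`); and limits in probability of stable variables with convergent norms are
stable, by compactness of the set of probability measures on the circle (`HasScale.of_tendsto`).
Hence `u ↦ ∫ u dZ` is an isometry defined on all of `L^α(μ)`, with closed range, which maps the
closed span of the `e^{ikθ}`, `k < 0`, onto `H⁻(ξ)`. The optimal estimates of `Aξ = ∫ A dZ` are
therefore the integrals of the best approximations `h` of `A` in that span
(`isOptimalEstimate_iff`).

*The best approximation* exists and is unique because `L^α` is uniformly convex for `α > 1`. If
`e = A - h` is its error, the first variation of the norm gives `∫ conj g |e|^{α-2} e f = 0` for all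
`g` in the span, which says that `C = |e|^{α-2} e f` has no Fourier coefficients of negative index.
As `e = (conj C)^{<1/(α-1)>} f^{-1/(α-1)}`, and as the minimality condition embeds `L^α(f)` into
`L¹`, so that the coefficients of nonnegative index of `h` vanish, `C` solves the system
(`IsMinimalDensity.exists_solvesSystem`).

*The solution of the system is unique* (`IsMinimalDensity.solvesSystem_unique`). For two solutions
with errors `e₁, e₂`, the integral of `conj (e₁ - e₂) (C₁ - C₂)` vanishes, because the spectrum of
one factor is contained in `n ≥ 1` and that of the other one in `n ≥ 0`. Since
`C = f |e|^{α-2} e` depends on `e` in a strictly monotone way, `e₁ = e₂`. That the integral vanishes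
is not obvious, as the factors are merely integrable, with an integrable product; it amounts to
Smirnov's theorem. It is proved in `integral_mul_eq_zero_of_spectrum` by multiplying both factors
with the square of Szegő's extremal function `Φ` of the weight `p = 1 + s (|g| + |w|)`: as `|Φ|² p`
is constant, the products are bounded, while their spectra remain on the same half-line; as
`s → 0`, `Φ` tends to `1`.
-/

noncomputable section

namespace StableExtrapolation

/-! ### Fourier series on the arc -/

/-- Lebesgue measure on the arc `(-π, π]`. -/
abbrev arc : Measure ℝ := volume.restrict (Set.Ioc (-Real.pi) Real.pi)

/-- The character `θ ↦ e^{inθ}`. -/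
def chr (n : ℤ) (θ : ℝ) : ℂ := Complex.exp (Complex.I * n * θ)

lemma continuous_chr (n : ℤ) : Continuous (chr n) := by unfold chr; fun_prop

lemma norm_chr (n : ℤ) (θ : ℝ) : ‖chr n θ‖ = 1 := by
  have : Complex.I * n * θ = ((n * θ : ℝ) : ℂ) * Complex.I := by push_cast; ring
  rw [chr, this, Complex.norm_exp_ofReal_mul_I]

lemma chr_add (m n : ℤ) (θ : ℝ) : chr (m + n) θ = chr m θ * chr n θ := by
  simp only [chr, ← Complex.exp_add]; push_cast; ring_nf

lemma conj_chr (n : ℤ) (θ : ℝ) : conj (chr n θ) = chr (-n) θ := by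
  simp only [chr, ← Complex.exp_conj]; simp

@[simp] lemma chr_zero (θ : ℝ) : chr 0 θ = 1 := by simp [chr]

lemma memLp_chr (p : ℝ≥0∞) (ρ : Measure ℝ) [IsFiniteMeasure ρ] (n : ℤ) : MemLp (chr n) p ρ :=
  MemLp.of_bound (continuous_chr n).aestronglyMeasurable 1 (by simp [norm_chr])

lemma chr_mul_integrable {ρ : Measure ℝ} {g : ℝ → ℂ} (hg : Integrable g ρ) (n : ℤ) :
    Integrable (fun θ => chr n θ * g θ) ρ :=
  hg.bdd_mul (c := 1) (continuous_chr n).aestronglyMeasurable (by simp [norm_chr])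

/-- An integrable function on the arc all of whose Fourier coefficients vanish is null. -/
lemma ae_eq_zero_of_fourier {g : ℝ → ℂ} (hg : Integrable g arc)
    (h : ∀ n : ℤ, ∫ θ, chr n θ * g θ ∂arc = 0) : g =ᵐ[arc] 0 := by
  have : Fact (0 < 2 * Real.pi) := ⟨Real.two_pi_pos⟩
  have hfour (n : ℤ) (θ : ℝ) : fourier n (θ : AddCircle (2 * Real.pi)) = chr n θ := by
    rw [fourier_coe_apply, chr]
    congr 1
    have : (Real.pi : ℂ) ≠ 0 := by exact_mod_cast Real.pi_ne_zero
    push_cast; field_simp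
  have hcont (φ : C(AddCircle (2 * Real.pi), ℂ)) :
      ∫ θ, φ (θ : AddCircle (2 * Real.pi)) * g θ ∂arc = 0 := by
    have hint (φ : C(AddCircle (2 * Real.pi), ℂ)) :
        Integrable (fun θ : ℝ => φ (θ : AddCircle (2 * Real.pi)) * g θ) arc :=
      hg.bdd_mul (c := ‖φ‖) (φ.continuous.comp (AddCircle.continuous_mk' _)).aestronglyMeasurable
        (Eventually.of_forall fun θ => φ.norm_coe_le_norm _)
    let T : C(AddCircle (2 * Real.pi), ℂ) →ₗ[ℂ] ℂ :=
      { toFun := fun φ => ∫ θ, φ (θ : AddCircle (2 * Real.pi)) * g θ ∂arc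
        map_add' := fun φ ψ => by
          rw [← integral_add (hint φ) (hint ψ)]
          exact integral_congr_ae (Eventually.of_forall fun θ => by simp [add_mul])
        map_smul' := fun c φ => by
          simp only [RingHom.id_apply, smul_eq_mul]
          rw [← integral_const_mul]
          exact integral_congr_ae (Eventually.of_forall fun θ => by simp [mul_assoc]) }
    let T' : C(AddCircle (2 * Real.pi), ℂ) →L[ℂ] ℂ :=
      T.mkContinuous (∫ θ, ‖g θ‖ ∂arc) (fun φ => by
        refine (norm_integral_le_integral_norm _).trans ?_
        rw [mul_comm (∫ θ, ‖g θ‖ ∂arc), ← integral_const_mul]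
        refine integral_mono_ae (hint φ).norm (hg.norm.const_mul _)
          (Eventually.of_forall fun θ => ?_)
        simp only [norm_mul]
        exact mul_le_mul_of_nonneg_right (φ.norm_coe_le_norm _) (norm_nonneg _))
    have hle : (Submodule.span ℂ (Set.range (fourier (T := 2 * Real.pi)))).topologicalClosure
        ≤ LinearMap.ker (T' : C(AddCircle (2 * Real.pi), ℂ) →ₗ[ℂ] ℂ) := by
      refine Submodule.topologicalClosure_minimal _ ?_ T'.isClosed_ker
      rw [Submodule.span_le]
      rintro _ ⟨n, rfl⟩
      change ∫ θ, fourier n (θ : AddCircle (2 * Real.pi)) * g θ ∂arc = 0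
      simpa only [hfour] using h n
    rw [span_fourier_closure_eq_top] at hle
    exact hle (Submodule.mem_top (x := φ))
  have key : ∀ᵐ θ ∂(volume : Measure ℝ), θ ∈ Set.Ioo (-Real.pi) Real.pi → g θ = 0 := by
    refine isOpen_Ioo.ae_eq_zero_of_integral_contDiff_smul_eq_zero ?_ ?_
    · exact (IntegrableOn.mono_set hg Set.Ioo_subset_Ioc_self).locallyIntegrableOn
    · intro φ hφ _ hsupp
      have hz (x : ℝ) (hx : x ∉ Set.Ioo (-Real.pi) Real.pi) : φ x = 0 :=
        image_eq_zero_of_notMem_tsupport fun hx' => hx (hsupp hx')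
      let ψ : C(AddCircle (2 * Real.pi), ℂ) :=
        ⟨AddCircle.liftIoc (2 * Real.pi) (-Real.pi) (fun x => (φ x : ℂ)),
          AddCircle.liftIoc_continuous
            (by rw [hz _ (by simp), hz]; intro hx; linarith [hx.2])
            (Complex.continuous_ofReal.comp hφ.continuous).continuousOn⟩
      have h1 := hcont ψ
      have h2 : ∫ θ, ψ (θ : AddCircle (2 * Real.pi)) * g θ ∂arc = ∫ θ, φ θ • g θ ∂arc := by
        refine integral_congr_ae ?_
        filter_upwards [ae_restrict_mem measurableSet_Ioc] with θ hθ
        have : θ ∈ Set.Ioc (-Real.pi) (-Real.pi + 2 * Real.pi) := by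
          constructor <;> linarith [hθ.1, hθ.2]
        change AddCircle.liftIoc (2 * Real.pi) (-Real.pi) (fun x => (φ x : ℂ)) θ * g θ = _
        rw [AddCircle.liftIoc_coe_apply this, Complex.real_smul]
      rw [h1] at h2
      rw [← setIntegral_eq_integral_of_forall_compl_eq_zero (s := Set.Ioc (-Real.pi) Real.pi)]
      · exact h2.symm
      · intro x hx
        rw [hz x (fun hx' => hx (Set.Ioo_subset_Ioc_self hx')), zero_smul]
  have : arc = volume.restrict (Set.Ioo (-Real.pi) Real.pi) :=
    (Measure.restrict_congr_set Ioo_ae_eq_Ioc).symm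
  rw [this]
  exact (ae_restrict_iff' measurableSet_Ioo).2 key

lemma integral_chr_of_ne_zero {n : ℤ} (hn : n ≠ 0) : ∫ θ, chr n θ ∂arc = 0 := by
  have hne : Complex.I * (n : ℂ) ≠ 0 := mul_ne_zero Complex.I_ne_zero (by exact_mod_cast hn)
  simp only [chr]
  rw [← intervalIntegral.integral_of_le (by linarith [Real.pi_pos]), integral_exp_mul_complex hne,
    div_eq_zero_iff]
  left
  have := Complex.exp_periodic.int_mul n (Complex.I * (n : ℂ) * (-Real.pi : ℝ))
  rw [sub_eq_zero, ← this]
  congr 1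
  push_cast; ring

/-- The character `e^{inθ}` as an element of `L^p(ρ)`. -/
def chrLp (p : ℝ≥0∞) (ρ : Measure ℝ) [IsFiniteMeasure ρ] (n : ℤ) : Lp ℂ p ρ :=
  (memLp_chr p ρ n).toLp _

lemma coeFn_chrLp (p : ℝ≥0∞) (ρ : Measure ℝ) [IsFiniteMeasure ρ] (n : ℤ) :
    chrLp p ρ n =ᵐ[ρ] chr n := (memLp_chr p ρ n).coeFn_toLp

/-- The closed span in `L²(ρ)` of the characters `e^{inθ}` with `n ≥ k`. -/
def analyticSpace (ρ : Measure ℝ) [IsFiniteMeasure ρ] (k : ℤ) : Submodule ℂ (Lp ℂ 2 ρ) :=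
  (Submodule.span ℂ (chrLp 2 ρ '' {n | k ≤ n})).topologicalClosure

lemma chrLp_mem_analyticSpace (ρ : Measure ℝ) [IsFiniteMeasure ρ] {k n : ℤ} (h : k ≤ n) :
    chrLp 2 ρ n ∈ analyticSpace ρ k :=
  Submodule.le_topologicalClosure _ (Submodule.subset_span ⟨n, h, rfl⟩)

lemma analyticSpace_mono (ρ : Measure ℝ) [IsFiniteMeasure ρ] {k l : ℤ} (h : k ≤ l) :
    analyticSpace ρ l ≤ analyticSpace ρ k :=
  Submodule.topologicalClosure_mono
    (Submodule.span_mono (Set.image_mono fun _ hn => h.trans hn))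

lemma inner_toLp_conj {ρ : Measure ℝ} (Φ : Lp ℂ 2 ρ) {v : ℝ → ℂ}
    (hv : MemLp (fun θ => conj (v θ)) 2 ρ) :
    inner ℂ (hv.toLp _) Φ = ∫ θ, Φ θ * v θ ∂ρ := by
  rw [L2.inner_def]
  refine integral_congr_ae ?_
  filter_upwards [hv.coeFn_toLp] with θ hθ
  rw [hθ]; simp

lemma memLp_conj {ρ : Measure ℝ} {p : ℝ≥0∞} {v : ℝ → ℂ} (hv : MemLp v p ρ) :
    MemLp (fun θ => conj (v θ)) p ρ := hv.star

/-- A function of `L²(ρ)` that annihilates the characters `e^{inθ}`, `n ≥ k`, for the bilinear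
pairing annihilates their closed span. -/
lemma integral_mul_eq_zero_of_mem_analyticSpace {ρ : Measure ℝ} [IsFiniteMeasure ρ] {k : ℤ}
    {Φ : Lp ℂ 2 ρ} (hΦ : Φ ∈ analyticSpace ρ k) {v : ℝ → ℂ} (hv : MemLp v 2 ρ)
    (h : ∀ n : ℤ, k ≤ n → ∫ θ, chr n θ * v θ ∂ρ = 0) : ∫ θ, Φ θ * v θ ∂ρ = 0 := by
  have hv' := memLp_conj hv
  have hle : analyticSpace ρ k ≤ (Submodule.span ℂ {hv'.toLp _})ᗮ := by
    refine Submodule.topologicalClosure_minimal _ ?_ (Submodule.isClosed_orthogonal _)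
    rw [Submodule.span_le]
    rintro _ ⟨n, hn, rfl⟩
    rw [SetLike.mem_coe, Submodule.mem_orthogonal_singleton_iff_inner_right, inner_toLp_conj,
      ← h n hn]
    refine integral_congr_ae ?_
    filter_upwards [coeFn_chrLp 2 ρ n] with θ hθ
    rw [hθ]
  have := hle hΦ
  rwa [Submodule.mem_orthogonal_singleton_iff_inner_right, inner_toLp_conj] at this

lemma mem_analyticSpace_of_fourier {g : ℝ → ℂ} (hg : MemLp g 2 arc) {k : ℤ}
    (h : ∀ n : ℤ, -k < n → ∫ θ, chr n θ * g θ ∂arc = 0) : hg.toLp g ∈ analyticSpace arc k := by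
  have : (analyticSpace arc k).HasOrthogonalProjection := by
    have : CompleteSpace (analyticSpace arc k) :=
      (Submodule.isClosed_topologicalClosure _).completeSpace_coe
    infer_instance
  set M := analyticSpace arc k
  set G := hg.toLp g
  have hperp : G - M.starProjection G ∈ Mᗮ := Submodule.sub_starProjection_mem_orthogonal G
  set D := G - M.starProjection G with hD
  have hmem : M.starProjection G ∈ M := Submodule.starProjection_apply_mem M G
  have hchr (F : Lp ℂ 2 arc) (n : ℤ) : inner ℂ (chrLp 2 arc n) F = ∫ θ, chr (-n) θ * F θ ∂arc := by
    rw [L2.inner_def]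
    refine integral_congr_ae ?_
    filter_upwards [coeFn_chrLp 2 arc n] with θ hθ
    rw [hθ]; simp [conj_chr, mul_comm]
  have horth (m n : ℤ) (hmn : m ≠ n) : ∫ θ, chr m θ * chr (-n) θ ∂arc = 0 := by
    simp only [← chr_add]
    exact integral_chr_of_ne_zero (by omega)
  have hzero : (D : ℝ → ℂ) =ᵐ[arc] 0 := by
    refine ae_eq_zero_of_fourier ((Lp.memLp D).integrable (by norm_num)) fun n => ?_
    by_cases hn : k ≤ -n
    · have := (Submodule.mem_orthogonal _ _).1 hperp _ (chrLp_mem_analyticSpace arc hn)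
      rwa [hchr, neg_neg] at this
    · have h1 : inner ℂ (chrLp 2 arc (-n)) D = 0 := by
        rw [hD, inner_sub_right]
        have h2 : inner ℂ (chrLp 2 arc (-n)) G = 0 := by
          rw [hchr, neg_neg, ← h n (by omega)]
          refine integral_congr_ae ?_
          filter_upwards [hg.coeFn_toLp] with θ hθ
          rw [hθ]
        have h3 : inner ℂ (chrLp 2 arc (-n)) (M.starProjection G) = 0 := by
          rw [hchr, neg_neg]
          have := integral_mul_eq_zero_of_mem_analyticSpace hmem (memLp_chr 2 arc n)
            (fun m hm => by
              have := horth m (-n) (by omega)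
              rwa [neg_neg] at this)
          simpa only [mul_comm] using this
        rw [h2, h3, sub_zero]
      rwa [hchr, neg_neg] at h1
  have : D = 0 := (Lp.eq_zero_iff_ae_eq_zero).2 hzero
  rw [hD, sub_eq_zero] at this
  rw [this]
  exact hmem

/-- The Fourier spectra of `g` and `w` being contained in `n ≥ 1` and in `n ≥ 0`, the integral of
the product vanishes. This is the square integrable case. -/
lemma integral_mul_eq_zero_of_memLp {g w : ℝ → ℂ} (hg : MemLp g 2 arc) (hw : MemLp w 2 arc)
    (hg0 : ∀ n : ℤ, 0 ≤ n → ∫ θ, chr n θ * g θ ∂arc = 0)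
    (hw0 : ∀ n : ℤ, 1 ≤ n → ∫ θ, chr n θ * w θ ∂arc = 0) : ∫ θ, g θ * w θ ∂arc = 0 := by
  have h1 := integral_mul_eq_zero_of_mem_analyticSpace
    (mem_analyticSpace_of_fourier hg (k := 1) (fun n hn => hg0 n (by omega))) hw hw0
  rw [← h1]
  refine integral_congr_ae ?_
  filter_upwards [hg.coeFn_toLp] with θ hθ
  rw [hθ]

/-! ### Szegő's extremal function -/

lemma integral_arc_one : ∫ _θ, (1 : ℂ) ∂arc = 2 * Real.pi := by
  simp only [integral_const, measureReal_restrict_apply_univ, Real.volume_real_Ioc]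
  rw [max_eq_left (by linarith [Real.pi_pos])]
  simp; ring

/-- Szegő's extremal function `Φ = 1 - q` for an integrable weight `p ≥ 1`, where `q` is the
projection in `L²(p)` of `1` onto the closed span of the `e^{inθ}`, `n ≥ 1`: the function `|Φ|² p`
is constant, and multiplication by `Φ²` keeps the spectrum of a function dominated by `p`
on the same half-line. -/
lemma exists_extremal {p : ℝ → ℝ} (hp1 : ∀ᵐ θ ∂arc, 1 ≤ p θ) (hpi : Integrable p arc) :
    ∃ (Φ : ℝ → ℂ) (c : ℝ), AEStronglyMeasurable Φ arc ∧ 2 * Real.pi * c ≤ ∫ θ, p θ ∂arc ∧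
      (∀ᵐ θ ∂arc, ‖Φ θ‖ ^ 2 * p θ = c) ∧ MemLp Φ 2 arc ∧
      ∫ θ, ‖Φ θ - 1‖ ^ 2 ∂arc ≤ (∫ θ, p θ ∂arc) - 2 * Real.pi ∧
      ∀ (H : ℝ → ℂ) (K : ℝ) (k : ℤ), AEStronglyMeasurable H arc →
        (∀ᵐ θ ∂arc, ‖H θ‖ ≤ K * p θ) → (∀ n : ℤ, k ≤ n → ∫ θ, chr n θ * H θ ∂arc = 0) →
        ∀ n : ℤ, k ≤ n → ∫ θ, chr n θ * (Φ θ ^ 2 * H θ) ∂arc = 0 := by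
  have hpm : AEMeasurable p arc := hpi.aemeasurable
  set ρ : Measure ℝ := arc.withDensity (fun θ => ENNReal.ofReal (p θ)) with hρ
  have hfin : IsFiniteMeasure ρ := isFiniteMeasure_withDensity_ofReal hpi.2
  have hac : ρ ≪ arc := withDensity_absolutelyContinuous _ _
  have hac' : arc ≪ ρ := by
    refine withDensity_absolutelyContinuous' hpm.ennreal_ofReal ?_
    filter_upwards [hp1] with θ hθ
    simp only [ne_eq, ENNReal.ofReal_eq_zero, not_le]; linarith
  have hint (F : ℝ → ℂ) : ∫ θ, F θ ∂ρ = ∫ θ, p θ * F θ ∂arc := by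
    rw [hρ, integral_withDensity_eq_integral_toReal_smul₀ hpm.ennreal_ofReal (by simp)]
    refine integral_congr_ae ?_
    filter_upwards [hp1] with θ hθ
    rw [ENNReal.toReal_ofReal (by linarith), Complex.real_smul]
  have hintR (F : ℝ → ℝ) : ∫ θ, F θ ∂ρ = ∫ θ, p θ * F θ ∂arc := by
    rw [hρ, integral_withDensity_eq_integral_toReal_smul₀ hpm.ennreal_ofReal (by simp)]
    refine integral_congr_ae ?_
    filter_upwards [hp1] with θ hθ
    rw [ENNReal.toReal_ofReal (by linarith), smul_eq_mul]
  have hiff (F : ℝ → ℂ) (hF : Integrable F ρ) : Integrable (fun θ => (p θ : ℂ) * F θ) arc := by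
    rw [hρ, integrable_withDensity_iff_integrable_smul₀' hpm.ennreal_ofReal (by simp)] at hF
    refine hF.congr ?_
    filter_upwards [hp1] with θ hθ
    rw [ENNReal.toReal_ofReal (by linarith), Complex.real_smul]
  have : (analyticSpace ρ 1).HasOrthogonalProjection := by
    have : CompleteSpace (analyticSpace ρ 1) :=
      (Submodule.isClosed_topologicalClosure _).completeSpace_coe
    infer_instance
  set M := analyticSpace ρ 1
  set q := M.starProjection (chrLp 2 ρ 0)
  have hq : q ∈ M := Submodule.starProjection_apply_mem M _
  set Φ := chrLp 2 ρ 0 - q with hΦdef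
  have hperp : Φ ∈ Mᗮ := Submodule.sub_starProjection_mem_orthogonal _
  have hΦ0 : Φ ∈ analyticSpace ρ 0 :=
    Submodule.sub_mem _ (chrLp_mem_analyticSpace ρ le_rfl) (analyticSpace_mono ρ zero_le_one hq)
  have hΦm : MemLp Φ 2 ρ := Lp.memLp Φ
  have hΦmeas : AEStronglyMeasurable Φ arc := (Lp.aestronglyMeasurable Φ).mono_ac hac'
  have hchrmul {v : ℝ → ℂ} (hv : MemLp v 2 ρ) (n : ℤ) : MemLp (fun θ => chr n θ * v θ) 2 ρ :=
    MemLp.of_le hv ((continuous_chr n).aestronglyMeasurable.mul hv.1)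
      (Eventually.of_forall fun θ => by simp [norm_chr])
  have horth (n : ℤ) (hn : 1 ≤ n) : ∫ θ, chr n θ * conj (Φ θ) ∂ρ = 0 := by
    have h1 := (Submodule.mem_orthogonal' _ _).1 hperp _ (chrLp_mem_analyticSpace ρ hn)
    rw [L2.inner_def] at h1
    rw [← h1]
    refine integral_congr_ae ?_
    filter_upwards [coeFn_chrLp 2 ρ n] with θ hθ
    rw [hθ]; simp
  -- the positive Fourier coefficients of `|Φ|² p`, hence all those of nonzero index, vanish
  have hpos (n : ℤ) (hn : 1 ≤ n) : ∫ θ, chr n θ * (‖Φ θ‖ ^ 2 : ℝ) ∂ρ = 0 := by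
    rw [← integral_mul_eq_zero_of_mem_analyticSpace hΦ0 (hchrmul (memLp_conj hΦm) n)
      (fun m hm => by
        rw [← horth (m + n) (by omega)]
        refine integral_congr_ae (Eventually.of_forall fun θ => ?_)
        simp only [chr_add]; ring)]
    refine integral_congr_ae (Eventually.of_forall fun θ => ?_)
    have := Complex.mul_conj' (Φ θ)
    simp only
    rw [mul_left_comm, this]; push_cast; ring
  have hne (n : ℤ) (hn : n ≠ 0) : ∫ θ, chr n θ * (‖Φ θ‖ ^ 2 : ℝ) ∂ρ = 0 := by
    rcases lt_or_gt_of_ne hn with h | h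
    · have h1 := hpos (-n) (by omega)
      have h2 := congrArg (starRingEnd ℂ) h1
      rw [← integral_conj, map_zero] at h2
      rw [← h2]
      refine integral_congr_ae (Eventually.of_forall fun θ => ?_)
      simp only [map_mul, conj_chr, neg_neg, Complex.conj_ofReal]
    · exact hpos n (by omega)
  have hsqi : Integrable (fun θ => ((‖Φ θ‖ ^ 2 : ℝ) : ℂ)) ρ :=
    Integrable.ofReal ((memLp_two_iff_integrable_sq_norm hΦm.1).1 hΦm)
  have hgi := hiff _ hsqi
  set c : ℝ := (2 * Real.pi)⁻¹ * ∫ θ, ‖Φ θ‖ ^ 2 ∂ρ with hc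
  have hcc : ∫ θ, ‖Φ θ‖ ^ 2 ∂ρ = 2 * Real.pi * c := by
    rw [hc]; field_simp
  have hconst : ∀ᵐ θ ∂arc, ‖Φ θ‖ ^ 2 * p θ = c := by
    have h0 := ae_eq_zero_of_fourier (hgi.sub (integrable_const (c : ℂ))) fun n => by
      have e1 : ∫ θ, chr n θ * ((p θ : ℂ) * ((‖Φ θ‖ ^ 2 : ℝ) : ℂ)) ∂arc
          = ∫ θ, chr n θ * (‖Φ θ‖ ^ 2 : ℝ) ∂ρ := by
        rw [hint]
        exact integral_congr_ae (Eventually.of_forall fun θ => by simp only; ring)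
      simp only [Pi.sub_apply, mul_sub]
      rw [integral_sub (chr_mul_integrable hgi n)
        (chr_mul_integrable (integrable_const _) n), e1, integral_mul_const]
      rcases eq_or_ne n 0 with rfl | hn
      · simp only [chr_zero, one_mul]
        rw [integral_arc_one, integral_complex_ofReal, hcc]
        push_cast; ring
      · rw [hne n hn, integral_chr_of_ne_zero hn]; simp
    filter_upwards [h0] with θ hθ
    simp only [Pi.sub_apply, Pi.zero_apply, sub_eq_zero] at hθ
    rw [mul_comm]
    exact_mod_cast hθ
  have hnormsq (F : Lp ℂ 2 ρ) : ‖F‖ ^ 2 = ∫ θ, ‖F θ‖ ^ 2 ∂ρ := by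
    have h1 : inner ℂ F F = ((‖F‖ ^ 2 : ℝ) : ℂ) := by
      rw [inner_self_eq_norm_sq_to_K]; norm_cast
    rw [L2.inner_def] at h1
    have h2 : ∫ θ, inner ℂ (F θ) (F θ) ∂ρ = ((∫ θ, ‖F θ‖ ^ 2 ∂ρ : ℝ) : ℂ) := by
      rw [← integral_complex_ofReal]
      refine integral_congr_ae (Eventually.of_forall fun θ => ?_)
      simp only [inner_self_eq_norm_sq_to_K]; norm_cast
    rw [h2] at h1
    exact_mod_cast h1.symm
  have hcle : 2 * Real.pi * c ≤ ∫ θ, p θ ∂arc := by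
    have h1 : ‖Φ‖ ≤ ‖chrLp 2 ρ 0‖ := by
      have h2 : inner ℂ Φ Φ = inner ℂ Φ (chrLp 2 ρ 0) := by
        have h3 := (Submodule.mem_orthogonal' _ _).1 hperp _ hq
        nth_rewrite 2 [hΦdef]
        rw [inner_sub_right, h3, sub_zero]
      have h3 : ‖Φ‖ * ‖Φ‖ ≤ ‖Φ‖ * ‖chrLp 2 ρ 0‖ := by
        have h4 := norm_inner_le_norm (𝕜 := ℂ) Φ (chrLp 2 ρ 0)
        rw [← h2, inner_self_eq_norm_sq_to_K] at h4
        simpa [pow_two] using h4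
      rcases (norm_nonneg Φ).eq_or_lt with h | h
      · rw [← h]; exact norm_nonneg _
      · exact le_of_mul_le_mul_left h3 h
    have h2 : ‖chrLp 2 ρ 0‖ ^ 2 = ∫ θ, p θ ∂arc := by
      rw [hnormsq]
      have : ∫ θ, ‖chrLp 2 ρ 0 θ‖ ^ 2 ∂ρ = ∫ _θ, (1 : ℝ) ∂ρ := by
        refine integral_congr_ae ?_
        filter_upwards [coeFn_chrLp 2 ρ 0] with θ hθ
        rw [hθ]; simp
      rw [this, hintR]; simp
    rw [← hcc, ← hnormsq, ← h2]
    exact pow_le_pow_left₀ (norm_nonneg _) h1 2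
  -- division by the weight turns integrals over the arc into integrals against `ρ`
  have hdiv (F : ℝ → ℂ) : ∫ θ, F θ * (p θ : ℂ)⁻¹ ∂ρ = ∫ θ, F θ ∂arc := by
    rw [hint]
    refine integral_congr_ae ?_
    filter_upwards [hp1] with θ hθ
    have : (p θ : ℂ) ≠ 0 := by exact_mod_cast (by linarith : p θ ≠ 0)
    field_simp
  have hpinv : AEStronglyMeasurable (fun θ => (p θ : ℂ)⁻¹) ρ :=
    ((Complex.measurable_ofReal.comp_aemeasurable hpm).inv.aestronglyMeasurable).mono_ac hac
  have hmean : ∫ θ, Φ θ ∂arc = 2 * Real.pi := by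
    have hinv : MemLp (fun θ => (p θ : ℂ)⁻¹) 2 ρ := by
      refine MemLp.of_bound hpinv 1 (hac.ae_le ?_)
      filter_upwards [hp1] with θ hθ
      rw [norm_inv, Complex.norm_real, Real.norm_of_nonneg (by linarith)]
      exact inv_le_one_of_one_le₀ hθ
    have h0 : ∫ θ, q θ * (p θ : ℂ)⁻¹ ∂ρ = 0 :=
      integral_mul_eq_zero_of_mem_analyticSpace hq hinv fun n hn => by
        rw [hdiv, integral_chr_of_ne_zero (by omega)]
    have h1 : ∫ θ, (Φ θ * (p θ : ℂ)⁻¹) ∂ρ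
        = ∫ θ, (1 * (p θ : ℂ)⁻¹) ∂ρ - ∫ θ, q θ * (p θ : ℂ)⁻¹ ∂ρ := by
      rw [← integral_sub]
      · refine integral_congr_ae ?_
        filter_upwards [Lp.coeFn_sub (chrLp 2 ρ 0) q, coeFn_chrLp 2 ρ 0] with θ h1 h2
        rw [hΦdef, h1, Pi.sub_apply, h2]; simp [sub_mul]
      · simpa using hinv.integrable (by norm_num)
      · exact (Lp.memLp q).integrable_mul hinv
    rw [h0, sub_zero, hdiv, hdiv, integral_arc_one] at h1
    exact h1
  have hsq_arc : Integrable (fun θ => ‖Φ θ‖ ^ 2) arc := by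
    refine Integrable.mono' (integrable_const c) (hΦmeas.norm.pow 2) ?_
    filter_upwards [hconst, hp1] with θ h1 h2
    rw [Real.norm_of_nonneg (by positivity), ← h1]
    exact le_mul_of_one_le_right (by positivity) h2
  have hΦarc : MemLp Φ 2 arc := (memLp_two_iff_integrable_sq_norm hΦmeas).2 hsq_arc
  refine ⟨Φ, c, hΦmeas, hcle, hconst, hΦarc, ?_, ?_⟩
  · have h1 : ∀ θ, ‖Φ θ - 1‖ ^ 2 = ‖Φ θ‖ ^ 2 - 2 * (Φ θ).re + 1 := by
      intro θ
      rw [← Complex.normSq_eq_norm_sq, ← Complex.normSq_eq_norm_sq, Complex.normSq_apply,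
        Complex.normSq_apply]
      simp; ring
    have hΦint : Integrable Φ arc := hΦarc.integrable (by norm_num)
    simp only [h1]
    have hre : Integrable (fun θ => 2 * (Φ θ).re) arc := hΦint.re.const_mul 2
    have hsub : Integrable (fun θ => ‖Φ θ‖ ^ 2 - 2 * (Φ θ).re) arc := hsq_arc.sub hre
    rw [integral_add hsub (integrable_const _), integral_sub hsq_arc hre, integral_const_mul]
    have h2 : ∫ θ, (Φ θ).re ∂arc = 2 * Real.pi := by
      have := integral_re hΦint
      simp only [RCLike.re_to_complex] at this
      rw [this, hmean]
      simp
    have h3 : ∫ _θ, (1 : ℝ) ∂arc = 2 * Real.pi := by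
      simp only [integral_const, measureReal_restrict_apply_univ, Real.volume_real_Ioc]
      rw [max_eq_left (by linarith [Real.pi_pos])]
      simp; ring
    have h4 : ∫ θ, ‖Φ θ‖ ^ 2 ∂arc ≤ 2 * Real.pi * c := by
      have : ∫ θ, ‖Φ θ‖ ^ 2 ∂arc ≤ ∫ _θ, c ∂arc := by
        refine integral_mono_ae hsq_arc (integrable_const c) ?_
        filter_upwards [hconst, hp1] with θ h1 h2
        rw [← h1]
        exact le_mul_of_one_le_right (by positivity) h2
      refine this.trans (le_of_eq ?_)
      rw [← mul_one c, integral_const_mul, h3]; ring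
    rw [h2, h3]
    linarith
  · intro H K k hHm hHK hH n hn
    have hu : ∀ᵐ θ ∂ρ, ‖H θ * (p θ : ℂ)⁻¹‖ ≤ K := by
      refine hac.ae_le ?_
      filter_upwards [hHK, hp1] with θ h1 h2
      rw [norm_mul, norm_inv, Complex.norm_real, Real.norm_of_nonneg (by linarith),
        ← div_eq_mul_inv, div_le_iff₀ (by linarith)]
      exact h1
    have humeas : AEStronglyMeasurable (fun θ => H θ * (p θ : ℂ)⁻¹) ρ := (hHm.mono_ac hac).mul hpinv
    have hum : MemLp (fun θ => H θ * (p θ : ℂ)⁻¹) 2 ρ := MemLp.of_bound humeas K hu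
    have step1 (n : ℤ) (hn : k ≤ n) : ∫ θ, Φ θ * (chr n θ * (H θ * (p θ : ℂ)⁻¹)) ∂ρ = 0 :=
      integral_mul_eq_zero_of_mem_analyticSpace hΦ0 (hchrmul hum n) fun m hm => by
        rw [← hH (m + n) (by omega), ← hdiv]
        refine integral_congr_ae (Eventually.of_forall fun θ => ?_)
        simp only [chr_add]; ring
    have hΦu : MemLp (fun θ => Φ θ * (chr n θ * (H θ * (p θ : ℂ)⁻¹))) 2 ρ := by
      refine MemLp.of_le_mul (c := K) hΦm
        (hΦm.1.mul ((continuous_chr n).aestronglyMeasurable.mul humeas)) ?_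
      filter_upwards [hu] with θ hθ
      rw [norm_mul, norm_mul (chr n θ), norm_chr, one_mul, mul_comm]
      exact mul_le_mul_of_nonneg_right hθ (norm_nonneg _)
    have step2 := integral_mul_eq_zero_of_mem_analyticSpace hΦ0 hΦu fun m hm => by
      rw [← step1 (m + n) (by omega)]
      refine integral_congr_ae (Eventually.of_forall fun θ => ?_)
      simp only [chr_add]; ring
    rw [← step2, ← hdiv]
    refine integral_congr_ae (Eventually.of_forall fun θ => ?_)
    simp only; ring

/-! ### Products of functions with spectra on a half-line -/

/-- If `g` and `w` are integrable with Fourier spectra in `n ≥ 1` and in `n ≥ 0`, and if their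
product is integrable, then the integral of the product vanishes. This replaces Smirnov's theorem
that a function of class `H^{1/2}` with integrable boundary values is of class `H¹`. -/
theorem integral_mul_eq_zero_of_spectrum {g w : ℝ → ℂ} (hg : Integrable g arc)
    (hw : Integrable w arc) (hgw : Integrable (fun θ => g θ * w θ) arc)
    (hg0 : ∀ n : ℤ, 0 ≤ n → ∫ θ, chr n θ * g θ ∂arc = 0)
    (hw0 : ∀ n : ℤ, 1 ≤ n → ∫ θ, chr n θ * w θ ∂arc = 0) : ∫ θ, g θ * w θ ∂arc = 0 := by
  have hπ := Real.pi_pos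
  have h2π : ∫ _θ, (1 : ℝ) ∂arc = 2 * Real.pi := by
    simp only [integral_const, measureReal_restrict_apply_univ, Real.volume_real_Ioc]
    rw [max_eq_left (by linarith [Real.pi_pos])]
    simp; ring
  set S : ℝ := ∫ θ, (‖g θ‖ + ‖w θ‖) ∂arc with hS
  have hS0 : 0 ≤ S := integral_nonneg fun θ => by positivity
  let s : ℕ → ℝ := fun m => ((m : ℝ) + 1)⁻¹
  have hs0 (m : ℕ) : 0 < s m := by positivity
  have hs1 (m : ℕ) : s m ≤ 1 := inv_le_one_of_one_le₀ (by simp)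
  let p : ℕ → ℝ → ℝ := fun m θ => 1 + s m * (‖g θ‖ + ‖w θ‖)
  have hp1 (m : ℕ) : ∀ᵐ θ ∂arc, 1 ≤ p m θ := Eventually.of_forall fun θ => by
    have := mul_nonneg (hs0 m).le (add_nonneg (norm_nonneg (g θ)) (norm_nonneg (w θ)))
    simp only [p]; linarith
  have hpi (m : ℕ) : Integrable (p m) arc :=
    (integrable_const _).add ((hg.norm.add hw.norm).const_mul _)
  have hpint (m : ℕ) : ∫ θ, p m θ ∂arc = 2 * Real.pi + s m * S := by
    simp only [p]
    have hadd : Integrable (fun θ => s m * (‖g θ‖ + ‖w θ‖)) arc := (hg.norm.add hw.norm).const_mul _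
    rw [integral_add (integrable_const _) hadd, h2π, integral_const_mul]
  choose Φ c hΦm hc hconst hΦ2 hnear hspec using fun m => exists_extremal (hp1 m) (hpi m)
  have hcle (m : ℕ) : c m ≤ 1 + S := by
    have h1 := hc m
    rw [hpint] at h1
    have h2 : s m * S ≤ S := mul_le_of_le_one_left hS0 (hs1 m)
    have h3 : S ≤ 2 * Real.pi * S := le_mul_of_one_le_left hS0 (by linarith [Real.pi_gt_three])
    have : 2 * Real.pi * c m ≤ 2 * Real.pi * (1 + S) := by linarith
    exact le_of_mul_le_mul_left this (by positivity)
  have hΦle (m : ℕ) : ∀ᵐ θ ∂arc, ‖Φ m θ‖ ^ 2 ≤ 1 + S := by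
    filter_upwards [hconst m, hp1 m] with θ h1 h2
    refine le_trans ?_ (hcle m)
    rw [← h1]
    exact le_mul_of_one_le_right (by positivity) h2
  -- multiplication by `Φ²` makes the two functions bounded
  have hbdd (m : ℕ) (H : ℝ → ℂ) (hH : ∀ θ, ‖H θ‖ ≤ ‖g θ‖ + ‖w θ‖)
      (hHm : AEStronglyMeasurable H arc) :
      MemLp (fun θ => Φ m θ ^ 2 * H θ) 2 arc := by
    refine MemLp.of_bound (((hΦm m).pow 2).mul hHm) ((s m)⁻¹ * (1 + S)) ?_
    filter_upwards [hconst m] with θ h1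
    rw [norm_mul, norm_pow]
    have h2 : s m * ‖H θ‖ ≤ p m θ := by
      have := mul_le_mul_of_nonneg_left (hH θ) (hs0 m).le
      simp only [p]; linarith
    have h3 : ‖H θ‖ ≤ (s m)⁻¹ * p m θ := by
      rw [inv_mul_eq_div, le_div_iff₀ (hs0 m)]; linarith
    calc ‖Φ m θ‖ ^ 2 * ‖H θ‖ ≤ ‖Φ m θ‖ ^ 2 * ((s m)⁻¹ * p m θ) := by gcongr
      _ = (s m)⁻¹ * c m := by rw [← h1]; ring
      _ ≤ (s m)⁻¹ * (1 + S) := mul_le_mul_of_nonneg_left (hcle m) (inv_nonneg.2 (hs0 m).le)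
  have hdom (m : ℕ) (H : ℝ → ℂ) (hH : ∀ θ, ‖H θ‖ ≤ ‖g θ‖ + ‖w θ‖) :
      ∀ᵐ θ ∂arc, ‖H θ‖ ≤ (s m)⁻¹ * p m θ := Eventually.of_forall fun θ => by
    rw [inv_mul_eq_div, le_div_iff₀ (hs0 m)]
    have := mul_le_mul_of_nonneg_left (hH θ) (hs0 m).le
    simp only [p]; linarith
  have hgle (θ : ℝ) : ‖g θ‖ ≤ ‖g θ‖ + ‖w θ‖ := by linarith [norm_nonneg (w θ)]
  have hwle (θ : ℝ) : ‖w θ‖ ≤ ‖g θ‖ + ‖w θ‖ := by linarith [norm_nonneg (g θ)]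
  have hzero (m : ℕ) : ∫ θ, Φ m θ ^ 4 * (g θ * w θ) ∂arc = 0 := by
    rw [← integral_mul_eq_zero_of_memLp (hbdd m g hgle hg.1) (hbdd m w hwle hw.1)
      (hspec m g _ 0 hg.1 (hdom m g hgle) hg0) (hspec m w _ 1 hw.1 (hdom m w hwle) hw0)]
    exact integral_congr_ae (Eventually.of_forall fun θ => by simp only; ring)
  -- `Φ → 1` in `L²`, hence almost everywhere along a subsequence
  have hlim : Tendsto (fun m => eLpNorm (Φ m - fun _ => (1 : ℂ)) 2 arc) atTop (𝓝 0) := by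
    have hsub (m : ℕ) : MemLp (Φ m - fun _ => (1 : ℂ)) 2 arc := (hΦ2 m).sub (memLp_const 1)
    have h1 (m : ℕ) : eLpNorm (Φ m - fun _ => (1 : ℂ)) 2 arc ≤ ENNReal.ofReal (√(s m * S)) := by
      rw [(hsub m).eLpNorm_eq_integral_rpow_norm (by norm_num) (by norm_num)]
      refine ENNReal.ofReal_le_ofReal ?_
      have h2 := hnear m
      rw [hpint] at h2
      rw [Real.sqrt_eq_rpow]
      norm_num
      refine Real.rpow_le_rpow (integral_nonneg fun θ => by positivity) ?_ (by norm_num)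
      linarith
    have h2 : Tendsto (fun m => √(s m * S)) atTop (𝓝 0) := by
      have : Tendsto s atTop (𝓝 0) := by
        simpa [s, one_div] using tendsto_one_div_add_atTop_nhds_zero_nat (𝕜 := ℝ)
      simpa using (this.mul_const S).sqrt
    have h3 := ENNReal.tendsto_ofReal h2
    rw [ENNReal.ofReal_zero] at h3
    exact tendsto_of_tendsto_of_tendsto_of_le_of_le tendsto_const_nhds h3 (fun _ => zero_le) h1
  obtain ⟨ns, -, hae⟩ := (tendstoInMeasure_of_tendsto_eLpNorm (by norm_num) (fun m => hΦm m)
    aestronglyMeasurable_const hlim).exists_seq_tendsto_ae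
  have hconv : Tendsto (fun i => ∫ θ, Φ (ns i) θ ^ 4 * (g θ * w θ) ∂arc) atTop
      (𝓝 (∫ θ, g θ * w θ ∂arc)) := by
    refine tendsto_integral_of_dominated_convergence (fun θ => (1 + S) ^ 2 * ‖g θ * w θ‖)
      (fun i => ((hΦm _).pow 4).mul hgw.1) (hgw.norm.const_mul _) (fun i => ?_) ?_
    · filter_upwards [hΦle (ns i)] with θ hθ
      rw [norm_mul, norm_pow]
      refine mul_le_mul_of_nonneg_right ?_ (norm_nonneg _)
      calc ‖Φ (ns i) θ‖ ^ 4 = (‖Φ (ns i) θ‖ ^ 2) ^ 2 := by ring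
        _ ≤ (1 + S) ^ 2 := by gcongr
    · filter_upwards [hae] with θ hθ
      simpa using (hθ.pow 4).mul_const (g θ * w θ)
  simp only [hzero] at hconv
  exact (tendsto_nhds_unique hconv tendsto_const_nhds)

/-! ### Uniform convexity and best approximation -/

/-- The strict convexity defect of `z ↦ ‖z‖^α`: the mean of the values at `z` and `w`, minus the
value at the midpoint. -/
def defect {E : Type*} [NormedAddCommGroup E] [NormedSpace ℝ E] (α : ℝ) (z w : E) : ℝ :=
  (‖z‖ ^ α + ‖w‖ ^ α) / 2 - ‖(1 / 2 : ℝ) • (z + w)‖ ^ α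

lemma defect_nonneg {E : Type*} [NormedAddCommGroup E] [NormedSpace ℝ E] {α : ℝ} (hα : 1 < α)
    (z w : E) : 0 ≤ defect α z w := by
  have h1 : ‖(1 / 2 : ℝ) • (z + w)‖ ≤ (1 / 2 : ℝ) * ‖z‖ + (1 / 2 : ℝ) * ‖w‖ := by
    rw [norm_smul, ← mul_add]
    norm_num
    exact norm_add_le z w
  have h2 := (convexOn_rpow hα.le).2 (norm_nonneg z) (norm_nonneg w)
    (by norm_num : (0 : ℝ) ≤ 1 / 2) (by norm_num : (0 : ℝ) ≤ 1 / 2) (by norm_num)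
  have h3 := Real.rpow_le_rpow (norm_nonneg _) h1 (by linarith : 0 ≤ α)
  simp only [smul_eq_mul] at h2
  unfold defect; linarith

lemma defect_pos {α : ℝ} (hα : 1 < α) {z w : ℂ} (h : z ≠ w) : 0 < defect α z w := by
  have h1 : ‖(1 / 2 : ℝ) • (z + w)‖ ≤ (1 / 2 : ℝ) * ‖z‖ + (1 / 2 : ℝ) * ‖w‖ := by
    rw [norm_smul, ← mul_add]
    norm_num
    exact norm_add_le z w
  by_cases hzw : ‖z‖ = ‖w‖
  · have h2 := (norm_midpoint_lt_iff hzw).2 h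
    have h3 := Real.rpow_lt_rpow (norm_nonneg _) h2 (by linarith : 0 < α)
    unfold defect; rw [← hzw]; linarith
  · have h2 := (strictConvexOn_rpow hα).2 (norm_nonneg z) (norm_nonneg w) hzw
      (by norm_num : (0 : ℝ) < 1 / 2) (by norm_num : (0 : ℝ) < 1 / 2) (by norm_num)
    have h3 := Real.rpow_le_rpow (norm_nonneg _) h1 (by linarith : 0 ≤ α)
    simp only [smul_eq_mul] at h2
    unfold defect; linarith

/-- `E` is uniformly convex, expressed through the powers `‖·‖^α`: if the convexity defect at two
vectors is small, then so is their distance. -/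
def UniformlyRotund (α : ℝ) (E : Type*) [NormedAddCommGroup E] [NormedSpace ℝ E] : Prop :=
  ∀ ε : ℝ, 0 < ε → ∃ K : ℝ, 0 ≤ K ∧ ∀ z w : E,
    ‖z - w‖ ^ α ≤ ε * (‖z‖ ^ α + ‖w‖ ^ α) + K * defect α z w

/-- On the compact set `‖z‖^α + ‖w‖^α = 1` the estimate follows from strict convexity; the general
case follows by homogeneity. -/
lemma uniformlyRotund_complex {α : ℝ} (hα : 1 < α) : UniformlyRotund α ℂ := by
  intro ε hε
  have hα0 : 0 < α := by linarith
  have hcn : Continuous fun z : ℂ => ‖z‖ ^ α := continuous_norm.rpow_const fun _ => .inr hα0.le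
  let T : Set (ℂ × ℂ) := {p | ‖p.1‖ ^ α + ‖p.2‖ ^ α = 1} ∩ {p | ε ≤ ‖p.1 - p.2‖ ^ α}
  have hdc : Continuous fun p : ℂ × ℂ => defect α p.1 p.2 := by
    unfold defect
    exact (((hcn.comp continuous_fst).add (hcn.comp continuous_snd)).div_const 2).sub
      (hcn.comp (by fun_prop : Continuous fun p : ℂ × ℂ => (1 / 2 : ℝ) • (p.1 + p.2)))
  have hle1 {a b : ℝ} (ha : 0 ≤ a) (hb : 0 ≤ b) (h : a ^ α + b ^ α = 1) : a ≤ 1 := by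
    by_contra! h1
    have := Real.one_lt_rpow h1 hα0
    linarith [Real.rpow_nonneg hb α]
  have hT : IsCompact T := by
    refine Metric.isCompact_of_isClosed_isBounded ?_ ?_
    · refine IsClosed.inter ?_ ?_
      · exact isClosed_eq ((hcn.comp continuous_fst).add (hcn.comp continuous_snd)) continuous_const
      · exact isClosed_le continuous_const (hcn.comp (continuous_fst.sub continuous_snd))
    · refine (Metric.isBounded_closedBall (x := (0 : ℂ × ℂ)) (r := 1)).subset ?_
      rintro ⟨z, w⟩ ⟨h, -⟩
      have h1 : ‖z‖ ^ α + ‖w‖ ^ α = 1 := h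
      rw [mem_closedBall_zero_iff, Prod.norm_def]
      exact max_le (hle1 (norm_nonneg _) (norm_nonneg _) h1)
        (hle1 (norm_nonneg _) (norm_nonneg _) (by rw [add_comm]; exact h1))
  obtain ⟨κ, hκ, hκT⟩ : ∃ κ : ℝ, 0 < κ ∧ ∀ p ∈ T, κ ≤ defect α p.1 p.2 := by
    rcases T.eq_empty_or_nonempty with he | hne
    · exact ⟨1, one_pos, by simp [he]⟩
    · obtain ⟨p, hp, hmin⟩ := hT.exists_isMinOn hne hdc.continuousOn
      refine ⟨_, defect_pos hα (z := p.1) (w := p.2) ?_, fun q hq => hmin hq⟩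
      intro h
      have h2 : ε ≤ ‖p.1 - p.2‖ ^ α := hp.2
      rw [h, sub_self, norm_zero, Real.zero_rpow hα0.ne'] at h2
      linarith
  have hunit (z w : ℂ) (h : ‖z‖ ^ α + ‖w‖ ^ α = 1) :
      ‖z - w‖ ^ α ≤ ε + 2 ^ α / κ * defect α z w := by
    by_cases hc : ε ≤ ‖z - w‖ ^ α
    · have h1 := hκT (z, w) ⟨h, hc⟩
      have h2 : ‖z - w‖ ≤ 2 := by
        have := norm_sub_le z w
        have h3 := hle1 (norm_nonneg _) (norm_nonneg _) h
        have h4 := hle1 (norm_nonneg _) (norm_nonneg _) (by rw [add_comm]; exact h)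
        linarith
      have h3 := Real.rpow_le_rpow (norm_nonneg _) h2 hα0.le
      have h4 : (2 : ℝ) ^ α ≤ 2 ^ α / κ * defect α z w := by
        rw [div_mul_eq_mul_div, le_div_iff₀ hκ]
        exact mul_le_mul_of_nonneg_left h1 (by positivity)
      linarith
    · have := mul_nonneg (by positivity : 0 ≤ (2 : ℝ) ^ α / κ) (defect_nonneg hα z w)
      linarith
  refine ⟨2 ^ α / κ, by positivity, fun z w => ?_⟩
  set r := ‖z‖ ^ α + ‖w‖ ^ α with hr
  have hr0 : 0 ≤ r := by positivity
  rcases hr0.eq_or_lt with h0 | hpos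
  · have hz : ‖z‖ ^ α = 0 := by
      linarith [Real.rpow_nonneg (norm_nonneg z) α, Real.rpow_nonneg (norm_nonneg w) α]
    have hw : ‖w‖ ^ α = 0 := by
      linarith [Real.rpow_nonneg (norm_nonneg z) α, Real.rpow_nonneg (norm_nonneg w) α]
    rw [Real.rpow_eq_zero (norm_nonneg _) hα0.ne', norm_eq_zero] at hz hw
    simp [hz, hw, defect, ← h0, Real.zero_rpow hα0.ne']
  · set s : ℝ := r ^ (-α⁻¹)
    have hs : 0 < s := Real.rpow_pos_of_pos hpos _
    have hsα : s ^ α = r⁻¹ := by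
      rw [← Real.rpow_mul hpos.le, neg_mul, inv_mul_cancel₀ hα0.ne', Real.rpow_neg_one]
    have hscale (u : ℂ) : ‖s • u‖ ^ α = r⁻¹ * ‖u‖ ^ α := by
      rw [norm_smul, Real.norm_of_nonneg hs.le, Real.mul_rpow hs.le (norm_nonneg _), hsα]
    have h1 := hunit (s • z) (s • w) (by
      rw [hscale, hscale, ← mul_add, ← hr, inv_mul_cancel₀ hpos.ne'])
    have h2 : defect α (s • z) (s • w) = r⁻¹ * defect α z w := by
      unfold defect
      rw [← smul_add, smul_comm, hscale, hscale, hscale]; ring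
    rw [← smul_sub, hscale, h2] at h1
    have h3 := mul_le_mul_of_nonneg_left h1 hpos.le
    have h4 : r * (r⁻¹ * ‖z - w‖ ^ α) = ‖z - w‖ ^ α := by field_simp
    have h5 : r * (ε + 2 ^ α / κ * (r⁻¹ * defect α z w)) = ε * r + 2 ^ α / κ * defect α z w := by
      field_simp
    rwa [h4, h5] at h3

/-- In a uniformly convex space, a sequence that minimizes the distance to `A` within a closed
subspace is a Cauchy sequence. -/
lemma exists_bestApprox {E : Type*} [NormedAddCommGroup E] [NormedSpace ℂ E] [CompleteSpace E]
    {α : ℝ} (hα : 1 < α) (hE : UniformlyRotund α E) (N : Submodule ℂ E)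
    (hN : IsClosed (N : Set E)) (A : E) : ∃ h ∈ N, ∀ g ∈ N, ‖A - h‖ ≤ ‖A - g‖ := by
  have hα0 : 0 < α := by linarith
  let S : Set ℝ := (fun g => ‖A - g‖ ^ α) '' (N : Set E)
  have hSne : S.Nonempty := ⟨_, 0, N.zero_mem, rfl⟩
  have hSb : BddBelow S := ⟨0, by rintro _ ⟨g, -, rfl⟩; positivity⟩
  set d := sInf S
  have hd0 : 0 ≤ d := le_csInf hSne (by rintro _ ⟨g, -, rfl⟩; positivity)
  have hdle (g : E) (hg : g ∈ N) : d ≤ ‖A - g‖ ^ α := csInf_le hSb ⟨g, hg, rfl⟩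
  have hex (n : ℕ) : ∃ g ∈ N, ‖A - g‖ ^ α < d + 1 / ((n : ℝ) + 1) := by
    obtain ⟨_, ⟨g, hg, rfl⟩, hlt⟩ := exists_lt_of_csInf_lt hSne
      (lt_add_of_pos_right d (by positivity : 0 < 1 / ((n : ℝ) + 1)))
    exact ⟨g, hg, hlt⟩
  choose h hhN hh using hex
  have hcau : CauchySeq h := by
    rw [Metric.cauchySeq_iff]
    intro δ hδ
    have hδα : 0 < δ ^ α := Real.rpow_pos_of_pos hδ α
    obtain ⟨K, hK0, hK⟩ := hE (δ ^ α / (4 * (d + 1))) (by positivity)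
    obtain ⟨n₀, hn₀⟩ := exists_nat_gt (2 * K / δ ^ α)
    refine ⟨n₀, fun m hm n hn => ?_⟩
    have hsm (k : ℕ) (hk : n₀ ≤ k) : ‖A - h k‖ ^ α < d + 1 / ((n₀ : ℝ) + 1) := by
      refine (hh k).trans_le ?_
      have : (n₀ : ℝ) ≤ k := by exact_mod_cast hk
      gcongr
    have h1 := hK (A - h m) (A - h n)
    have h2 : defect α (A - h m) (A - h n) ≤ 1 / ((n₀ : ℝ) + 1) := by
      have h3 : (1 / 2 : ℝ) • ((A - h m) + (A - h n)) = A - (1 / 2 : ℂ) • (h m + h n) := by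
        have : (1 / 2 : ℝ) • ((A - h m) + (A - h n))
            = (1 / 2 : ℂ) • ((A - h m) + (A - h n)) := by
          rw [← Complex.coe_smul]; norm_num
        rw [this]; module
      have h4 := hdle _ (N.smul_mem (1 / 2 : ℂ) (N.add_mem (hhN m) (hhN n)))
      unfold defect
      rw [h3]
      linarith [hsm m hm, hsm n hn]
    have h5 : 1 / ((n₀ : ℝ) + 1) ≤ 1 := by
      rw [div_le_one (by positivity)]; linarith [Nat.cast_nonneg (α := ℝ) n₀]
    have h6 : ‖A - h m‖ ^ α + ‖A - h n‖ ^ α ≤ 2 * (d + 1) := by linarith [hsm m hm, hsm n hn]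
    have h7 : K * (1 / ((n₀ : ℝ) + 1)) < δ ^ α / 2 := by
      rw [mul_one_div, div_lt_iff₀ (by positivity)]
      rw [div_lt_iff₀ hδα] at hn₀
      nlinarith
    have h8 : δ ^ α / (4 * (d + 1)) * (‖A - h m‖ ^ α + ‖A - h n‖ ^ α) ≤ δ ^ α / 2 := by
      refine (mul_le_mul_of_nonneg_left h6 (by positivity)).trans (le_of_eq ?_)
      field_simp; norm_num
    have h9 : ‖h m - h n‖ ^ α < δ ^ α := by
      have h10 : (A - h m) - (A - h n) = -(h m - h n) := by abel
      rw [h10, norm_neg] at h1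
      have := mul_le_mul_of_nonneg_left h2 hK0
      linarith
    rw [dist_eq_norm]
    exact (Real.rpow_lt_rpow_iff (norm_nonneg _) hδ.le hα0).1 h9
  obtain ⟨g, hg⟩ := cauchySeq_tendsto_of_complete hcau
  have hgN : g ∈ N := hN.mem_of_tendsto hg (Eventually.of_forall hhN)
  have hgd : ‖A - g‖ ^ α ≤ d := by
    have h1 : Tendsto (fun n => ‖A - h n‖ ^ α) atTop (𝓝 (‖A - g‖ ^ α)) :=
      ((tendsto_const_nhds.sub hg).norm).rpow_const (.inr hα0.le)
    have h2 : Tendsto (fun n : ℕ => d + 1 / ((n : ℝ) + 1)) atTop (𝓝 (d + 0)) :=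
      tendsto_const_nhds.add tendsto_one_div_add_atTop_nhds_zero_nat
    rw [add_zero] at h2
    exact le_of_tendsto_of_tendsto' h1 h2 fun n => (hh n).le
  refine ⟨g, hgN, fun k hk => ?_⟩
  exact (Real.rpow_le_rpow_iff (norm_nonneg _) (norm_nonneg _) hα0).1 (hgd.trans (hdle k hk))

lemma bestApprox_unique {E : Type*} [NormedAddCommGroup E] [NormedSpace ℂ E]
    {α : ℝ} (hα : 1 < α) (hE : UniformlyRotund α E) (N : Submodule ℂ E) {A g h : E}
    (hg : g ∈ N) (hh : h ∈ N) (hgm : ∀ k ∈ N, ‖A - g‖ ≤ ‖A - k‖)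
    (hhm : ∀ k ∈ N, ‖A - h‖ ≤ ‖A - k‖) : g = h := by
  have hα0 : 0 < α := by linarith
  have heq : ‖A - g‖ = ‖A - h‖ := le_antisymm (hgm h hh) (hhm g hg)
  have hdef : defect α (A - g) (A - h) ≤ 0 := by
    have h3 : (1 / 2 : ℝ) • ((A - g) + (A - h)) = A - (1 / 2 : ℂ) • (g + h) := by
      have : (1 / 2 : ℝ) • ((A - g) + (A - h)) = (1 / 2 : ℂ) • ((A - g) + (A - h)) := by
        rw [← Complex.coe_smul]; norm_num
      rw [this]; module
    have h4 := hgm _ (N.smul_mem (1 / 2 : ℂ) (N.add_mem hg hh))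
    have h5 := Real.rpow_le_rpow (norm_nonneg _) h4 hα0.le
    unfold defect
    rw [h3, ← heq]; linarith
  have hle : ∀ ε : ℝ, 0 < ε → ‖g - h‖ ^ α ≤ 0 + ε * (‖A - g‖ ^ α + ‖A - h‖ ^ α) := by
    intro ε hε
    obtain ⟨K, hK0, hK⟩ := hE ε hε
    have h1 := hK (A - g) (A - h)
    have h10 : (A - g) - (A - h) = -(g - h) := by abel
    rw [h10, norm_neg] at h1
    have := mul_nonpos_of_nonneg_of_nonpos hK0 hdef
    linarith
  have hz : ‖g - h‖ ^ α ≤ 0 := by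
    set c := ‖A - g‖ ^ α + ‖A - h‖ ^ α
    have hc : 0 ≤ c := by positivity
    refine le_of_forall_pos_le_add fun η hη => ?_
    have h1 := hle (η / (c + 1)) (by positivity)
    have h2 : η / (c + 1) * c ≤ η := by
      rw [div_mul_eq_mul_div, div_le_iff₀ (by positivity)]; nlinarith
    linarith
  have hz' : ‖g - h‖ ^ α = 0 := le_antisymm hz (by positivity)
  rw [Real.rpow_eq_zero (norm_nonneg _) hα0.ne', norm_eq_zero, sub_eq_zero] at hz'
  exact hz'

section Lp

variable {X : Type*} [MeasurableSpace X] {μ : Measure X} {α : ℝ}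

lemma ofReal_ne_zero_of_one_lt (hα : 1 < α) : ENNReal.ofReal α ≠ 0 := by
  simp only [ne_eq, ENNReal.ofReal_eq_zero, not_le]; linarith

lemma integrable_norm_rpow {u : X → ℂ} (hα : 1 < α) (hu : MemLp u (ENNReal.ofReal α) μ) :
    Integrable (fun x => ‖u x‖ ^ α) μ := by
  have := hu.integrable_norm_rpow (ofReal_ne_zero_of_one_lt hα) ENNReal.ofReal_ne_top
  rwa [ENNReal.toReal_ofReal (by linarith)] at this

lemma eLpNorm_rpow {u : X → ℂ} (hα : 1 < α) (hu : MemLp u (ENNReal.ofReal α) μ) :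
    eLpNorm u (ENNReal.ofReal α) μ ^ α = ENNReal.ofReal (∫ x, ‖u x‖ ^ α ∂μ) := by
  have hα0 : 0 < α := by linarith
  have hI : 0 ≤ ∫ x, ‖u x‖ ^ α ∂μ := integral_nonneg fun x => by positivity
  rw [hu.eLpNorm_eq_integral_rpow_norm (ofReal_ne_zero_of_one_lt hα) ENNReal.ofReal_ne_top,
    ENNReal.toReal_ofReal hα0.le, ENNReal.ofReal_rpow_of_nonneg (by positivity) hα0.le,
    ← Real.rpow_mul hI, inv_mul_cancel₀ hα0.ne', Real.rpow_one]

lemma norm_Lp_rpow [Fact (1 ≤ ENNReal.ofReal α)] (hα : 1 < α) (F : Lp ℂ (ENNReal.ofReal α) μ) :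
    ‖F‖ ^ α = ∫ x, ‖F x‖ ^ α ∂μ := by
  rw [Lp.norm_def, ENNReal.toReal_rpow, eLpNorm_rpow hα (Lp.memLp F),
    ENNReal.toReal_ofReal (integral_nonneg fun x => by positivity)]

lemma uniformlyRotund_Lp [Fact (1 ≤ ENNReal.ofReal α)] (hα : 1 < α) :
    UniformlyRotund α (Lp ℂ (ENNReal.ofReal α) μ) := by
  intro ε hε
  obtain ⟨K, hK0, hK⟩ := uniformlyRotund_complex hα ε hε
  refine ⟨K, hK0, fun F G => ?_⟩
  have hi (H : Lp ℂ (ENNReal.ofReal α) μ) := integrable_norm_rpow hα (Lp.memLp H)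
  have hmid : ‖(1 / 2 : ℝ) • (F + G)‖ ^ α = ∫ x, ‖(1 / 2 : ℝ) • (F x + G x)‖ ^ α ∂μ := by
    rw [norm_Lp_rpow hα]
    refine integral_congr_ae ?_
    filter_upwards [Lp.coeFn_smul (1 / 2 : ℝ) (F + G), Lp.coeFn_add F G] with x h1 h2
    rw [h1, Pi.smul_apply, h2, Pi.add_apply]
  have hmidi : Integrable (fun x => ‖(1 / 2 : ℝ) • (F x + G x)‖ ^ α) μ :=
    integrable_norm_rpow hα (((Lp.memLp F).add (Lp.memLp G)).const_smul (1 / 2 : ℝ))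
  have hdef : defect α F G = ∫ x, defect α (F x) (G x) ∂μ := by
    have h1 : Integrable (fun x => (‖F x‖ ^ α + ‖G x‖ ^ α) / 2) μ := ((hi F).add (hi G)).div_const 2
    unfold defect
    rw [integral_sub h1 hmidi, integral_div, integral_add (hi F) (hi G), hmid,
      norm_Lp_rpow hα, norm_Lp_rpow hα]
  have hdi : Integrable (fun x => defect α (F x) (G x)) μ :=
    (((hi F).add (hi G)).div_const 2).sub hmidi
  have hsub : ‖F - G‖ ^ α = ∫ x, ‖F x - G x‖ ^ α ∂μ := by
    rw [norm_Lp_rpow hα]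
    refine integral_congr_ae ?_
    filter_upwards [Lp.coeFn_sub F G] with x h1
    rw [h1, Pi.sub_apply]
  have hadd : Integrable (fun x => ε * (‖F x‖ ^ α + ‖G x‖ ^ α)) μ :=
    ((hi F).add (hi G)).const_mul ε
  rw [hsub, hdef, norm_Lp_rpow hα F, norm_Lp_rpow hα G, ← integral_add (hi F) (hi G),
    ← integral_const_mul, ← integral_const_mul, ← integral_add hadd (hdi.const_mul K)]
  exact integral_mono_ae (integrable_norm_rpow hα ((Lp.memLp F).sub (Lp.memLp G)))
    (hadd.add (hdi.const_mul K)) (Eventually.of_forall fun x => hK _ _)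

/-- James orthogonality: if `e` is a shortest vector on the line `e + t g` in `L^α`, then the first
variation of `∫ ‖e + t g‖^α` at `t = 0` vanishes. -/
lemma integral_inner_eq_zero_of_isMin (hα : 1 < α) {e g : X → ℂ}
    (he : MemLp e (ENNReal.ofReal α) μ) (hg : MemLp g (ENNReal.ofReal α) μ)
    (hmin : ∀ t : ℝ, ∫ x, ‖e x‖ ^ α ∂μ ≤ ∫ x, ‖e x + t • g x‖ ^ α ∂μ) :
    ∫ x, ‖e x‖ ^ (α - 2) * inner ℝ (e x) (g x) ∂μ = 0 := by
  have hα0 : 0 < α := by linarith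
  have hpow (z : ℂ) : ‖z‖ ^ (α - 2) * ‖z‖ = ‖z‖ ^ (α - 1) := by
    rcases eq_or_ne z 0 with rfl | hz
    · simp [Real.zero_rpow (by linarith : α - 1 ≠ 0)]
    · have := norm_pos_iff.2 hz
      rw [← Real.rpow_add_one this.ne']; ring_nf
  have hder (z w : ℂ) (t : ℝ) : HasDerivAt (fun t : ℝ => ‖z + t • w‖ ^ α)
      (α * (‖z + t • w‖ ^ (α - 2) * inner ℝ (z + t • w) w)) t := by
    have h1 : HasDerivAt (fun t : ℝ => z + t • w) w t := by
      simpa using ((hasDerivAt_id t).smul_const w).const_add z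
    have h2 := (hasFDerivAt_norm_rpow (z + t • w) hα).comp_hasDerivAt t h1
    refine h2.congr_deriv ?_
    simp [mul_assoc]; ring
  have hem := he.1
  have hgm := hg.1
  have hmeas (t : ℝ) : AEStronglyMeasurable (fun x => ‖e x + t • g x‖ ^ α) μ :=
    (((hem.add (hgm.const_smul t)).norm.aemeasurable).pow_const α).aestronglyMeasurable
  have hbi : Integrable (fun x => α * (‖e x‖ + ‖g x‖) ^ α) μ := by
    have h1 := (he.norm.add hg.norm)
    have h2 := h1.integrable_norm_rpow (ofReal_ne_zero_of_one_lt hα) ENNReal.ofReal_ne_top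
    rw [ENNReal.toReal_ofReal hα0.le] at h2
    refine (h2.congr (Eventually.of_forall fun x => ?_)).const_mul α
    exact congrArg (· ^ α) (Real.norm_of_nonneg (by positivity : 0 ≤ ‖e x‖ + ‖g x‖))
  have hmain := hasDerivAt_integral_of_dominated_loc_of_deriv_le (μ := μ) (x₀ := (0 : ℝ))
    (F := fun t x => ‖e x + t • g x‖ ^ α)
    (F' := fun t x => α * (‖e x + t • g x‖ ^ (α - 2) * inner ℝ (e x + t • g x) (g x)))
    (bound := fun x => α * (‖e x‖ + ‖g x‖) ^ α) (s := Set.Ioo (-1) 1)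
    (Ioo_mem_nhds (by norm_num) (by norm_num)) (Eventually.of_forall hmeas)
    (by simpa using integrable_norm_rpow hα he)
    (by
      have h0 : AEStronglyMeasurable (fun x => e x + (0 : ℝ) • g x) μ :=
        hem.add (hgm.const_smul (0 : ℝ))
      exact ((h0.norm.aemeasurable.pow_const _).aestronglyMeasurable.mul
        (h0.inner hgm)).const_mul α)
    (Eventually.of_forall fun x t ht => by
      have ht' : ‖t‖ ≤ 1 := by
        rw [Real.norm_eq_abs, abs_le]; exact ⟨ht.1.le, ht.2.le⟩
      have h1 : ‖e x + t • g x‖ ≤ ‖e x‖ + ‖g x‖ := by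
        refine (norm_add_le _ _).trans ?_
        rw [norm_smul]
        gcongr
        exact mul_le_of_le_one_left (norm_nonneg _) ht'
      rw [norm_mul, Real.norm_of_nonneg hα0.le, norm_mul,
        Real.norm_of_nonneg (Real.rpow_nonneg (norm_nonneg _) _)]
      refine mul_le_mul_of_nonneg_left ?_ hα0.le
      calc ‖e x + t • g x‖ ^ (α - 2) * ‖inner ℝ (e x + t • g x) (g x)‖
          ≤ ‖e x + t • g x‖ ^ (α - 2) * (‖e x + t • g x‖ * ‖g x‖) := by
            gcongr
            exact norm_inner_le_norm _ _
        _ = ‖e x + t • g x‖ ^ (α - 1) * ‖g x‖ := by rw [← mul_assoc, hpow]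
        _ ≤ (‖e x‖ + ‖g x‖) ^ (α - 1) * (‖e x‖ + ‖g x‖) := by
            gcongr
            linarith [norm_nonneg (e x)]
        _ = (‖e x‖ + ‖g x‖) ^ α := by
            have h0 : 0 ≤ ‖e x‖ + ‖g x‖ := by positivity
            rcases h0.eq_or_lt with h | h
            · rw [← h, Real.zero_rpow hα0.ne', mul_zero]
            · rw [← Real.rpow_add_one h.ne']; ring_nf)
    hbi (Eventually.of_forall fun x t _ => hder _ _ t)
  obtain ⟨-, hD⟩ := hmain
  have hloc : IsLocalMin (fun t : ℝ => ∫ x, ‖e x + t • g x‖ ^ α ∂μ) 0 :=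
    Eventually.of_forall fun t => by simpa using hmin t
  have hz := hloc.hasDerivAt_eq_zero hD
  simp only [zero_smul, add_zero] at hz
  rw [integral_const_mul, mul_eq_zero] at hz
  exact hz.resolve_left hα0.ne'

end Lp

/-! ### The duality map -/

/-- The duality map `z ↦ |z|^{α-2} z` of `ℂ` with the exponent `α`. -/
def dualMap (α : ℝ) (z : ℂ) : ℂ := ((‖z‖ ^ (α - 2) : ℝ) : ℂ) * z

lemma norm_dualMap {α : ℝ} (hα : 1 < α) (z : ℂ) : ‖dualMap α z‖ = ‖z‖ ^ (α - 1) := by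
  rw [dualMap, norm_mul, Complex.norm_real, Real.norm_of_nonneg (by positivity)]
  rcases eq_or_ne z 0 with rfl | hz
  · simp [Real.zero_rpow (by linarith : α - 1 ≠ 0)]
  · have := norm_pos_iff.2 hz
    rw [← Real.rpow_add_one this.ne']; ring_nf

lemma spow_conj (z : ℂ) (β : ℝ) : spow (conj z) β = ((‖z‖ ^ (β - 1) : ℝ) : ℂ) * z := by
  simp [spow]

/-- The function `C` is recovered from the error function by the duality map. -/
lemma mul_dualMap_errorChar {α : ℝ} (hα : 1 < α) {f : ℝ → ℝ} {C : ℝ → ℂ} {θ : ℝ}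
    (hf : 0 < f θ) : (f θ : ℂ) * dualMap α (errorChar α f C θ) = C θ := by
  have h1 : α - 1 ≠ 0 := by linarith
  rcases eq_or_ne (C θ) 0 with hC | hC
  · simp [errorChar, spow, hC, dualMap]
  · have hn : 0 < ‖C θ‖ := norm_pos_iff.2 hC
    have hcoef : errorChar α f C θ
        = ((‖C θ‖ ^ (1 / (α - 1) - 1) * f θ ^ (-1 / (α - 1)) : ℝ) : ℂ) * C θ := by
      rw [errorChar, spow_conj]; push_cast; ring
    have hpos : 0 < ‖C θ‖ ^ (1 / (α - 1) - 1) * f θ ^ (-1 / (α - 1)) := by positivity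
    have hnorm : ‖errorChar α f C θ‖ = ‖C θ‖ ^ (1 / (α - 1)) * f θ ^ (-1 / (α - 1)) := by
      rw [hcoef, norm_mul, Complex.norm_real, Real.norm_of_nonneg hpos.le, mul_right_comm,
        ← Real.rpow_add_one hn.ne']; ring_nf
    have hone : f θ * ‖errorChar α f C θ‖ ^ (α - 2)
        * (‖C θ‖ ^ (1 / (α - 1) - 1) * f θ ^ (-1 / (α - 1))) = 1 := by
      rw [hnorm, Real.mul_rpow (by positivity) (by positivity), ← Real.rpow_mul hn.le,
        ← Real.rpow_mul hf.le]
      have e1 : f θ * (‖C θ‖ ^ (1 / (α - 1) * (α - 2)) * f θ ^ (-1 / (α - 1) * (α - 2)))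
          * (‖C θ‖ ^ (1 / (α - 1) - 1) * f θ ^ (-1 / (α - 1)))
          = (f θ ^ (1 : ℝ) * f θ ^ (-1 / (α - 1) * (α - 2)) * f θ ^ (-1 / (α - 1)))
            * (‖C θ‖ ^ (1 / (α - 1) * (α - 2)) * ‖C θ‖ ^ (1 / (α - 1) - 1)) := by
        rw [Real.rpow_one]; ring
      rw [e1, ← Real.rpow_add hf, ← Real.rpow_add hf, ← Real.rpow_add hn]
      have e2 : 1 + -1 / (α - 1) * (α - 2) + -1 / (α - 1) = 0 := by field_simp; ring
      have e3 : 1 / (α - 1) * (α - 2) + (1 / (α - 1) - 1) = 0 := by field_simp; ring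
      rw [e2, e3]; simp
    rw [dualMap]
    nth_rewrite 2 [hcoef]
    rw [← mul_assoc, ← mul_assoc, ← Complex.ofReal_mul, ← Complex.ofReal_mul, hone]
    simp

lemma errorChar_of_eq {α : ℝ} (hα : 1 < α) {f : ℝ → ℝ} {C : ℝ → ℂ} {θ : ℝ} {e : ℂ}
    (hf : 0 < f θ) (hC : C θ = (f θ : ℂ) * dualMap α e) : errorChar α f C θ = e := by
  have h1 : α - 1 ≠ 0 := by linarith
  rcases eq_or_ne e 0 with rfl | he
  · simp [errorChar, spow, hC, dualMap]
  · have hn : 0 < ‖e‖ := norm_pos_iff.2 he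
    have hnorm : ‖C θ‖ = f θ * ‖e‖ ^ (α - 1) := by
      rw [hC, norm_mul, norm_dualMap hα, Complex.norm_real, Real.norm_of_nonneg hf.le]
    have hone : ‖C θ‖ ^ (1 / (α - 1) - 1) * (f θ * ‖e‖ ^ (α - 2)) * f θ ^ (-1 / (α - 1)) = 1 := by
      rw [hnorm, Real.mul_rpow hf.le (by positivity), ← Real.rpow_mul hn.le]
      have e1 : f θ ^ (1 / (α - 1) - 1) * ‖e‖ ^ ((α - 1) * (1 / (α - 1) - 1))
          * (f θ * ‖e‖ ^ (α - 2)) * f θ ^ (-1 / (α - 1))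
          = (f θ ^ (1 / (α - 1) - 1) * f θ ^ (1 : ℝ) * f θ ^ (-1 / (α - 1)))
            * (‖e‖ ^ ((α - 1) * (1 / (α - 1) - 1)) * ‖e‖ ^ (α - 2)) := by
        rw [Real.rpow_one]; ring
      rw [e1, ← Real.rpow_add hf, ← Real.rpow_add hf, ← Real.rpow_add hn]
      have e2 : 1 / (α - 1) - 1 + 1 + -1 / (α - 1) = 0 := by field_simp; ring
      have e3 : (α - 1) * (1 / (α - 1) - 1) + (α - 2) = 0 := by field_simp; ring
      rw [e2, e3]; simp
    have : errorChar α f C θ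
        = ((‖C θ‖ ^ (1 / (α - 1) - 1) * (f θ * ‖e‖ ^ (α - 2)) * f θ ^ (-1 / (α - 1)) : ℝ) : ℂ)
          * e := by
      rw [errorChar, spow_conj]
      nth_rewrite 2 [hC]
      rw [dualMap]; push_cast; ring
    rw [this, hone]; simp

/-- Strict monotonicity of the duality map. -/
lemma dualMap_monotone {α : ℝ} (hα : 1 < α) (x y : ℂ) :
    0 ≤ (conj (x - y) * (dualMap α x - dualMap α y)).re ∧
      ((conj (x - y) * (dualMap α x - dualMap α y)).re = 0 → x = y) := by
  have hsq (z : ℂ) : z.re * z.re + z.im * z.im = ‖z‖ * ‖z‖ := by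
    rw [← Complex.normSq_apply, Complex.normSq_eq_norm_sq]; ring
  have hr (z : ℂ) : ‖z‖ ^ (α - 2) * ‖z‖ = ‖z‖ ^ (α - 1) := by
    have := norm_dualMap hα z
    rwa [dualMap, norm_mul, Complex.norm_real, Real.norm_of_nonneg (by positivity)] at this
  set a := ‖x‖ ^ (α - 2) with ha
  set b := ‖y‖ ^ (α - 2) with hb
  have ha0 : 0 ≤ a := by positivity
  have hb0 : 0 ≤ b := by positivity
  set s := x.re * y.re + x.im * y.im with hs
  have hsle : s ≤ ‖x‖ * ‖y‖ := by
    have h1 : s = (conj x * y).re := by simp [hs]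
    rw [h1]
    refine (Complex.re_le_norm _).trans (le_of_eq ?_)
    rw [norm_mul, Complex.norm_conj]
  have hexp : (conj (x - y) * (dualMap α x - dualMap α y)).re
      = a * (‖x‖ * ‖x‖) + b * (‖y‖ * ‖y‖) - (a + b) * s := by
    rw [← hsq x, ← hsq y, hs]
    simp [dualMap, ← ha, ← hb]; ring
  have hlow : (a * ‖x‖ - b * ‖y‖) * (‖x‖ - ‖y‖)
      = a * (‖x‖ * ‖x‖) + b * (‖y‖ * ‖y‖) - (a + b) * (‖x‖ * ‖y‖) := by ring
  have hge : (a * ‖x‖ - b * ‖y‖) * (‖x‖ - ‖y‖)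
      ≤ (conj (x - y) * (dualMap α x - dualMap α y)).re := by
    rw [hexp, hlow]
    have := mul_le_mul_of_nonneg_left hsle (add_nonneg ha0 hb0)
    linarith
  have hmono : 0 ≤ (a * ‖x‖ - b * ‖y‖) * (‖x‖ - ‖y‖) ∧
      (‖x‖ ≠ ‖y‖ → 0 < (a * ‖x‖ - b * ‖y‖) * (‖x‖ - ‖y‖)) := by
    rw [ha, hb, hr, hr]
    rcases lt_trichotomy ‖x‖ ‖y‖ with h | h | h
    · have h1 := Real.rpow_lt_rpow (norm_nonneg x) h (by linarith : 0 < α - 1)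
      have := mul_pos_of_neg_of_neg (sub_neg.2 h1) (sub_neg.2 h)
      exact ⟨this.le, fun _ => this⟩
    · rw [h]; simp
    · have h1 := Real.rpow_lt_rpow (norm_nonneg y) h (by linarith : 0 < α - 1)
      have := mul_pos (sub_pos.2 h1) (sub_pos.2 h)
      exact ⟨this.le, fun _ => this⟩
  refine ⟨hmono.1.trans hge, fun h0 => ?_⟩
  have hxy : ‖x‖ = ‖y‖ := by
    by_contra hne
    linarith [hmono.2 hne]
  rcases eq_or_ne x 0 with hx | hx
  · rw [hx, norm_zero] at hxy
    rw [hx, norm_eq_zero.1 hxy.symm]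
  · have hx0 : 0 < ‖x‖ := norm_pos_iff.2 hx
    have hab : b = a := by rw [ha, hb, hxy]
    have hapos : 0 < a := Real.rpow_pos_of_pos hx0 _
    rw [hexp, hab, ← hxy] at h0
    have h1 : ‖x - y‖ * ‖x - y‖ = 2 * (‖x‖ * ‖x‖) - 2 * s := by
      rw [← hsq (x - y)]
      have e1 := hsq x
      have e2 := hsq y
      rw [← hxy] at e2
      simp only [Complex.sub_re, Complex.sub_im, hs]
      linarith
    have h2 : a * (‖x - y‖ * ‖x - y‖) = 0 := by rw [h1]; linarith
    have h3 := (mul_eq_zero.1 h2).resolve_left hapos.ne'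
    rw [mul_self_eq_zero, norm_eq_zero, sub_eq_zero] at h3
    exact h3

/-! ### The function `A`, and spectral densities that satisfy the minimality condition -/

lemma continuous_symbolA {a : ℕ → ℂ} (ha : Summable fun j => ‖a j‖) : Continuous (symbolA a) := by
  refine continuous_tsum (fun j => ?_) ha fun j θ => ?_
  · exact continuous_const.mul (continuous_chr j)
  · have := norm_chr j θ
    rw [norm_mul]
    simp only [chr, Int.cast_natCast] at this
    rw [this, mul_one]

lemma norm_symbolA_le {a : ℕ → ℂ} (ha : Summable fun j => ‖a j‖) (θ : ℝ) :
    ‖symbolA a θ‖ ≤ ∑' j, ‖a j‖ := by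
  refine tsum_of_norm_bounded ha.hasSum fun j => ?_
  have := norm_chr j θ
  simp only [chr, Int.cast_natCast] at this
  rw [norm_mul, this, mul_one]

lemma memLp_symbolA {a : ℕ → ℂ} (ha : Summable fun j => ‖a j‖) (p : ℝ≥0∞) (ρ : Measure ℝ)
    [IsFiniteMeasure ρ] : MemLp (symbolA a) p ρ :=
  MemLp.of_bound (continuous_symbolA ha).aestronglyMeasurable _
    (Eventually.of_forall (norm_symbolA_le ha))

/-- The assumptions on the spectral density: it is positive and integrable, and it satisfies the
minimality condition. -/
structure IsMinimalDensity (α : ℝ) (f : ℝ → ℝ) : Prop where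
  one_lt : 1 < α
  meas : AEMeasurable f arc
  pos : ∀ᵐ θ ∂arc, 0 < f θ
  integrable : Integrable f arc
  minimal : Integrable (fun θ => f θ ^ (-1 / (α - 1))) arc

namespace IsMinimalDensity

variable {α : ℝ} {f : ℝ → ℝ}

lemma isFiniteMeasure (hf : IsMinimalDensity α f) : IsFiniteMeasure (densityMeasure f) :=
  isFiniteMeasure_withDensity_ofReal hf.integrable.2

lemma arc_ac (hf : IsMinimalDensity α f) : arc ≪ densityMeasure f := by
  refine withDensity_absolutelyContinuous' hf.meas.ennreal_ofReal ?_
  filter_upwards [hf.pos] with θ hθ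
  simpa only [ne_eq, ENNReal.ofReal_eq_zero, not_le]

lemma ac_arc (f : ℝ → ℝ) : densityMeasure f ≪ arc := withDensity_absolutelyContinuous _ _

lemma integral_eq (hf : IsMinimalDensity α f) {E : Type*} [NormedAddCommGroup E]
    [NormedSpace ℝ E] (F : ℝ → E) :
    ∫ θ, F θ ∂(densityMeasure f) = ∫ θ, f θ • F θ ∂arc := by
  rw [densityMeasure, integral_withDensity_eq_integral_toReal_smul₀ hf.meas.ennreal_ofReal
    (by simp)]
  refine integral_congr_ae ?_
  filter_upwards [hf.pos] with θ hθ
  rw [ENNReal.toReal_ofReal hθ.le]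

lemma integrable_iff (hf : IsMinimalDensity α f) {E : Type*} [NormedAddCommGroup E]
    [NormedSpace ℝ E] (F : ℝ → E) :
    Integrable F (densityMeasure f) ↔ Integrable (fun θ => f θ • F θ) arc := by
  rw [densityMeasure, integrable_withDensity_iff_integrable_smul₀' hf.meas.ennreal_ofReal
    (by simp)]
  refine integrable_congr ?_
  filter_upwards [hf.pos] with θ hθ
  rw [ENNReal.toReal_ofReal hθ.le]

/-- Under the minimality condition `L^α(f)` embeds into `L¹`, by Hölder's inequality. -/
lemma integrable_of_memLp (hf : IsMinimalDensity α f) : ∃ K : ℝ, ∀ u : ℝ → ℂ,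
    MemLp u (ENNReal.ofReal α) (densityMeasure f) → Integrable u arc ∧
      ∫ θ, ‖u θ‖ ∂arc ≤ (eLpNorm u (ENNReal.ofReal α) (densityMeasure f)).toReal * K := by
  have hα := hf.one_lt
  have hα0 : 0 < α := by linarith
  have h1 : α - 1 ≠ 0 := by linarith
  set μ := densityMeasure f
  set q := α.conjExponent with hq
  have hpq : α.HolderConjugate q := Real.HolderConjugate.conjExponent hα
  have hq0 : 0 < q := hpq.symm.pos
  have hinvm : AEStronglyMeasurable (fun θ => (f θ)⁻¹) μ :=
    (hf.meas.inv.aestronglyMeasurable).mono_ac (ac_arc f)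
  have hqint : Integrable (fun θ => ‖(f θ)⁻¹‖ ^ q) μ := by
    rw [hf.integrable_iff]
    refine hf.minimal.congr ?_
    filter_upwards [hf.pos] with θ hθ
    rw [Real.norm_of_nonneg (by positivity), smul_eq_mul, Real.inv_rpow hθ.le,
      ← Real.rpow_neg hθ.le]
    nth_rewrite 2 [← Real.rpow_one (f θ)]
    rw [← Real.rpow_add hθ, hq, Real.conjExponent]
    congr 1
    field_simp; ring
  have hinv : MemLp (fun θ => (f θ)⁻¹) (ENNReal.ofReal q) μ := by
    rw [← integrable_norm_rpow_iff hinvm (by simpa using hq0) ENNReal.ofReal_ne_top,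
      ENNReal.toReal_ofReal hq0.le]
    exact hqint
  refine ⟨(∫ θ, (f θ)⁻¹ ^ q ∂μ) ^ (1 / q), fun u hu => ?_⟩
  have : ENNReal.HolderConjugate (ENNReal.ofReal α) (ENNReal.ofReal q) := by
    have := hpq.ennrealOfReal
    simpa using this
  have hmul : Integrable (fun θ => ‖u θ‖ * (f θ)⁻¹) μ := hu.norm.integrable_mul hinv
  have hum : AEStronglyMeasurable u arc := hu.1.mono_ac hf.arc_ac
  have hcancel : (fun θ => f θ • (‖u θ‖ * (f θ)⁻¹)) =ᵐ[arc] fun θ => ‖u θ‖ := by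
    filter_upwards [hf.pos] with θ hθ
    rw [smul_eq_mul]; field_simp
  refine ⟨?_, ?_⟩
  · rw [← integrable_norm_iff hum]
    exact ((hf.integrable_iff _).1 hmul).congr hcancel
  · rw [← integral_congr_ae hcancel, ← hf.integral_eq]
    have hnn : 0 ≤ᵐ[μ] fun θ => (f θ)⁻¹ := (ac_arc f).ae_le (by
      filter_upwards [hf.pos] with θ hθ
      exact (inv_pos.2 hθ).le)
    refine (integral_mul_le_Lp_mul_Lq_of_nonneg hpq
      (Eventually.of_forall fun θ => norm_nonneg _) hnn hu.norm hinv).trans (le_of_eq ?_)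
    rw [hu.eLpNorm_eq_integral_rpow_norm (ofReal_ne_zero_of_one_lt hα) ENNReal.ofReal_ne_top,
      ENNReal.toReal_ofReal (by positivity), ENNReal.toReal_ofReal hα0.le, one_div]

end IsMinimalDensity

/-! ### Best approximation in the past and the system of equations -/

lemma fact_one_le {α : ℝ} (hα : 1 < α) : Fact (1 ≤ ENNReal.ofReal α) :=
  ⟨by rw [← ENNReal.ofReal_one]; exact ENNReal.ofReal_le_ofReal hα.le⟩

/-- The closed span in `L^p(ρ)` of the characters `e^{ikθ}`, `k < 0`: the image of the past under
the spectral isometry. -/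
def pastLp (p : ℝ≥0∞) [Fact (1 ≤ p)] (ρ : Measure ℝ) [IsFiniteMeasure ρ] : Submodule ℂ (Lp ℂ p ρ) :=
  (Submodule.span ℂ (chrLp p ρ '' {k | k < 0})).topologicalClosure

namespace IsMinimalDensity

variable {α : ℝ} {f : ℝ → ℝ}

lemma integrable_of_memLp' (hf : IsMinimalDensity α f) {u : ℝ → ℂ}
    (hu : MemLp u (ENNReal.ofReal α) (densityMeasure f)) : Integrable u arc := by
  obtain ⟨K, hK⟩ := hf.integrable_of_memLp
  exact (hK u hu).1

/-- The Fourier coefficients of nonnegative index vanish on the closed span of the characters of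
negative index. -/
lemma integral_chr_mul_eq_zero (hf : IsMinimalDensity α f) [Fact (1 ≤ ENNReal.ofReal α)]
    [IsFiniteMeasure (densityMeasure f)] {F : Lp ℂ (ENNReal.ofReal α) (densityMeasure f)}
    (hF : F ∈ pastLp (ENNReal.ofReal α) (densityMeasure f)) {n : ℤ} (hn : n ≤ 0) :
    ∫ θ, chr n θ * F θ ∂arc = 0 := by
  obtain ⟨K, hK⟩ := hf.integrable_of_memLp
  have hint (G : Lp ℂ (ENNReal.ofReal α) (densityMeasure f)) :
      Integrable (fun θ => chr n θ * G θ) arc := chr_mul_integrable (hK G (Lp.memLp G)).1 n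
  let T : Lp ℂ (ENNReal.ofReal α) (densityMeasure f) →ₗ[ℂ] ℂ :=
    { toFun := fun G => ∫ θ, chr n θ * G θ ∂arc
      map_add' := fun G H => by
        rw [← integral_add (hint G) (hint H)]
        refine integral_congr_ae ?_
        filter_upwards [hf.arc_ac.ae_le (Lp.coeFn_add G H)] with θ h
        rw [h, Pi.add_apply, mul_add]
      map_smul' := fun c G => by
        simp only [RingHom.id_apply, smul_eq_mul]
        rw [← integral_const_mul]
        refine integral_congr_ae ?_
        filter_upwards [hf.arc_ac.ae_le (Lp.coeFn_smul c G)] with θ h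
        rw [h, Pi.smul_apply, smul_eq_mul, mul_left_comm] }
  let T' := T.mkContinuous K fun G => by
    refine (norm_integral_le_integral_norm _).trans ?_
    simp only [norm_mul, norm_chr, one_mul]
    rw [mul_comm]
    exact (hK G (Lp.memLp G)).2
  have hle : pastLp (ENNReal.ofReal α) (densityMeasure f)
      ≤ LinearMap.ker (T' : Lp ℂ (ENNReal.ofReal α) (densityMeasure f) →ₗ[ℂ] ℂ) := by
    refine Submodule.topologicalClosure_minimal _ ?_ T'.isClosed_ker
    rw [Submodule.span_le]
    rintro _ ⟨k, hk, rfl⟩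
    change ∫ θ, chr n θ * chrLp _ _ k θ ∂arc = 0
    have hk' : k < 0 := hk
    rw [← integral_chr_of_ne_zero (n := n + k) (by omega)]
    refine integral_congr_ae ?_
    filter_upwards [hf.arc_ac.ae_le (coeFn_chrLp (ENNReal.ofReal α) (densityMeasure f) k)] with θ h
    rw [h, chr_add]
  exact hle hF

/-- The error `e` of a best approximation in the past yields an integrable function
`C = |e|^{α-2} e f` without negative frequencies, by James orthogonality. -/
lemma dualMap_error (hf : IsMinimalDensity α f) [Fact (1 ≤ ENNReal.ofReal α)]
    [IsFiniteMeasure (densityMeasure f)] {A : ℝ → ℂ}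
    (hA : MemLp A (ENNReal.ofReal α) (densityMeasure f))
    {h : Lp ℂ (ENNReal.ofReal α) (densityMeasure f)}
    (hh : h ∈ pastLp (ENNReal.ofReal α) (densityMeasure f))
    (hmin : ∀ g ∈ pastLp (ENNReal.ofReal α) (densityMeasure f), ‖hA.toLp A - h‖ ≤ ‖hA.toLp A - g‖) :
    Integrable (fun θ => (f θ : ℂ) * dualMap α (A θ - h θ)) arc ∧
      ∀ n : ℤ, 0 < n → ∫ θ, chr n θ * ((f θ : ℂ) * dualMap α (A θ - h θ)) ∂arc = 0 := by
  have hα := hf.one_lt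
  have hα0 : 0 < α := by linarith
  set e : ℝ → ℂ := fun θ => A θ - h θ with he_def
  have he : MemLp e (ENNReal.ofReal α) (densityMeasure f) := hA.sub (Lp.memLp h)
  have hem : AEStronglyMeasurable e arc := he.1.mono_ac hf.arc_ac
  have hdm : AEStronglyMeasurable (fun θ => dualMap α (e θ)) arc :=
    (Complex.measurable_ofReal.comp_aemeasurable
      (hem.norm.aemeasurable.pow_const (α - 2))).aestronglyMeasurable.mul hem
  have hCm : AEStronglyMeasurable (fun θ => (f θ : ℂ) * dualMap α (e θ)) arc :=
    (Complex.measurable_ofReal.comp_aemeasurable hf.meas).aestronglyMeasurable.mul hdm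
  have hpowi : Integrable (fun θ => f θ * ‖e θ‖ ^ α) arc := by
    simpa only [smul_eq_mul] using (hf.integrable_iff _).1 (integrable_norm_rpow hα he)
  have hCi : Integrable (fun θ => (f θ : ℂ) * dualMap α (e θ)) arc := by
    refine Integrable.mono' (hf.integrable.add hpowi) hCm ?_
    filter_upwards [hf.pos] with θ hθ
    rw [norm_mul, norm_dualMap hα, Complex.norm_real, Real.norm_of_nonneg hθ.le, Pi.add_apply]
    have : ‖e θ‖ ^ (α - 1) ≤ 1 + ‖e θ‖ ^ α := by
      rcases le_total ‖e θ‖ 1 with h1 | h1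
      · have := Real.rpow_le_one (norm_nonneg (e θ)) h1 (by linarith : 0 ≤ α - 1)
        linarith [Real.rpow_nonneg (norm_nonneg (e θ)) α]
      · have := Real.rpow_le_rpow_of_exponent_le h1 (by linarith : α - 1 ≤ α)
        linarith
    nlinarith
  refine ⟨hCi, fun n hn => ?_⟩
  have hnormsub (g : Lp ℂ (ENNReal.ofReal α) (densityMeasure f)) (v : ℝ → ℂ)
      (hv : (fun θ => A θ - g θ) =ᵐ[densityMeasure f] v) :
      ‖hA.toLp A - g‖ ^ α = ∫ θ, ‖v θ‖ ^ α ∂(densityMeasure f) := by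
    rw [norm_Lp_rpow hα]
    refine integral_congr_ae ?_
    filter_upwards [Lp.coeFn_sub (hA.toLp A) g, hA.coeFn_toLp, hv] with θ h1 h2 h3
    rw [h1, Pi.sub_apply, h2, h3]
  have hvar (c : ℂ) :
      ∫ θ, ‖e θ‖ ^ (α - 2) * inner ℝ (e θ) (c * chr (-n) θ) ∂(densityMeasure f) = 0 := by
    refine integral_inner_eq_zero_of_isMin hα he
      ((memLp_chr _ (densityMeasure f) (-n)).const_mul c) fun t => ?_
    have hg : h - ((t : ℂ) * c) • chrLp (ENNReal.ofReal α) (densityMeasure f) (-n)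
        ∈ pastLp (ENNReal.ofReal α) (densityMeasure f) := by
      refine Submodule.sub_mem _ hh (Submodule.smul_mem _ _ ?_)
      exact Submodule.le_topologicalClosure _ (Submodule.subset_span
        ⟨-n, by simpa using hn, rfl⟩)
    have h1 := Real.rpow_le_rpow (norm_nonneg _) (hmin _ hg) hα0.le
    rw [hnormsub h e (Eventually.of_forall fun θ => rfl),
      hnormsub _ (fun θ => e θ + t • (c * chr (-n) θ))] at h1
    · exact h1
    · filter_upwards [
        Lp.coeFn_sub h (((t : ℂ) * c) • chrLp (ENNReal.ofReal α) (densityMeasure f) (-n)),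
        Lp.coeFn_smul ((t : ℂ) * c) (chrLp (ENNReal.ofReal α) (densityMeasure f) (-n)),
        coeFn_chrLp (ENNReal.ofReal α) (densityMeasure f) (-n)] with θ h1 h2 h3
      rw [h1, Pi.sub_apply, h2, Pi.smul_apply, h3, smul_eq_mul, Complex.real_smul, he_def]
      ring
  have hci := chr_mul_integrable hCi n
  have hinner (θ : ℝ) (c : ℂ) : f θ • (‖e θ‖ ^ (α - 2) * inner ℝ (e θ) (c * chr (-n) θ))
      = (conj c * (chr n θ * ((f θ : ℂ) * dualMap α (e θ)))).re := by
    rw [Complex.inner, ← Complex.conj_re (conj c * _)]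
    have : conj (conj c * (chr n θ * ((f θ : ℂ) * dualMap α (e θ))))
        = ((f θ * ‖e θ‖ ^ (α - 2) : ℝ) : ℂ) * (c * chr (-n) θ * conj (e θ)) := by
      simp only [map_mul, Complex.conj_conj, dualMap, Complex.conj_ofReal, conj_chr]
      push_cast; ring
    rw [this, Complex.re_ofReal_mul, smul_eq_mul]; ring
  have hre (c : ℂ) : (conj c * ∫ θ, chr n θ * ((f θ : ℂ) * dualMap α (e θ)) ∂arc).re = 0 := by
    rw [← integral_const_mul]
    have h1 := integral_re (hci.const_mul (conj c))
    simp only [RCLike.re_to_complex] at h1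
    rw [← h1, ← hvar c, hf.integral_eq]
    exact integral_congr_ae (Eventually.of_forall fun θ => (hinner θ c).symm)
  apply Complex.ext
  · simpa using hre 1
  · simpa using hre Complex.I

end IsMinimalDensity

lemma fourier_integral_eq (g : ℝ → ℂ) (n : ℤ) (E : ℝ → ℂ) (hE : ∀ θ, E θ = chr n θ) :
    ∫ θ in (-Real.pi)..Real.pi, E θ * g θ = ∫ θ, chr n θ * g θ ∂arc := by
  rw [intervalIntegral.integral_of_le (by linarith [Real.pi_pos])]
  simp only [hE]

lemma HasAnalyticSeries.integral_chr_mul {c : ℕ → ℂ} {C : ℝ → ℂ} (h : HasAnalyticSeries c C)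
    {n : ℤ} (hn : 0 < n) : ∫ θ, chr n θ * C θ ∂arc = 0 := by
  lift n to ℕ using hn.le
  rw [← h.coeff_neg n (by exact_mod_cast hn), ← fourier_integral_eq C n (chr n) (fun _ => rfl)]
  simp only [chr, Int.cast_natCast, mul_comm]

lemma SolvesSystem.integral_chr_mul {α : ℝ} {f : ℝ → ℝ} {a c : ℕ → ℂ} {C : ℝ → ℂ}
    (h : SolvesSystem α f a c C) {n : ℤ} (hn : n ≤ 0) :
    ∫ θ, chr n θ * spectralChar α f a C θ ∂arc = 0 := by
  obtain ⟨k, rfl⟩ : ∃ k : ℕ, n = -(k : ℤ) := ⟨n.natAbs, by omega⟩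
  rw [← h.system k]
  refine (fourier_integral_eq _ _ _ fun θ => ?_).symm
  simp only [chr]; push_cast; ring_nf

namespace IsMinimalDensity

variable {α : ℝ} {f : ℝ → ℝ}

/-- The best approximation of `A` in the past is the spectral characteristic of a solution of the
system. -/
lemma exists_solvesSystem (hf : IsMinimalDensity α f) {a : ℕ → ℂ}
    [Fact (1 ≤ ENNReal.ofReal α)] [IsFiniteMeasure (densityMeasure f)]
    (hA : MemLp (symbolA a) (ENNReal.ofReal α) (densityMeasure f)) :
    ∃ h ∈ pastLp (ENNReal.ofReal α) (densityMeasure f),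
      (∀ g ∈ pastLp (ENNReal.ofReal α) (densityMeasure f),
        ‖hA.toLp (symbolA a) - h‖ ≤ ‖hA.toLp (symbolA a) - g‖) ∧
      ∃ (c : ℕ → ℂ) (C : ℝ → ℂ), SolvesSystem α f a c C ∧ spectralChar α f a C =ᵐ[arc] h := by
  have hα := hf.one_lt
  obtain ⟨h, hh, hmin⟩ := exists_bestApprox hα (uniformlyRotund_Lp hα)
    (pastLp (ENNReal.ofReal α) (densityMeasure f)) (Submodule.isClosed_topologicalClosure _)
    (hA.toLp (symbolA a))
  obtain ⟨hCi, hC⟩ := hf.dualMap_error hA hh hmin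
  set C : ℝ → ℂ := fun θ => (f θ : ℂ) * dualMap α (symbolA a θ - h θ)
  have hchar : spectralChar α f a C =ᵐ[arc] h := by
    filter_upwards [hf.pos] with θ hθ
    rw [spectralChar, errorChar_of_eq hα hθ rfl, sub_sub_cancel]
  refine ⟨h, hh, hmin, _, C, ⟨⟨hCi, fun j => rfl, fun j hj => ?_⟩, ?_, fun k => ?_⟩, hchar⟩
  · rw [← hC j (by exact_mod_cast hj), ← fourier_integral_eq C j (chr j) (fun _ => rfl)]
    simp only [chr, Int.cast_natCast, mul_comm]
  · exact (memLp_congr_ae ((ac_arc f).ae_le hchar)).2 (Lp.memLp h)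
  · rw [fourier_integral_eq _ (-k) _ (fun θ => by simp only [chr]; push_cast; ring_nf),
      ← hf.integral_chr_mul_eq_zero hh (n := -k) (by simp)]
    refine integral_congr_ae ?_
    filter_upwards [hchar] with θ hθ
    rw [hθ]

lemma memLp_errorChar (hf : IsMinimalDensity α f) {a c : ℕ → ℂ} (ha : Summable fun j => ‖a j‖)
    {C : ℝ → ℂ} (h : SolvesSystem α f a c C) :
    MemLp (errorChar α f C) (ENNReal.ofReal α) (densityMeasure f) := by
  have := hf.isFiniteMeasure
  have h1 := (memLp_symbolA ha (ENNReal.ofReal α) (densityMeasure f)).sub h.memLp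
  refine (memLp_congr_ae (Eventually.of_forall fun θ => ?_)).1 h1
  simp [spectralChar]

/-- Two solutions of the system agree: by the orthogonality of spectra and the strict monotonicity
of the duality map, their error functions are equal almost everywhere. -/
lemma solvesSystem_unique (hf : IsMinimalDensity α f) {a : ℕ → ℂ} (ha : Summable fun j => ‖a j‖)
    {c₁ c₂ : ℕ → ℂ} {C₁ C₂ : ℝ → ℂ} (h₁ : SolvesSystem α f a c₁ C₁)
    (h₂ : SolvesSystem α f a c₂ C₂) :
    c₁ = c₂ ∧ spectralChar α f a C₁ =ᵐ[arc] spectralChar α f a C₂ := by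
  have hα := hf.one_lt
  have hα0 : 0 < α := by linarith
  have hfin := hf.isFiniteMeasure
  set e₁ := errorChar α f C₁ with he₁
  set e₂ := errorChar α f C₂ with he₂
  have hm₁ := hf.memLp_errorChar ha h₁
  have hm₂ := hf.memLp_errorChar ha h₂
  have hi₁ : Integrable C₁ arc := h₁.series.integrable
  have hi₂ : Integrable C₂ arc := h₂.series.integrable
  have hs₁ := hf.integrable_of_memLp' h₁.memLp
  have hs₂ := hf.integrable_of_memLp' h₂.memLp
  have hdiff (θ : ℝ) : e₁ θ - e₂ θ = spectralChar α f a C₂ θ - spectralChar α f a C₁ θ := by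
    simp only [spectralChar, he₁, he₂]; ring
  have hmono : ∀ᵐ θ ∂arc, 0 ≤ (conj (e₁ θ - e₂ θ) * (C₁ θ - C₂ θ)).re ∧
      ((conj (e₁ θ - e₂ θ) * (C₁ θ - C₂ θ)).re = 0 → e₁ θ = e₂ θ) := by
    filter_upwards [hf.pos] with θ hθ
    have hm := dualMap_monotone hα (e₁ θ) (e₂ θ)
    have hre : (conj (e₁ θ - e₂ θ) * (C₁ θ - C₂ θ)).re
        = f θ * (conj (e₁ θ - e₂ θ) * (dualMap α (e₁ θ) - dualMap α (e₂ θ))).re := by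
      rw [← mul_dualMap_errorChar hα (C := C₁) hθ, ← mul_dualMap_errorChar hα (C := C₂) hθ,
        ← mul_sub, mul_left_comm, Complex.re_ofReal_mul]
    rw [hre]
    exact ⟨mul_nonneg hθ.le hm.1, fun h0 => hm.2 ((mul_eq_zero.1 h0).resolve_left hθ.ne')⟩
  have hgi : Integrable (fun θ => conj (e₁ θ - e₂ θ)) arc := by
    have : Integrable (fun θ => spectralChar α f a C₂ θ - spectralChar α f a C₁ θ) arc :=
      hs₂.sub hs₁
    simp only [hdiff]
    exact (memLp_one_iff_integrable.1 (memLp_conj (memLp_one_iff_integrable.2 this)))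
  have hpow : Integrable (fun θ => f θ * (‖e₁ θ‖ + ‖e₂ θ‖) ^ α) arc := by
    have h1 := ((hm₁.norm.add hm₂.norm).integrable_norm_rpow (ofReal_ne_zero_of_one_lt hα)
      ENNReal.ofReal_ne_top)
    rw [ENNReal.toReal_ofReal hα0.le, hf.integrable_iff] at h1
    refine h1.congr (Eventually.of_forall fun θ => ?_)
    simp only [Pi.add_apply, smul_eq_mul]
    rw [Real.norm_of_nonneg (by positivity)]
  have hgw : Integrable (fun θ => conj (e₁ θ - e₂ θ) * (C₁ θ - C₂ θ)) arc := by
    refine Integrable.mono' (hpow.const_mul 2) (hgi.1.mul (hi₁.sub hi₂).1) ?_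
    filter_upwards [hf.pos] with θ hθ
    have hb (C : ℝ → ℂ) (hle : ‖errorChar α f C θ‖ ≤ ‖e₁ θ‖ + ‖e₂ θ‖) :
        ‖C θ‖ ≤ f θ * (‖e₁ θ‖ + ‖e₂ θ‖) ^ (α - 1) := by
      rw [← mul_dualMap_errorChar hα (C := C) hθ, norm_mul, norm_dualMap hα, Complex.norm_real,
        Real.norm_of_nonneg hθ.le]
      have : 0 ≤ α - 1 := by linarith
      gcongr
    have hb₁ := hb C₁ (by linarith [norm_nonneg (e₂ θ)])
    have hb₂ := hb C₂ (by linarith [norm_nonneg (e₁ θ)])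
    rw [norm_mul, RCLike.norm_conj]
    have hs : (‖e₁ θ‖ + ‖e₂ θ‖) * (‖e₁ θ‖ + ‖e₂ θ‖) ^ (α - 1) = (‖e₁ θ‖ + ‖e₂ θ‖) ^ α := by
      have h0 : 0 ≤ ‖e₁ θ‖ + ‖e₂ θ‖ := by positivity
      rcases h0.eq_or_lt with h | h
      · rw [← h, Real.zero_rpow hα0.ne', zero_mul]
      · rw [mul_comm, ← Real.rpow_add_one h.ne']; ring_nf
    calc ‖e₁ θ - e₂ θ‖ * ‖C₁ θ - C₂ θ‖
        ≤ (‖e₁ θ‖ + ‖e₂ θ‖) * (f θ * (‖e₁ θ‖ + ‖e₂ θ‖) ^ (α - 1)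
            + f θ * (‖e₁ θ‖ + ‖e₂ θ‖) ^ (α - 1)) := by
          refine mul_le_mul (norm_sub_le _ _) ((norm_sub_le _ _).trans (add_le_add hb₁ hb₂))
            (norm_nonneg _) (by positivity)
      _ = 2 * (f θ * ((‖e₁ θ‖ + ‖e₂ θ‖) * (‖e₁ θ‖ + ‖e₂ θ‖) ^ (α - 1))) := by ring
      _ = 2 * (f θ * (‖e₁ θ‖ + ‖e₂ θ‖) ^ α) := by rw [hs]
  have hzero : ∫ θ, conj (e₁ θ - e₂ θ) * (C₁ θ - C₂ θ) ∂arc = 0 := by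
    refine integral_mul_eq_zero_of_spectrum hgi (hi₁.sub hi₂) hgw (fun n hn => ?_) fun n hn => ?_
    · have h1 : ∫ θ, chr (-n) θ * (spectralChar α f a C₂ θ - spectralChar α f a C₁ θ) ∂arc = 0 := by
        simp only [mul_sub]
        rw [integral_sub (chr_mul_integrable hs₂ _) (chr_mul_integrable hs₁ _),
          h₁.integral_chr_mul (by omega), h₂.integral_chr_mul (by omega), sub_zero]
      have h2 := congrArg (starRingEnd ℂ) h1
      rw [← integral_conj, map_zero] at h2
      rw [← h2]
      refine integral_congr_ae (Eventually.of_forall fun θ => ?_)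
      simp only [map_mul, conj_chr, neg_neg, hdiff]
    · simp only [mul_sub]
      rw [integral_sub (chr_mul_integrable hi₁ _) (chr_mul_integrable hi₂ _),
        h₁.series.integral_chr_mul (by omega), h₂.series.integral_chr_mul (by omega), sub_zero]
  have hrez : ∫ θ, (conj (e₁ θ - e₂ θ) * (C₁ θ - C₂ θ)).re ∂arc = 0 := by
    have h1 := integral_re hgw
    simp only [RCLike.re_to_complex] at h1
    rw [h1, hzero, Complex.zero_re]
  have heq : ∀ᵐ θ ∂arc, e₁ θ = e₂ θ := by
    have h1 := (integral_eq_zero_iff_of_nonneg_ae (hmono.mono fun θ h => h.1) hgw.re).1 hrez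
    filter_upwards [hmono, h1] with θ h2 h3
    exact h2.2 h3
  have hCeq : C₁ =ᵐ[arc] C₂ := by
    filter_upwards [heq, hf.pos] with θ h1 h2
    rw [← mul_dualMap_errorChar hα (C := C₁) h2, ← mul_dualMap_errorChar hα (C := C₂) h2]
    simp only [he₁, he₂] at h1
    rw [h1]
  refine ⟨funext fun j => ?_, ?_⟩
  · rw [← h₁.series.coeff j, ← h₂.series.coeff j,
      intervalIntegral.integral_of_le (by linarith [Real.pi_pos]),
      intervalIntegral.integral_of_le (by linarith [Real.pi_pos])]
    congr 1
    refine integral_congr_ae ?_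
    filter_upwards [hCeq] with θ hθ
    rw [hθ]
  · filter_upwards [heq] with θ hθ
    have := hdiff θ
    rw [hθ, sub_self] at this
    exact (sub_eq_zero.1 this.symm).symm

end IsMinimalDensity

/-! ### Symmetric stable variables and their norm -/

section StableLaws

variable {Ω : Type*} [MeasurableSpace Ω] {P : Measure Ω} {α : ℝ} {X : Ω → ℂ} {Γ : Measure ℂ}

lemma IsStableSpectralMeasure.norm_eq_one (h : IsStableSpectralMeasure α P X Γ) :
    ∀ᵐ x ∂Γ, ‖x‖ = 1 := by
  have h1 : ∀ᵐ x ∂Γ, x ∈ Metric.sphere (0 : ℂ) 1 := by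
    rw [ae_iff]; exact h.sphere
  filter_upwards [h1] with x hx
  simpa using hx

lemma continuous_abs_inner_rpow (hα : 1 < α) (t : ℂ) :
    Continuous fun x : ℂ => |inner ℝ t x| ^ α :=
  (continuous_const.inner continuous_id).abs.rpow_const fun _ => .inr (by linarith)

lemma abs_inner_rpow_le (hα : 1 < α) (t x : ℂ) : |inner ℝ t x| ^ α ≤ (‖t‖ * ‖x‖) ^ α :=
  Real.rpow_le_rpow (abs_nonneg _) (abs_real_inner_le_norm t x) (by linarith)

lemma IsStableSpectralMeasure.integrable (hα : 1 < α) (h : IsStableSpectralMeasure α P X Γ)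
    (t : ℂ) : Integrable (fun x => |inner ℝ t x| ^ α) Γ := by
  have := h.finite
  refine Integrable.mono' (integrable_const (‖t‖ ^ α))
    (continuous_abs_inner_rpow hα t).aestronglyMeasurable ?_
  filter_upwards [h.norm_eq_one] with x hx
  rw [Real.norm_of_nonneg (by positivity)]
  simpa [hx] using abs_inner_rpow_le hα t x

/-- The integral over a period of `|cos φ|^α`. The exponent of a stable law, integrated over the
unit circle, is the product of this constant and the total mass of the spectral measure. -/
def circleMean (α : ℝ) : ℝ := ∫ φ in (-Real.pi)..Real.pi, |Real.cos φ| ^ α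

lemma circleMean_pos (hα : 1 < α) : 0 < circleMean α := by
  have hc : Continuous fun φ : ℝ => |Real.cos φ| ^ α :=
    Real.continuous_cos.abs.rpow_const fun _ => .inr (by linarith)
  refine intervalIntegral.integral_pos (by linarith [Real.pi_pos]) hc.continuousOn
    (fun _ _ => by positivity) ⟨0, ⟨by linarith [Real.pi_pos], Real.pi_pos.le⟩, by simp⟩

lemma integral_abs_inner_circle (x : ℂ) (hx : ‖x‖ = 1) :
    ∫ φ in (-Real.pi)..Real.pi, |inner ℝ (Complex.exp (φ * Complex.I)) x| ^ α = circleMean α := by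
  have hx' : x = Complex.exp (x.arg * Complex.I) := by
    have := Complex.norm_mul_exp_arg_mul_I x
    rw [hx, Complex.ofReal_one, one_mul] at this
    exact this.symm
  have h1 (φ : ℝ) : |inner ℝ (Complex.exp (φ * Complex.I)) x| ^ α
      = (fun s : ℝ => |Real.cos s| ^ α) (φ - x.arg) := by
    have : inner ℝ (Complex.exp (φ * Complex.I)) x = Real.cos (φ - x.arg) := by
      rw [Complex.inner, ← Complex.exp_conj]
      nth_rewrite 1 [hx']
      rw [← Complex.exp_add]
      have e : (x.arg : ℂ) * Complex.I + conj ((φ : ℂ) * Complex.I)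
          = ((x.arg - φ : ℝ) : ℂ) * Complex.I := by
        simp; ring
      rw [e, Complex.exp_ofReal_mul_I_re, ← Real.cos_neg, neg_sub]
    simp only [this]
  simp only [h1]
  rw [intervalIntegral.integral_comp_sub_right (fun s : ℝ => |Real.cos s| ^ α)]
  have hper : Function.Periodic (fun s : ℝ => |Real.cos s| ^ α) (2 * Real.pi) := fun s => by
    simp only [Real.cos_add_two_pi]
  have := hper.intervalIntegral_add_eq (-Real.pi - x.arg) (-Real.pi)
  rw [circleMean]
  convert this using 2 <;> ring

lemma IsStableSpectralMeasure.integral_circle (hα : 1 < α) (h : IsStableSpectralMeasure α P X Γ) :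
    ∫ φ in (-Real.pi)..Real.pi, (∫ x, |inner ℝ (Complex.exp (φ * Complex.I)) x| ^ α ∂Γ)
      = circleMean α * Γ.real Set.univ := by
  have := h.finite
  have hα0 : 0 ≤ α := by linarith
  rw [intervalIntegral.integral_of_le (by linarith [Real.pi_pos]), integral_integral_swap]
  · have : ∀ᵐ x ∂Γ, ∫ φ, |inner ℝ (Complex.exp (φ * Complex.I)) x| ^ α ∂arc = circleMean α := by
      filter_upwards [h.norm_eq_one] with x hx
      rw [← integral_abs_inner_circle x hx,
        intervalIntegral.integral_of_le (by linarith [Real.pi_pos])]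
    rw [integral_congr_ae this, integral_const, smul_eq_mul, mul_comm]
  · have h1 : Integrable (fun x : ℂ => ‖x‖ ^ α) Γ := by
      refine (integrable_const (1 : ℝ)).congr ?_
      filter_upwards [h.norm_eq_one] with x hx
      simp [hx]
    have h2 := (integrable_const (μ := arc) (1 : ℝ)).mul_prod h1
    refine Integrable.mono' h2 ?_ (Eventually.of_forall fun p => ?_)
    · refine Continuous.aestronglyMeasurable ?_
      have : Continuous fun p : ℝ × ℂ => inner ℝ (Complex.exp (p.1 * Complex.I)) p.2 := by
        refine Continuous.inner ?_ continuous_snd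
        fun_prop
      exact this.abs.rpow_const fun _ => .inr hα0
    · simp only [Function.uncurry]
      rw [Real.norm_of_nonneg (by positivity)]
      have := abs_inner_rpow_le hα (Complex.exp (p.1 * Complex.I)) p.2
      rwa [Complex.norm_exp_ofReal_mul_I, one_mul, ← one_mul (‖p.2‖ ^ α)] at this

lemma IsStableSpectralMeasure.exponent_eq {Γ' : Measure ℂ} (h : IsStableSpectralMeasure α P X Γ)
    (h' : IsStableSpectralMeasure α P X Γ') (t : ℂ) :
    ∫ x, |inner ℝ t x| ^ α ∂Γ = ∫ x, |inner ℝ t x| ^ α ∂Γ' := by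
  have h1 := (h.charFun_eq t).symm.trans (h'.charFun_eq t)
  rw [← Complex.ofReal_neg, ← Complex.ofReal_neg, ← Complex.ofReal_exp, ← Complex.ofReal_exp] at h1
  have h2 := Real.exp_injective (Complex.ofReal_injective h1)
  linarith

/-- All spectral measures of a stable variable have the same total mass. -/
lemma IsStableSpectralMeasure.mass_unique (hα : 1 < α) {Γ' : Measure ℂ}
    (h : IsStableSpectralMeasure α P X Γ) (h' : IsStableSpectralMeasure α P X Γ') :
    Γ Set.univ = Γ' Set.univ := by
  have := h.finite
  have := h'.finite
  have h1 := h.integral_circle hα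
  have h2 := h'.integral_circle hα
  simp only [h.exponent_eq h'] at h1
  have h3 := mul_left_cancel₀ (circleMean_pos hα).ne' (h1.symm.trans h2)
  rwa [measureReal_def, measureReal_def,
    ENNReal.toReal_eq_toReal_iff' (measure_ne_top _ _) (measure_ne_top _ _)] at h3

/-- `X` is a symmetric `α`-stable complex variable whose spectral measure has the total mass `M`,
so that `M = ‖X‖_α^α`. -/
def HasScale (α : ℝ) (P : Measure Ω) (X : Ω → ℂ) (M : ℝ≥0∞) : Prop :=
  ∃ Γ : Measure ℂ, IsStableSpectralMeasure α P X Γ ∧ Γ Set.univ = M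

lemma IsStableSpectralMeasure.lintegral_eq (h : IsStableSpectralMeasure α P X Γ) :
    ∫⁻ x, ‖x‖ₑ ^ α ∂Γ = Γ Set.univ := by
  rw [← lintegral_one]
  refine lintegral_congr_ae ?_
  filter_upwards [h.norm_eq_one] with x hx
  rw [← ofReal_norm, hx]; simp

lemma HasScale.stableNormPow_eq (hα : 1 < α) {M : ℝ≥0∞} (h : HasScale α P X M) :
    stableNormPow α P X = M := by
  obtain ⟨Γ, hΓ, rfl⟩ := h
  refine le_antisymm ((iInf₂_le Γ hΓ).trans hΓ.lintegral_eq.le) (le_iInf₂ fun Γ' hΓ' => ?_)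
  rw [hΓ'.lintegral_eq, hΓ.mass_unique hα hΓ']

lemma HasScale.aemeasurable {M : ℝ≥0∞} (h : HasScale α P X M) : AEMeasurable X P := by
  obtain ⟨Γ, hΓ, -⟩ := h
  exact hΓ.aemeasurable

lemma hasScale_stableNormPow (hα : 1 < α) (h : stableNormPow α P X ≠ ⊤) :
    HasScale α P X (stableNormPow α P X) := by
  have h1 := lt_top_iff_ne_top.2 h
  rw [stableNormPow, iInf_lt_iff] at h1
  obtain ⟨Γ, hΓ⟩ := h1
  rw [iInf_lt_iff] at hΓ
  obtain ⟨hΓ, -⟩ := hΓ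
  have : HasScale α P X (Γ Set.univ) := ⟨Γ, hΓ, rfl⟩
  rwa [this.stableNormPow_eq hα]

lemma charFun_map_eq (hX : AEMeasurable X P) (t : ℂ) :
    charFun (P.map X) t = ∫ ω, Complex.exp (inner ℝ (X ω) t * Complex.I) ∂P := by
  rw [charFun_apply, integral_map hX]
  refine Continuous.aestronglyMeasurable ?_
  have : Continuous fun x : ℂ => inner ℝ x t := continuous_id.inner continuous_const
  fun_prop

lemma hasScale_zero [IsProbabilityMeasure P] : HasScale α P (fun _ : Ω => (0 : ℂ)) 0 := by
  refine ⟨0, ⟨aemeasurable_const, inferInstance, by simp, by simp, fun t => ?_⟩, by simp⟩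
  rw [charFun_map_eq aemeasurable_const]; simp

lemma HasScale.const_mul (hα : 1 < α) {M : ℝ≥0∞} (h : HasScale α P X M) {c : ℂ} (hc : c ≠ 0) :
    HasScale α P (fun ω => c * X ω) (‖c‖ₑ ^ α * M) := by
  obtain ⟨Γ, hΓ, rfl⟩ := h
  have := hΓ.finite
  have hα0 : 0 ≤ α := by linarith
  have hc0 : 0 < ‖c‖ := norm_pos_iff.2 hc
  set r : ℂ := c / ‖c‖
  have hr : ‖r‖ = 1 := by simp [r, hc0.ne']
  have hmeas : Measurable fun x : ℂ => r * x := measurable_const_mul r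
  have hinner (x t : ℂ) : inner ℝ (c * x) t = inner ℝ x (conj c * t) := by
    simp only [Complex.inner, map_mul]; ring_nf
  have htop : ‖c‖ₑ ^ α ≠ ⊤ := by finiteness
  refine ⟨‖c‖ₑ ^ α • Γ.map (fun x => r * x), ⟨hΓ.aemeasurable.const_mul c, ?_, ?_, ?_, ?_⟩, ?_⟩
  · have := Measure.isFiniteMeasure_map Γ (fun x => r * x)
    exact Measure.smul_finite _ htop
  · rw [Measure.smul_apply, Measure.map_apply hmeas Metric.isClosed_sphere.measurableSet.compl]
    have : (fun x : ℂ => r * x) ⁻¹' (Metric.sphere 0 1)ᶜ = (Metric.sphere 0 1)ᶜ := by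
      ext x; simp [hr]
    rw [this, hΓ.sphere]; simp
  · rw [Measure.map_smul, Measure.map_map measurable_neg hmeas]
    congr 1
    nth_rewrite 2 [← hΓ.symmetric]
    rw [Measure.map_map hmeas measurable_neg]
    congr 1
    funext x; simp
  · intro t
    have h1 : charFun (P.map fun ω => c * X ω) t = charFun (P.map X) (conj c * t) := by
      rw [charFun_map_eq (hΓ.aemeasurable.const_mul c), charFun_map_eq hΓ.aemeasurable]
      simp only [hinner]
    rw [h1, hΓ.charFun_eq, integral_smul_measure, integral_map hmeas.aemeasurable
      (continuous_abs_inner_rpow hα t).aestronglyMeasurable, smul_eq_mul, ← integral_const_mul]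
    congr 3
    refine integral_congr_ae (Eventually.of_forall fun x => ?_)
    have h2 : inner ℝ (conj c * t) x = ‖c‖ * inner ℝ t (r * x) := by
      rw [real_inner_comm, ← hinner, real_inner_comm, ← inner_smul_right, Complex.real_smul]
      congr 1
      have : (‖c‖ : ℂ) ≠ 0 := by exact_mod_cast hc0.ne'
      simp only [r]; field_simp
    simp only
    rw [h2, abs_mul, abs_of_pos hc0, Real.mul_rpow hc0.le (abs_nonneg _), ← ENNReal.toReal_rpow,
      toReal_enorm]
  · rw [Measure.smul_apply, Measure.map_apply hmeas MeasurableSet.univ]; simp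

lemma HasScale.add {Y : Ω → ℂ} (hα : 1 < α) {M M' : ℝ≥0∞} (h : HasScale α P X M)
    (h' : HasScale α P Y M') (hXY : X ⟂ᵢ[P] Y) [IsProbabilityMeasure P] :
    HasScale α P (fun ω => X ω + Y ω) (M + M') := by
  obtain ⟨Γ, hΓ, rfl⟩ := h
  obtain ⟨Γ', hΓ', rfl⟩ := h'
  have := hΓ.finite
  have := hΓ'.finite
  refine ⟨Γ + Γ', ⟨hΓ.aemeasurable.add hΓ'.aemeasurable, inferInstance, ?_, ?_, fun t => ?_⟩, ?_⟩
  · simp [hΓ.sphere, hΓ'.sphere]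
  · rw [Measure.map_add _ _ measurable_neg, hΓ.symmetric, hΓ'.symmetric]
  · rw [hXY.charFun_map_fun_add_eq_mul hΓ.aemeasurable hΓ'.aemeasurable, Pi.mul_apply,
      hΓ.charFun_eq, hΓ'.charFun_eq, ← Complex.exp_add,
      integral_add_measure (hΓ.integrable hα t) (hΓ'.integrable hα t)]
    congr 1
    push_cast; ring
  · simp

lemma HasScale.sum [IsProbabilityMeasure P] (hα : 1 < α) {X : ℕ → Ω → ℂ} {M : ℕ → ℝ≥0∞}
    (h : ∀ i, HasScale α P (X i) (M i)) (hind : iIndepFun X P) (n : ℕ) :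
    HasScale α P (fun ω => ∑ i ∈ Finset.range n, X i ω) (∑ i ∈ Finset.range n, M i) := by
  induction n with
  | zero => simpa using hasScale_zero
  | succ n ih =>
    simp only [Finset.sum_range_succ]
    refine ih.add hα (h n) ?_
    have := hind.indepFun_finsetSum_of_notMem₀ (fun i => (h i).aemeasurable)
      (s := Finset.range n) (i := n) (by simp)
    convert this using 1
    funext ω; simp

end StableLaws

/-! ### Limits of stable variables -/

section InMeasure

variable {Ω : Type*} [MeasurableSpace Ω] {P : Measure Ω} {ι : Type*} {l : Filter ι}

lemma tendstoInMeasure_add {X X' : ι → Ω → ℂ} {Y Y' : Ω → ℂ} (h : TendstoInMeasure P X l Y)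
    (h' : TendstoInMeasure P X' l Y') :
    TendstoInMeasure P (fun i ω => X i ω + X' i ω) l (fun ω => Y ω + Y' ω) := by
  rw [tendstoInMeasure_iff_norm] at *
  intro ε hε
  have h1 := (h (ε / 2) (by positivity)).add (h' (ε / 2) (by positivity))
  rw [add_zero] at h1
  refine tendsto_of_tendsto_of_tendsto_of_le_of_le tendsto_const_nhds h1 (fun _ => zero_le)
    fun i => ?_
  refine (measure_mono fun ω hω => ?_).trans (measure_union_le _ _)
  simp only [Set.mem_ofPred_eq, Set.mem_union] at hω ⊢
  by_contra! hcon
  have h2 : X i ω + X' i ω - (Y ω + Y' ω) = (X i ω - Y ω) + (X' i ω - Y' ω) := by ring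
  rw [h2] at hω
  linarith [norm_add_le (X i ω - Y ω) (X' i ω - Y' ω)]

lemma tendstoInMeasure_const_mul {X : ι → Ω → ℂ} {Y : Ω → ℂ} (h : TendstoInMeasure P X l Y)
    (c : ℂ) : TendstoInMeasure P (fun i ω => c * X i ω) l (fun ω => c * Y ω) := by
  rw [tendstoInMeasure_iff_norm] at *
  intro ε hε
  refine tendsto_of_tendsto_of_tendsto_of_le_of_le tendsto_const_nhds
    (h (ε / (‖c‖ + 1)) (by positivity)) (fun _ => zero_le) fun i => measure_mono fun ω hω => ?_
  simp only [Set.mem_ofPred_eq] at hω ⊢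
  rw [← mul_sub, norm_mul] at hω
  rw [div_le_iff₀ (by positivity)]
  nlinarith [norm_nonneg (X i ω - Y ω), norm_nonneg c]

lemma tendsto_charFun_of_tendstoInMeasure [IsProbabilityMeasure P] [l.IsCountablyGenerated]
    {X : ι → Ω → ℂ} {Y : Ω → ℂ} (h : TendstoInMeasure P X l Y) (hX : ∀ i, AEMeasurable (X i) P)
    (hY : AEMeasurable Y P) (t : ℂ) :
    Tendsto (fun i => charFun (P.map (X i)) t) l (𝓝 (charFun (P.map Y) t)) := by
  have h1 := (ProbabilityMeasure.tendsto_iff_forall_integral_rclike_tendsto ℂ).1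
    (h.tendstoInDistribution_of_aemeasurable hX hY).tendsto
  simp_rw [charFun_eq_integral_innerProbChar]
  exact h1 (BoundedContinuousFunction.innerProbChar t)

end InMeasure

section Limits

variable {Ω : Type*} [MeasurableSpace Ω] {P : Measure Ω} {α : ℝ}

lemma HasScale.charFun_eq_exp {X : Ω → ℂ} {M : ℝ≥0∞} (hα : 1 < α) (h : HasScale α P X M) (t : ℂ) :
    ∃ s : ℝ, 0 ≤ s ∧ s ≤ ‖t‖ ^ α * M.toReal ∧ charFun (P.map X) t = Complex.exp (-(s : ℂ)) := by
  obtain ⟨Γ, hΓ, rfl⟩ := h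
  have := hΓ.finite
  refine ⟨_, integral_nonneg fun x => by positivity, ?_, hΓ.charFun_eq t⟩
  have h1 : ∫ x, |inner ℝ t x| ^ α ∂Γ ≤ ∫ _x, ‖t‖ ^ α ∂Γ := by
    refine integral_mono_ae (hΓ.integrable hα t) (integrable_const _) ?_
    filter_upwards [hΓ.norm_eq_one] with x hx
    simpa [hx] using abs_inner_rpow_le hα t x
  rwa [integral_const, smul_eq_mul, mul_comm, measureReal_def] at h1

/-- The tail of a stable variable is controlled by its norm `‖·‖_α`. -/
lemma HasScale.measure_norm_ge_le [IsProbabilityMeasure P] {X : Ω → ℂ} {M : ℝ≥0∞} (hα : 1 < α)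
    (h : HasScale α P X M) {r : ℝ} (hr : 0 < r) :
    P.real {ω | r ≤ ‖X ω‖} ≤ 4 * (8 / r) ^ α * M.toReal := by
  have hXm := h.aemeasurable
  have hprob : IsProbabilityMeasure (P.map X) := Measure.isProbabilityMeasure_map hXm
  have hdir (a : ℂ) (ha : ‖a‖ = 1) :
      (P.map X).real {x | r / 4 < |inner ℝ a x|} ≤ 2 * (8 / r) ^ α * M.toReal := by
    refine (measureReal_abs_inner_gt_le_integral_charFun (by positivity)).trans ?_
    have h1 : ∀ t ∈ Set.uIoc (-2 * (r / 4)⁻¹) (2 * (r / 4)⁻¹),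
        ‖1 - charFun (P.map X) (t • a)‖ ≤ (8 / r) ^ α * M.toReal := by
      intro t ht
      rw [Set.uIoc_of_le (by have : 0 < (r / 4)⁻¹ := by positivity
                             linarith)] at ht
      obtain ⟨s, hs0, hs1, hs2⟩ := h.charFun_eq_exp hα (t • a)
      rw [hs2, ← Complex.ofReal_neg, ← Complex.ofReal_exp, ← Complex.ofReal_one,
        ← Complex.ofReal_sub, Complex.norm_real, Real.norm_of_nonneg
          (sub_nonneg.2 (Real.exp_le_one_iff.2 (by linarith)))]
      have h2 : 1 - Real.exp (-s) ≤ s := by linarith [Real.add_one_le_exp (-s)]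
      refine h2.trans (hs1.trans ?_)
      have h3 : ‖t • a‖ ≤ 8 / r := by
        rw [norm_smul, ha, mul_one, Real.norm_eq_abs, abs_le]
        have h4 : 2 * (r / 4)⁻¹ = 8 / r := by field_simp; norm_num
        constructor <;> linarith [ht.1, ht.2]
      have : 0 ≤ α := by linarith
      gcongr
    have h2 := intervalIntegral.norm_integral_le_of_norm_le_const h1
    have h3 : |2 * (r / 4)⁻¹ - -2 * (r / 4)⁻¹| = 16 / r := by
      rw [abs_of_nonneg]
      · field_simp; norm_num
      · have : 0 < (r / 4)⁻¹ := by positivity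
        linarith
    rw [h3] at h2
    calc 2⁻¹ * (r / 4) * ‖∫ t in -2 * (r / 4)⁻¹..2 * (r / 4)⁻¹, 1 - charFun (P.map X) (t • a)‖
        ≤ 2⁻¹ * (r / 4) * ((8 / r) ^ α * M.toReal * (16 / r)) := by gcongr
      _ = 2 * (8 / r) ^ α * M.toReal := by field_simp; ring
  have hpre (a : ℂ) : P.real {ω | r / 4 < |inner ℝ a (X ω)|}
      = (P.map X).real {x | r / 4 < |inner ℝ a x|} := by
    have hms : MeasurableSet {x : ℂ | r / 4 < |inner ℝ a x|} :=
      (isOpen_lt continuous_const (continuous_const.inner continuous_id).abs).measurableSet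
    rw [measureReal_def, measureReal_def, Measure.map_apply_of_aemeasurable hXm hms]
    rfl
  have hsub : {ω | r ≤ ‖X ω‖} ⊆
      {ω | r / 4 < |inner ℝ (1 : ℂ) (X ω)|} ∪ {ω | r / 4 < |inner ℝ Complex.I (X ω)|} := by
    intro ω hω
    simp only [Set.mem_ofPred_eq, Set.mem_union] at hω ⊢
    by_contra! hcon
    have h1 : inner ℝ (1 : ℂ) (X ω) = (X ω).re := by simp [Complex.inner]
    have h2 : inner ℝ Complex.I (X ω) = (X ω).im := by simp [Complex.inner]
    rw [h1, h2] at hcon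
    linarith [Complex.norm_le_abs_re_add_abs_im (X ω), hcon.1, hcon.2]
  calc P.real {ω | r ≤ ‖X ω‖}
      ≤ P.real ({ω | r / 4 < |inner ℝ (1 : ℂ) (X ω)|} ∪
          {ω | r / 4 < |inner ℝ Complex.I (X ω)|}) := measureReal_mono hsub
    _ ≤ _ := measureReal_union_le _ _
    _ ≤ 2 * (8 / r) ^ α * M.toReal + 2 * (8 / r) ^ α * M.toReal := by
        rw [hpre, hpre]
        exact add_le_add (hdir 1 (by simp)) (hdir _ (by simp))
    _ = 4 * (8 / r) ^ α * M.toReal := by ring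

/-- Convergence in the norm `‖·‖_α` implies convergence in probability. -/
lemma tendstoInMeasure_of_stableNormPow [IsProbabilityMeasure P] {ι : Type*} {l : Filter ι}
    (hα : 1 < α) {X : ι → Ω → ℂ} {Y : Ω → ℂ}
    (h : Tendsto (fun i => stableNormPow α P (fun ω => Y ω - X i ω)) l (𝓝 0)) :
    TendstoInMeasure P X l Y := by
  rw [tendstoInMeasure_iff_measureReal_norm]
  intro ε hε
  have h1 : ∀ᶠ i in l, stableNormPow α P (fun ω => Y ω - X i ω) ≠ ⊤ := by
    filter_upwards [h.eventually (gt_mem_nhds ENNReal.zero_lt_top)] with i hi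
    exact hi.ne
  have h2 : Tendsto (fun i => 4 * (8 / ε) ^ α * (stableNormPow α P (fun ω => Y ω - X i ω)).toReal) l
      (𝓝 0) := by
    have := ((ENNReal.tendsto_toReal ENNReal.zero_ne_top).comp h).const_mul (4 * (8 / ε) ^ α)
    simpa using this
  refine tendsto_of_tendsto_of_tendsto_of_le_of_le' tendsto_const_nhds h2
    (Eventually.of_forall fun _ => measureReal_nonneg) ?_
  filter_upwards [h1] with i hi
  have := (hasScale_stableNormPow hα hi).measure_norm_ge_le hα hε
  simpa only [norm_sub_rev] using this

/-- On stable variables, convergence in probability to `0` implies convergence in `‖·‖_α`: the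
exponent at two orthogonal unit vectors dominates the mass of the spectral measure. -/
lemma tendsto_scale_zero [IsProbabilityMeasure P] {ι : Type*} {l : Filter ι}
    [l.IsCountablyGenerated] (hα : 1 < α) (hα2 : α ≤ 2) {X : ι → Ω → ℂ} {M : ι → ℝ≥0∞}
    (h : ∀ i, HasScale α P (X i) (M i)) (h0 : TendstoInMeasure P X l (fun _ => 0)) :
    Tendsto M l (𝓝 0) := by
  choose Γ hΓ hM using h
  have hlim (t : ℂ) : Tendsto (fun i => ∫ x, |inner ℝ t x| ^ α ∂(Γ i)) l (𝓝 0) := by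
    have h1 := tendsto_charFun_of_tendstoInMeasure h0 (fun i => (hΓ i).aemeasurable)
      aemeasurable_const t
    have h2 : charFun (P.map fun _ : Ω => (0 : ℂ)) t = 1 := by
      rw [charFun_map_eq aemeasurable_const]; simp
    simp only [h2, (hΓ _).charFun_eq] at h1
    have h3 := (Real.continuousAt_log (by simp : ‖(1 : ℂ)‖ ≠ 0)).tendsto.comp h1.norm
    have h4 : (Real.log ∘ fun i => ‖Complex.exp (-((∫ x, |inner ℝ t x| ^ α ∂(Γ i) : ℝ) : ℂ))‖)
        = fun i => -∫ x, |inner ℝ t x| ^ α ∂(Γ i) := by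
      funext i
      rw [Function.comp_apply, ← Complex.ofReal_neg, Complex.norm_exp_ofReal, Real.log_exp]
    rw [h4] at h3
    simpa using h3.neg
  have hle (i : ι) : M i ≤ ENNReal.ofReal
      ((∫ x, |inner ℝ (1 : ℂ) x| ^ α ∂(Γ i)) + ∫ x, |inner ℝ Complex.I x| ^ α ∂(Γ i)) := by
    have := (hΓ i).finite
    have h1 : (Γ i).real Set.univ
        ≤ (∫ x, |inner ℝ (1 : ℂ) x| ^ α ∂(Γ i)) + ∫ x, |inner ℝ Complex.I x| ^ α ∂(Γ i) := by
      rw [← integral_add ((hΓ i).integrable hα _) ((hΓ i).integrable hα _)]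
      have : (Γ i).real Set.univ = ∫ _x, (1 : ℝ) ∂(Γ i) := by simp
      rw [this]
      refine integral_mono_ae (integrable_const _)
        (((hΓ i).integrable hα _).add ((hΓ i).integrable hα _)) ?_
      filter_upwards [(hΓ i).norm_eq_one] with x hx
      have h1 : inner ℝ (1 : ℂ) x = x.re := by simp [Complex.inner]
      have h2 : inner ℝ Complex.I x = x.im := by simp [Complex.inner]
      rw [h1, h2]
      have hpow (b : ℝ) (hb : |b| ≤ 1) : b ^ 2 ≤ |b| ^ α := by
        rw [← sq_abs, ← Real.rpow_natCast]
        rcases (abs_nonneg b).eq_or_lt with h | h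
        · rw [← h, Real.zero_rpow (by norm_num), Real.zero_rpow (by linarith)]
        · exact Real.rpow_le_rpow_of_exponent_ge h hb (by exact_mod_cast hα2)
      have h3 := hpow x.re (hx ▸ Complex.abs_re_le_norm x)
      have h4 := hpow x.im (hx ▸ Complex.abs_im_le_norm x)
      have h5 : x.re ^ 2 + x.im ^ 2 = 1 := by
        have := Complex.normSq_eq_norm_sq x
        rw [hx, Complex.normSq_apply] at this
        linarith
      linarith
    rw [← hM i, ← ENNReal.ofReal_toReal (measure_ne_top (Γ i) Set.univ)]
    exact ENNReal.ofReal_le_ofReal h1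
  have h1 := ENNReal.tendsto_ofReal ((hlim 1).add (hlim Complex.I))
  rw [add_zero, ENNReal.ofReal_zero] at h1
  exact tendsto_of_tendsto_of_tendsto_of_le_of_le tendsto_const_nhds h1 (fun _ => zero_le) hle

/-- The unit circle as a subtype of `ℂ`. -/
abbrev UnitCircle : Type := Metric.sphere (0 : ℂ) 1

/-- A spectral measure is a multiple of a probability measure on the circle. -/
lemma IsStableSpectralMeasure.exists_probabilityMeasure {X : Ω → ℂ} {Γ : Measure ℂ}
    (h : IsStableSpectralMeasure α P X Γ) : ∃ ν : ProbabilityMeasure UnitCircle,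
      ∀ g : ℂ → ℝ, ∫ x, g x ∂Γ
        = Γ.real Set.univ * ∫ x : UnitCircle, g x ∂(ν : Measure UnitCircle) := by
  have := h.finite
  have hS : MeasurableSet (Metric.sphere (0 : ℂ) 1) := Metric.isClosed_sphere.measurableSet
  by_cases h0 : Γ Set.univ = 0
  · refine ⟨⟨Measure.dirac ⟨1, by simp⟩, inferInstance⟩, fun g => ?_⟩
    rw [Measure.measure_univ_eq_zero.1 h0]; simp
  · set ν : Measure UnitCircle := (Γ Set.univ)⁻¹ • Γ.comap Subtype.val with hν
    have hcomap : Γ.comap (Subtype.val : UnitCircle → ℂ) Set.univ = Γ Set.univ := by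
      rw [comap_subtype_coe_apply hS, Set.image_univ, Subtype.range_coe]
      exact measure_of_measure_compl_eq_zero h.sphere
    have hp : IsProbabilityMeasure ν := ⟨by
      rw [hν, Measure.smul_apply, hcomap, smul_eq_mul,
        ENNReal.inv_mul_cancel h0 (measure_ne_top _ _)]⟩
    refine ⟨⟨ν, hp⟩, fun g => ?_⟩
    rw [ProbabilityMeasure.coe_mk, hν, integral_smul_measure, integral_subtype_comap hS,
      Measure.restrict_eq_self_of_ae_mem (by rw [ae_iff]; exact h.sphere), smul_eq_mul,
      ← mul_assoc, ENNReal.toReal_inv, measureReal_def, mul_inv_cancel₀, one_mul]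
    exact (ENNReal.toReal_pos h0 (measure_ne_top _ _)).ne'

/-- A variable with the exponent of a stable law is stable: the measure on the circle becomes
symmetric by averaging it with its reflection. -/
lemma hasScale_of_charFun [IsProbabilityMeasure P] (hα : 1 < α) {X : Ω → ℂ} (hX : AEMeasurable X P)
    (ν : ProbabilityMeasure UnitCircle) {M : ℝ≥0∞} (hM : M ≠ ⊤)
    (h : ∀ t : ℂ, charFun (P.map X) t = Complex.exp
      (-((M.toReal *
        ∫ x : UnitCircle, |inner ℝ t (x : ℂ)| ^ α ∂(ν : Measure UnitCircle) : ℝ) : ℂ))) :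
    HasScale α P X M := by
  have hval : Measurable (Subtype.val : UnitCircle → ℂ) := measurable_subtype_coe
  set ν₁ : Measure ℂ := (ν : Measure UnitCircle).map Subtype.val with hν₁
  have hp₁ : IsProbabilityMeasure ν₁ := Measure.isProbabilityMeasure_map hval.aemeasurable
  set ν₂ : Measure ℂ := ν₁.map (fun x => -x) with hν₂
  have hp₂ : IsProbabilityMeasure ν₂ := Measure.isProbabilityMeasure_map measurable_neg.aemeasurable
  have hS : MeasurableSet (Metric.sphere (0 : ℂ) 1)ᶜ := Metric.isClosed_sphere.measurableSet.compl
  have hs₁ : ν₁ (Metric.sphere (0 : ℂ) 1)ᶜ = 0 := by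
    rw [hν₁, Measure.map_apply hval hS]
    have : (Subtype.val : UnitCircle → ℂ) ⁻¹' (Metric.sphere (0 : ℂ) 1)ᶜ = ∅ := by
      ext x; simp
    rw [this, measure_empty]
  have hs₂ : ν₂ (Metric.sphere (0 : ℂ) 1)ᶜ = 0 := by
    rw [hν₂, Measure.map_apply measurable_neg hS]
    have : (fun x : ℂ => -x) ⁻¹' (Metric.sphere 0 1)ᶜ = (Metric.sphere 0 1)ᶜ := by ext x; simp
    rw [this, hs₁]
  have hM2 : M / 2 ≠ ⊤ := ENNReal.div_ne_top hM (by norm_num)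
  refine ⟨(M / 2) • (ν₁ + ν₂), ⟨hX, Measure.smul_finite _ hM2, by simp [hs₁, hs₂], ?_,
    fun t => ?_⟩, ?_⟩
  · rw [Measure.map_smul, Measure.map_add _ _ measurable_neg]
    have : ν₂.map (fun x => -x) = ν₁ := by
      rw [hν₂, Measure.map_map measurable_neg measurable_neg]
      simp
    rw [this, ← hν₂, add_comm]
  · have hcont := continuous_abs_inner_rpow hα t
    have hi₁ : Integrable (fun x => |inner ℝ t x| ^ α) ν₁ := by
      refine Integrable.mono' (integrable_const (‖t‖ ^ α)) hcont.aestronglyMeasurable ?_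
      have : ∀ᵐ x ∂ν₁, x ∈ Metric.sphere (0 : ℂ) 1 := by rw [ae_iff]; exact hs₁
      filter_upwards [this] with x hx
      rw [Real.norm_of_nonneg (by positivity)]
      have hx' : ‖x‖ = 1 := by simpa using hx
      simpa [hx'] using abs_inner_rpow_le hα t x
    have hi₂ : Integrable (fun x => |inner ℝ t x| ^ α) ν₂ := by
      rw [hν₂, integrable_map_measure hcont.aestronglyMeasurable measurable_neg.aemeasurable]
      simpa only [Function.comp_def, inner_neg_right, abs_neg] using hi₁
    rw [h t, integral_smul_measure, integral_add_measure hi₁ hi₂]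
    have h2 : ∫ x, |inner ℝ t x| ^ α ∂ν₂ = ∫ x, |inner ℝ t x| ^ α ∂ν₁ := by
      rw [hν₂, integral_map measurable_neg.aemeasurable hcont.aestronglyMeasurable]
      simp only [inner_neg_right, abs_neg]
    have h1 : ∫ x, |inner ℝ t x| ^ α ∂ν₁
        = ∫ x : UnitCircle, |inner ℝ t (x : ℂ)| ^ α ∂(ν : Measure UnitCircle) := by
      rw [hν₁, integral_map hval.aemeasurable hcont.aestronglyMeasurable]
    rw [h2, h1, smul_eq_mul, ENNReal.toReal_div]
    congr 3
    simp; ring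
  · simp only [Measure.smul_apply, Measure.add_apply, measure_univ, smul_eq_mul]
    norm_num
    exact ENNReal.div_mul_cancel (by norm_num) (by norm_num)

/-- Symmetric stable variables are closed under limits in probability with convergent norms, by
the compactness of the space of probability measures on the circle. -/
lemma HasScale.of_tendsto [IsProbabilityMeasure P] (hα : 1 < α) {X : ℕ → Ω → ℂ} {M : ℕ → ℝ≥0∞}
    (h : ∀ k, HasScale α P (X k) (M k)) {L : ℝ≥0∞} (hM : Tendsto M atTop (𝓝 L)) (hL : L ≠ ⊤)
    {Y : Ω → ℂ} (hY : TendstoInMeasure P X atTop Y) : HasScale α P Y L := by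
  have hYm : AEMeasurable Y P := hY.aemeasurable fun k => (h k).aemeasurable
  have hchar := tendsto_charFun_of_tendstoInMeasure hY (fun k => (h k).aemeasurable) hYm
  choose Γ hΓ hmass using h
  choose ν hν using fun k => (hΓ k).exists_probabilityMeasure
  -- a limit of the normalized spectral measures along an ultrafilter
  let U : Ultrafilter ℕ := Ultrafilter.of atTop
  have hU : (U : Filter ℕ) ≤ atTop := Ultrafilter.of_le atTop
  obtain ⟨ν₀, -, hν₀⟩ := isCompact_univ.ultrafilter_le_nhds (U.map ν) (by simp)
  have hν₀' : Tendsto ν U (𝓝 ν₀) := hν₀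
  refine hasScale_of_charFun hα hYm ν₀ hL fun t => ?_
  let g : BoundedContinuousFunction UnitCircle ℝ := BoundedContinuousFunction.mkOfCompact
    ⟨fun x => |inner ℝ t (x : ℂ)| ^ α, (continuous_abs_inner_rpow hα t).comp continuous_subtype_val⟩
  have h1 := ProbabilityMeasure.tendsto_iff_forall_integral_tendsto.1 hν₀' g
  have h2 : Tendsto (fun k => (M k).toReal) U (𝓝 L.toReal) :=
    ((ENNReal.tendsto_toReal hL).comp hM).mono_left hU
  have h3 : Tendsto (fun k => charFun (P.map (X k)) t) U (𝓝 (Complex.exp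
      (-((L.toReal *
        ∫ x : UnitCircle, |inner ℝ t (x : ℂ)| ^ α ∂(ν₀ : Measure UnitCircle) : ℝ) : ℂ)))) := by
    have h4 := (Complex.continuous_exp.tendsto _).comp
      ((Complex.continuous_ofReal.tendsto _).comp (h2.mul h1)).neg
    refine h4.congr fun k => ?_
    rw [(hΓ k).charFun_eq, hν k, measureReal_def, hmass k]
    rfl
  exact tendsto_nhds_unique ((hchar t).mono_left hU) h3

end Limits

/-! ### Step functions and their integrals -/

section Steps

variable {Ω : Type*} (Z : Circ → Ω → ℂ)

/-- The pair of the indicator function of `(s, t]` and of the increment of `Z` over `(s, t]`. -/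
def incrementPair (s t : Circ) : (ℝ → ℂ) × (Ω → ℂ) :=
  ((Set.Ioc (s : ℝ) (t : ℝ)).indicator fun _ => 1, fun ω => Z t ω - Z s ω)

/-- The step functions with breakpoints `t`, paired with their integrals, as linear images of their
values. -/
def stepMap (n : ℕ) (t : ℕ → Circ) : (ℕ → ℂ) →ₗ[ℂ] (ℝ → ℂ) × (Ω → ℂ) where
  toFun a := ∑ k ∈ Finset.range n, a k • incrementPair Z (t k) (t (k + 1))
  map_add' a b := by simp only [Pi.add_apply, add_smul, Finset.sum_add_distrib]
  map_smul' c a := by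
    simp only [Pi.smul_apply, smul_eq_mul, mul_smul, Finset.smul_sum, RingHom.id_apply]

lemma stepMap_apply (n : ℕ) (t : ℕ → Circ) (a : ℕ → ℂ) :
    stepMap Z n t a = (stepFun n t a, stepIntegral Z n t a) := by
  have h : stepMap Z n t a = ∑ k ∈ Finset.range n, a k • incrementPair Z (t k) (t (k + 1)) := rfl
  rw [h]
  refine Prod.ext ?_ ?_
  · rw [Prod.fst_sum]
    funext θ
    simp only [incrementPair, Prod.smul_fst, Finset.sum_apply, Pi.smul_apply, stepFun,
      Set.indicator_apply, smul_eq_mul, mul_ite, mul_one, mul_zero]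
  · rw [Prod.snd_sum]
    funext ω
    simp only [incrementPair, Prod.smul_snd, Finset.sum_apply, Pi.smul_apply, stepIntegral,
      smul_eq_mul]

/-- `S` is the integral of the step function `φ`. -/
def IsStep (φ : ℝ → ℂ) (S : Ω → ℂ) : Prop :=
  ∃ (n : ℕ) (t : ℕ → Circ) (a : ℕ → ℂ), Monotone t ∧ φ = stepFun n t a ∧ S = stepIntegral Z n t a

lemma incrementPair_add {r s t : Circ} (hrs : r ≤ s) (hst : s ≤ t) :
    incrementPair Z r s + incrementPair Z s t = incrementPair Z r t := by
  refine Prod.ext ?_ ?_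
  · funext θ
    have h1 : (r : ℝ) ≤ s := hrs
    have h2 : (s : ℝ) ≤ t := hst
    simp only [incrementPair, Prod.fst_add, Pi.add_apply, Set.indicator_apply, Set.mem_Ioc]
    split_ifs <;> grind
  · funext ω
    simp [incrementPair]

lemma incrementPair_self (s : Circ) : incrementPair Z s s = 0 := by
  refine Prod.ext ?_ ?_
  · funext θ; simp [incrementPair]
  · funext ω; simp [incrementPair]

lemma incrementPair_mem_range {n : ℕ} {t : ℕ → Circ} (ht : Monotone t) {i j : ℕ} (hij : i ≤ j)
    (hj : j ≤ n) : incrementPair Z (t i) (t j) ∈ LinearMap.range (stepMap Z n t) := by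
  induction j, hij using Nat.le_induction with
  | base => rw [incrementPair_self]; exact Submodule.zero_mem _
  | succ j hij ih =>
    rw [← incrementPair_add Z (ht hij) (ht (Nat.le_succ j))]
    refine Submodule.add_mem _ (ih (by omega)) ⟨Pi.single j 1, ?_⟩
    change ∑ k ∈ Finset.range n, (Pi.single j 1 : ℕ → ℂ) k • incrementPair Z (t k) (t (k + 1)) = _
    rw [Finset.sum_eq_single j]
    · simp
    · intro k _ hk; simp [hk]
    · intro hk; exact absurd (Finset.mem_range.2 (by omega)) hk

/-- A finite set of breakpoints is enumerated by a monotone sequence. -/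
lemma exists_monotone_enum (F : Finset Circ) (hF : F.Nonempty) :
    ∃ (n : ℕ) (t : ℕ → Circ), Monotone t ∧ ∀ s ∈ F, ∃ i ≤ n, t i = s := by
  have hc : 0 < F.card := hF.card_pos
  let e := F.orderEmbOfFin rfl
  refine ⟨F.card - 1, fun k => e ⟨min k (F.card - 1), by omega⟩, fun i j hij => ?_, fun s hs => ?_⟩
  · refine e.monotone ?_
    simp only [Fin.mk_le_mk]
    omega
  · have : s ∈ Set.range e := by rw [Finset.range_orderEmbOfFin]; exact hs
    obtain ⟨i, rfl⟩ := this
    have hi := i.2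
    refine ⟨i, by omega, congrArg e (Fin.ext ?_)⟩
    change min (i : ℕ) (F.card - 1) = i
    omega

/-- Two step functions have a common refinement. -/
lemma IsStep.add_const_mul {φ φ' : ℝ → ℂ} {S S' : Ω → ℂ} (h : IsStep Z φ S) (h' : IsStep Z φ' S')
    (c : ℂ) : IsStep Z (fun θ => φ θ + c * φ' θ) (fun ω => S ω + c * S' ω) := by
  obtain ⟨n, t, a, ht, rfl, rfl⟩ := h
  obtain ⟨n', t', a', ht', rfl, rfl⟩ := h'
  obtain ⟨N, τ, hτ, hF⟩ := exists_monotone_enum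
    ((Finset.range (n + 1)).image t ∪ (Finset.range (n' + 1)).image t')
    ⟨t 0, by simp only [Finset.mem_union, Finset.mem_image, Finset.mem_range]
             exact .inl ⟨0, by omega, rfl⟩⟩
  have hinc {s r : Circ} (hsr : s ≤ r) (hs : ∃ i ≤ N, τ i = s) (hr : ∃ i ≤ N, τ i = r) :
      incrementPair Z s r ∈ LinearMap.range (stepMap Z N τ) := by
    obtain ⟨i, hi, rfl⟩ := hs
    obtain ⟨j, hj, rfl⟩ := hr
    rcases le_total i j with hij | hij
    · exact incrementPair_mem_range Z hτ hij hj
    · rw [le_antisymm hsr (hτ hij), incrementPair_self]; exact Submodule.zero_mem _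
  have h1 : stepMap Z n t a ∈ LinearMap.range (stepMap Z N τ) := by
    change ∑ k ∈ Finset.range n, a k • incrementPair Z (t k) (t (k + 1)) ∈ _
    refine Submodule.sum_mem _ fun k hk => Submodule.smul_mem _ _ (hinc (ht (Nat.le_succ k)) ?_ ?_)
    all_goals
      refine hF _ ?_
      simp only [Finset.mem_union, Finset.mem_image, Finset.mem_range] at hk ⊢
    · exact .inl ⟨k, by omega, rfl⟩
    · exact .inl ⟨k + 1, by omega, rfl⟩
  have h2 : stepMap Z n' t' a' ∈ LinearMap.range (stepMap Z N τ) := by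
    change ∑ k ∈ Finset.range n', a' k • incrementPair Z (t' k) (t' (k + 1)) ∈ _
    refine Submodule.sum_mem _ fun k hk => Submodule.smul_mem _ _ (hinc (ht' (Nat.le_succ k)) ?_ ?_)
    all_goals
      refine hF _ ?_
      simp only [Finset.mem_union, Finset.mem_image, Finset.mem_range] at hk ⊢
    · exact .inr ⟨k, by omega, rfl⟩
    · exact .inr ⟨k + 1, by omega, rfl⟩
  obtain ⟨b, hb⟩ := Submodule.add_mem _ h1 (Submodule.smul_mem _ c h2)
  rw [stepMap_apply, stepMap_apply, stepMap_apply] at hb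
  refine ⟨N, τ, b, hτ, ?_, ?_⟩
  · exact (congrArg Prod.fst hb).symm
  · exact (congrArg Prod.snd hb).symm

lemma stepFun_apply {n : ℕ} {t : ℕ → Circ} (ht : Monotone t) (a : ℕ → ℂ) {k : ℕ} (hk : k < n)
    {θ : ℝ} (hθ : θ ∈ Set.Ioc (t k : ℝ) (t (k + 1))) : stepFun n t a θ = a k := by
  rw [stepFun, Finset.sum_eq_single k]
  · simp [Set.indicator_of_mem hθ]
  · intro j _ hj
    refine Set.indicator_of_notMem (fun hθ' => ?_) _
    rcases lt_or_gt_of_ne hj with h | h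
    · have : (t (j + 1) : ℝ) ≤ t k := ht h
      linarith [hθ'.2, hθ.1]
    · have : (t (k + 1) : ℝ) ≤ t j := ht h
      linarith [hθ'.1, hθ.2]
  · intro h; exact absurd (Finset.mem_range.2 hk) h

lemma enorm_stepFun_rpow {n : ℕ} {t : ℕ → Circ} (ht : Monotone t) (a : ℕ → ℂ) {α : ℝ} (hα : 0 < α)
    (θ : ℝ) : ‖stepFun n t a θ‖ₑ ^ α = ∑ k ∈ Finset.range n,
      (Set.Ioc (t k : ℝ) (t (k + 1))).indicator (fun _ => ‖a k‖ₑ ^ α) θ := by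
  by_cases h : ∃ k < n, θ ∈ Set.Ioc (t k : ℝ) (t (k + 1))
  · obtain ⟨k, hk, hθ⟩ := h
    rw [stepFun_apply ht a hk hθ, Finset.sum_eq_single k]
    · simp [Set.indicator_of_mem hθ]
    · intro j _ hj
      refine Set.indicator_of_notMem (fun hθ' => ?_) _
      rcases lt_or_gt_of_ne hj with h | h
      · have : (t (j + 1) : ℝ) ≤ t k := ht h
        linarith [hθ'.2, hθ.1]
      · have : (t (k + 1) : ℝ) ≤ t j := ht h
        linarith [hθ'.1, hθ.2]
    · intro h; exact absurd (Finset.mem_range.2 hk) h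
  · push Not at h
    have h1 : stepFun n t a θ = 0 :=
      Finset.sum_eq_zero fun k hk => Set.indicator_of_notMem (h k (Finset.mem_range.1 hk)) _
    rw [h1, Finset.sum_eq_zero fun k hk =>
      Set.indicator_of_notMem (h k (Finset.mem_range.1 hk)) _]
    simp [hα]

lemma measurable_stepFun (n : ℕ) (t : ℕ → Circ) (a : ℕ → ℂ) : Measurable (stepFun n t a) :=
  Finset.measurable_fun_sum _ fun _ _ => measurable_const.indicator measurableSet_Ioc

lemma memLp_stepFun (n : ℕ) (t : ℕ → Circ) (a : ℕ → ℂ) (p : ℝ≥0∞) (μ : Measure ℝ)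
    [IsFiniteMeasure μ] : MemLp (stepFun n t a) p μ := by
  refine MemLp.of_bound (measurable_stepFun n t a).aestronglyMeasurable
    (∑ k ∈ Finset.range n, ‖a k‖) (Eventually.of_forall fun θ => ?_)
  refine (norm_sum_le _ _).trans (Finset.sum_le_sum fun k _ => ?_)
  exact norm_indicator_le_norm_self _ _

lemma exists_mem_Ioc_of_mem {t : ℕ → Circ} {n : ℕ} {θ : ℝ} (h : θ ∈ Set.Ioc (t 0 : ℝ) (t n)) :
    ∃ k < n, θ ∈ Set.Ioc (t k : ℝ) (t (k + 1)) := by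
  induction n with
  | zero => exact absurd h (by simp)
  | succ n ih =>
    by_cases hn : θ ≤ t n
    · obtain ⟨k, hk, hθ⟩ := ih ⟨h.1, hn⟩
      exact ⟨k, by omega, hθ⟩
    · exact ⟨n, by omega, not_le.1 hn, h.2⟩

/-- Step functions are dense in `L^p` of a finite measure carried by `(-π, π]`. -/
lemma exists_isStep_eLpNorm_le {μ : Measure ℝ} [IsFiniteMeasure μ] {p : ℝ≥0∞} (hp : 1 ≤ p)
    (hp' : p ≠ ⊤) (hμ : μ (Set.Ioc (-Real.pi) Real.pi)ᶜ = 0) {u : ℝ → ℂ} (hu : MemLp u p μ)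
    {ε : ℝ≥0∞} (hε : ε ≠ 0) :
    ∃ φ S, IsStep Z φ S ∧ eLpNorm (fun θ => φ θ - u θ) p μ ≤ ε := by
  have hε2 : ε / 2 ≠ 0 := by simpa using hε
  obtain ⟨g, hgs, hgu, hgc, -⟩ := hu.exists_hasCompactSupport_eLpNorm_sub_le hp' hε2
  have hK : μ Set.univ ^ p.toReal⁻¹ ≠ ⊤ := by
    have := measure_ne_top μ Set.univ
    finiteness
  obtain ⟨η, hη, hηε⟩ := ENNReal.exists_nnreal_pos_mul_lt hK hε2
  obtain ⟨δ, hδ, hgδ⟩ := Metric.uniformContinuous_iff.1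
    (hgc.uniformContinuous_of_tendsto_cocompact hgs.is_zero_at_infty) η (by exact_mod_cast hη)
  have hπ := Real.pi_pos
  obtain ⟨n, hn⟩ := exists_nat_gt (2 * Real.pi / δ)
  have hn0 : 0 < (n : ℝ) := lt_of_le_of_lt (by positivity) hn
  let t : ℕ → Circ := fun k => ⟨min (-Real.pi + 2 * Real.pi * k / n) Real.pi,
    le_min (by have : 0 ≤ 2 * Real.pi * k / n := by positivity
               linarith) (by linarith), min_le_right _ _⟩
  have ht : Monotone t := fun i j hij => by
    have : (i : ℝ) ≤ j := by exact_mod_cast hij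
    refine Subtype.mk_le_mk.2 (min_le_min_right _ ?_)
    gcongr
  refine ⟨_, _, ⟨n, t, fun k => g (t k), ht, rfl, rfl⟩, ?_⟩
  have hclose : ∀ᵐ θ ∂μ, ‖stepFun n t (fun k => g (t k)) θ - g θ‖ ≤ η := by
    have hae : ∀ᵐ θ ∂μ, θ ∈ Set.Ioc (-Real.pi) Real.pi := by rw [ae_iff]; exact hμ
    filter_upwards [hae] with θ hθ
    have ht0 : (t 0 : ℝ) = -Real.pi := by simp [t]; linarith
    have htn : (t n : ℝ) = Real.pi := by
      simp only [t]
      rw [mul_div_cancel_right₀ _ hn0.ne']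
      exact min_eq_right (by linarith)
    obtain ⟨k, hk, hkθ⟩ := exists_mem_Ioc_of_mem (t := t) (n := n) (by rw [ht0, htn]; exact hθ)
    rw [stepFun_apply ht _ hk hkθ, ← dist_eq_norm]
    refine (hgδ ?_).le
    rw [Real.dist_eq, abs_sub_comm, abs_of_pos (by linarith [hkθ.1])]
    have h1 : (t (k + 1) : ℝ) ≤ -Real.pi + 2 * Real.pi * (k + 1 : ℕ) / n := min_le_left _ _
    have h2 : (t k : ℝ) = -Real.pi + 2 * Real.pi * k / n := by
      refine min_eq_left ?_
      have h3 : (k : ℝ) ≤ n := by exact_mod_cast hk.le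
      have h4 : 2 * Real.pi * k / n ≤ 2 * Real.pi := by
        rw [div_le_iff₀ hn0]; gcongr
      linarith
    have h5 : 2 * Real.pi * (k + 1 : ℕ) / n = 2 * Real.pi * k / n + 2 * Real.pi / n := by
      push_cast; ring
    have h6 : 2 * Real.pi / n < δ := by
      rw [div_lt_iff₀ hn0]; rw [div_lt_iff₀ hδ] at hn; linarith
    linarith [hkθ.2]
  have hgm : AEStronglyMeasurable g μ := hgc.aestronglyMeasurable
  have h1 : eLpNorm (fun θ => stepFun n t (fun k => g (t k)) θ - g θ) p μ ≤ ε / 2 := by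
    refine (eLpNorm_le_of_ae_bound hclose).trans ?_
    rw [mul_comm, ENNReal.ofReal_coe_nnreal]
    exact hηε.le
  have h2 : (fun θ => stepFun n t (fun k => g (t k)) θ - u θ)
      = (fun θ => stepFun n t (fun k => g (t k)) θ - g θ) - (u - g) := by
    funext θ; simp
  rw [h2]
  calc _ ≤ eLpNorm (fun θ => stepFun n t (fun k => g (t k)) θ - g θ) p μ + eLpNorm (u - g) p μ :=
        eLpNorm_sub_le ((measurable_stepFun _ _ _).aestronglyMeasurable.sub hgm) (hu.1.sub hgm) hp
    _ ≤ ε / 2 + ε / 2 := add_le_add h1 hgu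
    _ = ε := ENNReal.add_halves ε

end Steps

/-! ### The integral with respect to a stable noise -/

section Integral

variable {Ω : Type*} [MeasurableSpace Ω] {P : Measure Ω} {α : ℝ} {Z : Circ → Ω → ℂ}
  {μ : Measure ℝ}

/-- `Z` has independent symmetric `α`-stable increments with finite spectral measure `μ` on
`(-π, π]`: what is needed of `Z` in order to integrate with respect to it. -/
structure IsStableNoise (α : ℝ) (P : Measure Ω) (Z : Circ → Ω → ℂ) (μ : Measure ℝ) : Prop where
  one_lt : 1 < α
  le_two : α ≤ 2
  indep : HasIndepIncrements Z P
  finite : IsFiniteMeasure μ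
  carrier : μ (Set.Ioc (-Real.pi) Real.pi)ᶜ = 0
  spectral : ∀ s t : Circ, s ≤ t →
    μ (Set.Ioc (s : ℝ) (t : ℝ)) = stableNormPow α P (fun ω => Z t ω - Z s ω)

lemma IsStableNoise.one_le (hZ : IsStableNoise α P Z μ) : 1 ≤ ENNReal.ofReal α :=
  ENNReal.one_le_ofReal.2 hZ.one_lt.le

lemma eLpNorm_rpow_eq_lintegral (hα : 1 < α) (u : ℝ → ℂ) :
    eLpNorm u (ENNReal.ofReal α) μ ^ α = ∫⁻ θ, ‖u θ‖ₑ ^ α ∂μ := by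
  have hα0 : 0 < α := by linarith
  rw [eLpNorm_eq_lintegral_rpow_enorm_toReal (ofReal_ne_zero_of_one_lt hα) ENNReal.ofReal_ne_top,
    ENNReal.toReal_ofReal hα0.le, ← ENNReal.rpow_mul, one_div, inv_mul_cancel₀ hα0.ne',
    ENNReal.rpow_one]

/-- The map from step functions to their integrals preserves `‖·‖_α`. -/
lemma IsStep.hasScale [IsProbabilityMeasure P] (hZ : IsStableNoise α P Z μ) {φ : ℝ → ℂ} {S : Ω → ℂ}
    (h : IsStep Z φ S) : HasScale α P S (eLpNorm φ (ENNReal.ofReal α) μ ^ α) := by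
  obtain ⟨n, t, a, ht, rfl, rfl⟩ := h
  have hα0 : 0 < α := by linarith [hZ.one_lt]
  have := hZ.finite
  have hinc (k : ℕ) : HasScale α P (fun ω => Z (t (k + 1)) ω - Z (t k) ω)
      (μ (Set.Ioc (t k : ℝ) (t (k + 1)))) := by
    have h1 := hZ.spectral (t k) (t (k + 1)) (ht (Nat.le_succ k))
    rw [h1]
    exact hasScale_stableNormPow hZ.one_lt (by rw [← h1]; exact measure_ne_top _ _)
  have hk (k : ℕ) : HasScale α P (fun ω => a k * (Z (t (k + 1)) ω - Z (t k) ω))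
      (‖a k‖ₑ ^ α * μ (Set.Ioc (t k : ℝ) (t (k + 1)))) := by
    by_cases h0 : a k = 0
    · simpa [h0, hα0] using hasScale_zero
    · exact (hinc k).const_mul hZ.one_lt h0
  have hind : iIndepFun (fun k ω => a k * (Z (t (k + 1)) ω - Z (t k) ω)) P :=
    (hZ.indep.nat ht).comp (fun k x => a k * x) fun k => measurable_const_mul (a k)
  have hsum := HasScale.sum hZ.one_lt hk hind n
  have hnorm : eLpNorm (stepFun n t a) (ENNReal.ofReal α) μ ^ α
      = ∑ k ∈ Finset.range n, ‖a k‖ₑ ^ α * μ (Set.Ioc (t k : ℝ) (t (k + 1))) := by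
    rw [eLpNorm_rpow_eq_lintegral hZ.one_lt]
    simp_rw [enorm_stepFun_rpow ht a hα0]
    rw [lintegral_finsetSum _ fun k _ => measurable_const.indicator measurableSet_Ioc]
    exact Finset.sum_congr rfl fun k _ => lintegral_indicator_const measurableSet_Ioc _
  rw [hnorm]
  exact hsum

/-- `Y = ∫ u dZ`, as a limit in probability of integrals of step functions that converge to `u` in
`L^α(μ)`. In contrast to `‖·‖_α`, convergence in probability makes sense without knowing that the
variables in question are stable. -/
def IsProbIntegral (α : ℝ) (P : Measure Ω) (Z : Circ → Ω → ℂ) (μ : Measure ℝ) (u : ℝ → ℂ)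
    (Y : Ω → ℂ) : Prop :=
  MemLp u (ENNReal.ofReal α) μ ∧ ∃ (φ : ℕ → ℝ → ℂ) (S : ℕ → Ω → ℂ), (∀ m, IsStep Z (φ m) (S m)) ∧
    Tendsto (fun m => eLpNorm (fun θ => φ m θ - u θ) (ENNReal.ofReal α) μ) atTop (𝓝 0) ∧
    TendstoInMeasure P S atTop Y

variable {u u' : ℝ → ℂ} {Y Y' : Ω → ℂ}

lemma IsStep.memLp (hZ : IsStableNoise α P Z μ) {φ : ℝ → ℂ} {S : Ω → ℂ} (h : IsStep Z φ S) :
    MemLp φ (ENNReal.ofReal α) μ := by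
  obtain ⟨n, t, a, ht, rfl, rfl⟩ := h
  have := hZ.finite
  exact memLp_stepFun n t a _ μ

lemma IsStep.isProbIntegral (hZ : IsStableNoise α P Z μ) {φ : ℝ → ℂ} {S : Ω → ℂ}
    (h : IsStep Z φ S) : IsProbIntegral α P Z μ φ S := by
  refine ⟨h.memLp hZ, fun _ => φ, fun _ => S, fun _ => h, ?_, ?_⟩
  · simp
  · rw [tendstoInMeasure_iff_norm]
    intro ε hε
    simp [not_le.2 hε]

lemma IsStableIntegral.isProbIntegral [IsProbabilityMeasure P] (hα : 1 < α)
    (h : IsStableIntegral α P Z μ u Y) : IsProbIntegral α P Z μ u Y := by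
  obtain ⟨hu, n, t, a, ht, h1, h2⟩ := h
  exact ⟨hu, _, _, fun m => ⟨n m, t m, a m, ht m, rfl, rfl⟩, h1,
    tendstoInMeasure_of_stableNormPow hα h2⟩

lemma IsProbIntegral.add_const_mul (hZ : IsStableNoise α P Z μ) (h : IsProbIntegral α P Z μ u Y)
    (h' : IsProbIntegral α P Z μ u' Y') (c : ℂ) :
    IsProbIntegral α P Z μ (fun θ => u θ + c * u' θ) (fun ω => Y ω + c * Y' ω) := by
  obtain ⟨hu, φ, S, hS, h1, h2⟩ := h
  obtain ⟨hu', φ', S', hS', h1', h2'⟩ := h'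
  refine ⟨hu.add (hu'.const_mul c), _, _, fun m => (hS m).add_const_mul Z (hS' m) c, ?_,
    tendstoInMeasure_add h2 (tendstoInMeasure_const_mul h2' c)⟩
  have h3 : Tendsto (fun m => eLpNorm (fun θ => φ m θ - u θ) (ENNReal.ofReal α) μ
      + ‖c‖ₑ * eLpNorm (fun θ => φ' m θ - u' θ) (ENNReal.ofReal α) μ) atTop (𝓝 0) := by
    simpa using h1.add (ENNReal.Tendsto.const_mul h1' (.inr (enorm_ne_top (x := c))))
  refine tendsto_of_tendsto_of_tendsto_of_le_of_le tendsto_const_nhds h3 (fun _ => zero_le)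
    fun m => ?_
  have h4 : (fun θ => φ m θ + c * φ' m θ - (u θ + c * u' θ))
      = (fun θ => φ m θ - u θ) + c • fun θ => φ' m θ - u' θ := by
    funext θ; simp only [Pi.add_apply, Pi.smul_apply, smul_eq_mul]; ring
  have hm := ((hS m).memLp hZ).sub hu
  have hm' := ((hS' m).memLp hZ).sub hu'
  simp only []
  rw [h4, ← eLpNorm_const_smul]
  exact eLpNorm_add_le hm.1 (hm'.1.const_smul c) hZ.one_le

lemma IsProbIntegral.sub (hZ : IsStableNoise α P Z μ) (h : IsProbIntegral α P Z μ u Y)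
    (h' : IsProbIntegral α P Z μ u' Y') :
    IsProbIntegral α P Z μ (fun θ => u θ - u' θ) (fun ω => Y ω - Y' ω) := by
  simpa [sub_eq_add_neg] using h.add_const_mul hZ h' (-1)

lemma isProbIntegral_zero (hZ : IsStableNoise α P Z μ) :
    IsProbIntegral α P Z μ (fun _ => 0) (fun _ => 0) := by
  have h : IsStep Z (stepFun 0 (fun _ => ⟨0, by simp [Real.pi_pos.le]⟩) 0)
      (stepIntegral Z 0 (fun _ => ⟨0, by simp [Real.pi_pos.le]⟩) 0) :=
    ⟨0, _, _, monotone_const, rfl, rfl⟩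
  simpa using (h.isProbIntegral hZ).sub hZ (h.isProbIntegral hZ)

lemma IsProbIntegral.const_mul (hZ : IsStableNoise α P Z μ) (h : IsProbIntegral α P Z μ u Y)
    (c : ℂ) :
    IsProbIntegral α P Z μ (fun θ => c * u θ) (fun ω => c * Y ω) := by
  simpa using (isProbIntegral_zero hZ).add_const_mul hZ h c

lemma IsProbIntegral.add (hZ : IsStableNoise α P Z μ) (h : IsProbIntegral α P Z μ u Y)
    (h' : IsProbIntegral α P Z μ u' Y') :
    IsProbIntegral α P Z μ (fun θ => u θ + u' θ) (fun ω => Y ω + Y' ω) := by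
  simpa using h.add_const_mul hZ h' 1

lemma IsProbIntegral.congr (h : IsProbIntegral α P Z μ u Y) (hu : u =ᵐ[μ] u') (hY : Y =ᵐ[P] Y') :
    IsProbIntegral α P Z μ u' Y' := by
  obtain ⟨h0, φ, S, hS, h1, h2⟩ := h
  refine ⟨h0.ae_eq hu, φ, S, hS, ?_, h2.congr_right hY⟩
  refine h1.congr fun m => eLpNorm_congr_ae ?_
  filter_upwards [hu] with θ hθ
  rw [hθ]

/-- The integral is an isometry: `‖∫ u dZ‖_α` is the norm of `u` in `L^α(μ)`. -/
lemma IsProbIntegral.hasScale [IsProbabilityMeasure P] (hZ : IsStableNoise α P Z μ)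
    (h : IsProbIntegral α P Z μ u Y) : HasScale α P Y (eLpNorm u (ENNReal.ofReal α) μ ^ α) := by
  obtain ⟨hu, φ, S, hS, h1, h2⟩ := h
  have hα0 : 0 ≤ α := by linarith [hZ.one_lt]
  refine HasScale.of_tendsto hZ.one_lt (fun m => (hS m).hasScale hZ) ?_
    (ENNReal.rpow_ne_top_of_nonneg hα0 hu.2.ne) h2
  refine (ENNReal.continuous_rpow_const.tendsto _).comp ?_
  have hlow : Tendsto (fun m => eLpNorm u (ENNReal.ofReal α) μ
      - eLpNorm (fun θ => φ m θ - u θ) (ENNReal.ofReal α) μ) atTop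
      (𝓝 (eLpNorm u (ENNReal.ofReal α) μ)) := by
    simpa using ENNReal.Tendsto.sub (tendsto_const_nhds (x := eLpNorm u (ENNReal.ofReal α) μ)) h1
      (.inl hu.2.ne)
  have hup : Tendsto (fun m => eLpNorm (fun θ => φ m θ - u θ) (ENNReal.ofReal α) μ
      + eLpNorm u (ENNReal.ofReal α) μ) atTop (𝓝 (eLpNorm u (ENNReal.ofReal α) μ)) := by
    simpa using h1.add_const (eLpNorm u (ENNReal.ofReal α) μ)
  refine tendsto_of_tendsto_of_tendsto_of_le_of_le hlow hup (fun m => ?_) fun m => ?_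
  · have hm := ((hS m).memLp hZ)
    refine tsub_le_iff_left.2 ?_
    have h3 : u = φ m - fun θ => φ m θ - u θ := by funext θ; simp
    conv_lhs => rw [h3]
    rw [add_comm]
    exact eLpNorm_sub_le hm.1 (hm.sub hu).1 hZ.one_le
  · have hm := ((hS m).memLp hZ)
    have h3 : φ m = (fun θ => φ m θ - u θ) + u := by funext θ; simp
    conv_lhs => rw [h3]
    exact eLpNorm_add_le (hm.sub hu).1 hu.1 hZ.one_le

lemma IsProbIntegral.stableNormPow_eq [IsProbabilityMeasure P] (hZ : IsStableNoise α P Z μ)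
    (h : IsProbIntegral α P Z μ u Y) :
    stableNormPow α P Y = eLpNorm u (ENNReal.ofReal α) μ ^ α :=
  (h.hasScale hZ).stableNormPow_eq hZ.one_lt

lemma IsProbIntegral.stableNormPow_sub [IsProbabilityMeasure P] (hZ : IsStableNoise α P Z μ)
    (h : IsProbIntegral α P Z μ u Y) (h' : IsProbIntegral α P Z μ u' Y') :
    stableNormPow α P (fun ω => Y ω - Y' ω)
      = eLpNorm (fun θ => u θ - u' θ) (ENNReal.ofReal α) μ ^ α :=
  (h.sub hZ h').stableNormPow_eq hZ

lemma tendsto_rpow_zero {ι : Type*} {l : Filter ι} (hα : 1 < α) {M : ι → ℝ≥0∞}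
    (h : Tendsto M l (𝓝 0)) : Tendsto (fun i => M i ^ α) l (𝓝 0) := by
  have := (ENNReal.continuous_rpow_const (y := α)).tendsto 0
  rw [ENNReal.zero_rpow_of_pos (by linarith)] at this
  exact this.comp h

lemma tendsto_zero_of_rpow {ι : Type*} {l : Filter ι} (hα : 1 < α) {M : ι → ℝ≥0∞}
    (h : Tendsto (fun i => M i ^ α) l (𝓝 0)) : Tendsto M l (𝓝 0) := by
  have := (ENNReal.continuous_rpow_const (y := α⁻¹)).tendsto 0
  rw [ENNReal.zero_rpow_of_pos (by positivity)] at this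
  refine (this.comp h).congr fun i => ?_
  rw [Function.comp_apply, ← ENNReal.rpow_mul, mul_inv_cancel₀ (by linarith), ENNReal.rpow_one]

lemma IsProbIntegral.isStableIntegral [IsProbabilityMeasure P] (hZ : IsStableNoise α P Z μ)
    (h : IsProbIntegral α P Z μ u Y) : IsStableIntegral α P Z μ u Y := by
  obtain ⟨hu, φ, S, hS, h1, -⟩ := id h
  have h3 (m : ℕ) := ((hS m).isProbIntegral hZ).stableNormPow_sub hZ h
  have h4 (m : ℕ) := h.stableNormPow_sub hZ ((hS m).isProbIntegral hZ)
  choose n t a ht hφ hS' using hS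
  refine ⟨hu, n, t, a, ht, ?_, ?_⟩
  · simpa only [hφ] using h1
  · have h5 := tendsto_rpow_zero hZ.one_lt h1
    refine h5.congr fun m => ?_
    rw [← hS' m, h4 m]
    congr 1
    exact eLpNorm_sub_comm _ _ _ _

lemma IsProbIntegral.ae_eq [IsProbabilityMeasure P] (hZ : IsStableNoise α P Z μ)
    (h : IsProbIntegral α P Z μ u Y) (h' : IsProbIntegral α P Z μ u' Y) : u =ᵐ[μ] u' := by
  have hα0 : 0 < α := by linarith [hZ.one_lt]
  have h1 := h.stableNormPow_sub hZ h'
  simp only [sub_self] at h1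
  rw [hasScale_zero.stableNormPow_eq hZ.one_lt] at h1
  have h2 := (ENNReal.rpow_eq_zero_iff_of_pos hα0).1 h1.symm
  replace h2 := (eLpNorm_eq_zero_iff (h.1.sub h'.1).1 (ofReal_ne_zero_of_one_lt hZ.one_lt)).1 h2
  filter_upwards [h2] with θ hθ
  exact sub_eq_zero.1 hθ

lemma IsProbIntegral.ae_unique [IsProbabilityMeasure P] (hZ : IsStableNoise α P Z μ)
    (h : IsProbIntegral α P Z μ u Y) (h' : IsProbIntegral α P Z μ u Y') : Y =ᵐ[P] Y' := by
  have h1 := h.stableNormPow_sub hZ h'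
  have hα0 : 0 < α := by linarith [hZ.one_lt]
  simp only [sub_self, eLpNorm_zero', ENNReal.zero_rpow_of_pos hα0] at h1
  have h2 : TendstoInMeasure P (fun _ : ℕ => Y') atTop Y :=
    tendstoInMeasure_of_stableNormPow hZ.one_lt (by simp only [h1]; exact tendsto_const_nhds)
  have h3 : TendstoInMeasure P (fun _ : ℕ => Y') atTop Y' := by
    rw [tendstoInMeasure_iff_norm]
    intro ε hε
    simp [not_le.2 hε]
  exact tendstoInMeasure_ae_unique h2 h3

/-- Every function in `L^α(μ)` can be integrated. The integrals of step functions that approach it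
fast enough converge almost surely, by the Borel–Cantelli lemma. -/
lemma exists_isProbIntegral [IsProbabilityMeasure P] (hZ : IsStableNoise α P Z μ)
    (hu : MemLp u (ENNReal.ofReal α) μ) : ∃ Y, IsProbIntegral α P Z μ u Y := by
  have hα := hZ.one_lt
  have hα0 : 0 < α := by linarith
  have := hZ.finite
  -- with this rate, the bound `4 (8 / r)^α ‖·‖_α^α` at `r = 2^{-m}` is at most `4 · 4^{-m}`
  have hε (m : ℕ) : ENNReal.ofReal ((1 / 8) ^ m / 16) ≠ 0 := by
    simp only [ne_eq, ENNReal.ofReal_eq_zero, not_le]; positivity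
  choose φ S hS hφ using fun m : ℕ =>
    exists_isStep_eLpNorm_le Z hZ.one_le ENNReal.ofReal_ne_top hZ.carrier hu (hε m)
  have hlim : Tendsto (fun m : ℕ => ENNReal.ofReal ((1 / 8) ^ m / 16)) atTop (𝓝 0) := by
    have h1 : Tendsto (fun m : ℕ => ((1 / 8 : ℝ)) ^ m / 16) atTop (𝓝 (0 / 16)) :=
      (tendsto_pow_atTop_nhds_zero_of_lt_one (by norm_num) (by norm_num)).div_const _
    simpa using ENNReal.tendsto_ofReal h1
  have hSm (m : ℕ) : AEMeasurable (S m) P := ((hS m).hasScale hZ).aemeasurable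
  have hdiff (m : ℕ) : HasScale α P (fun ω => S m ω - S (m + 1) ω)
      (eLpNorm (fun θ => φ m θ - φ (m + 1) θ) (ENNReal.ofReal α) μ ^ α) :=
    (((hS m).isProbIntegral hZ).sub hZ ((hS (m + 1)).isProbIntegral hZ)).hasScale hZ
  have hnorm (m : ℕ) : eLpNorm (fun θ => φ m θ - φ (m + 1) θ) (ENNReal.ofReal α) μ
      ≤ ENNReal.ofReal ((1 / 8) ^ m / 8) := by
    have h1 : (fun θ => φ m θ - φ (m + 1) θ)
        = (fun θ => φ m θ - u θ) - fun θ => φ (m + 1) θ - u θ := by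
      funext θ; simp
    rw [h1]
    refine (eLpNorm_sub_le (((hS m).memLp hZ).sub hu).1 (((hS (m + 1)).memLp hZ).sub hu).1
      hZ.one_le).trans ((add_le_add (hφ m) (hφ (m + 1))).trans ?_)
    rw [← ENNReal.ofReal_add (by positivity) (by positivity)]
    refine ENNReal.ofReal_le_ofReal ?_
    have : (1 / 8 : ℝ) ^ (m + 1) ≤ (1 / 8) ^ m := pow_le_pow_of_le_one (by norm_num) (by norm_num)
      (Nat.le_succ m)
    linarith
  have hprob (m : ℕ) : P {ω | (1 / 2 : ℝ) ^ m ≤ ‖S m ω - S (m + 1) ω‖}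
      ≤ ENNReal.ofReal (4 * (1 / 4) ^ m) := by
    have h1 := (hdiff m).measure_norm_ge_le hα (r := (1 / 2) ^ m) (by positivity)
    rw [← ofReal_measureReal]
    refine ENNReal.ofReal_le_ofReal (h1.trans ?_)
    rw [← ENNReal.toReal_rpow, mul_assoc, ← Real.mul_rpow (by positivity) (by positivity)]
    have h2 := ENNReal.toReal_le_of_le_ofReal (by positivity) (hnorm m)
    have h3 : 8 / (1 / 2 : ℝ) ^ m * (eLpNorm (fun θ => φ m θ - φ (m + 1) θ)
        (ENNReal.ofReal α) μ).toReal ≤ (1 / 4) ^ m := by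
      calc _ ≤ 8 / (1 / 2 : ℝ) ^ m * ((1 / 8) ^ m / 8) := by gcongr
        _ = (1 / 4) ^ m := by
          rw [show (1 / 8 : ℝ) = 1 / 2 * (1 / 4) by norm_num, mul_pow]
          field_simp
    have h4 : (1 / 4 : ℝ) ^ m ≤ 1 := pow_le_one₀ (by norm_num) (by norm_num)
    have h5 := Real.rpow_le_self_of_le_one
      (x := 8 / (1 / 2 : ℝ) ^ m * (eLpNorm (fun θ => φ m θ - φ (m + 1) θ)
        (ENNReal.ofReal α) μ).toReal) (by positivity) (h3.trans h4) hα.le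
    linarith
  have hsum : ∑' m : ℕ, P {ω | (1 / 2 : ℝ) ^ m ≤ ‖S m ω - S (m + 1) ω‖} ≠ ⊤ := by
    refine ne_top_of_le_ne_top ?_ (ENNReal.tsum_le_tsum hprob)
    exact ((summable_geometric_of_lt_one (by norm_num) (by norm_num)).mul_left 4).tsum_ofReal_ne_top
  have hconv : ∀ᵐ ω ∂P, ∃ y, Tendsto (fun m => S m ω) atTop (𝓝 y) := by
    filter_upwards [ae_eventually_notMem hsum] with ω hω
    refine cauchySeq_tendsto_of_complete (cauchySeq_of_summable_dist ?_)
    refine Summable.of_norm_bounded_eventually_nat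
      (summable_geometric_of_lt_one (by norm_num) (by norm_num : (1 / 2 : ℝ) < 1)) ?_
    filter_upwards [hω] with m hm
    simp only [not_le] at hm
    rw [Real.norm_of_nonneg dist_nonneg, dist_eq_norm]
    exact hm.le
  obtain ⟨Y, -, hY⟩ := measurable_limit_of_tendsto_metrizable_ae hSm hconv
  exact ⟨Y, hu, φ, S, hS, tendsto_of_tendsto_of_tendsto_of_le_of_le tendsto_const_nhds hlim
    (fun _ => zero_le) hφ, tendstoInMeasure_of_tendsto_ae
      (fun m => (hSm m).aestronglyMeasurable) hY⟩

/-- The set of all integrals is closed: a limit in `‖·‖_α` of integrals is an integral, and the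
integrands converge in `L^α(μ)`. -/
lemma exists_isProbIntegral_of_tendsto [IsProbabilityMeasure P] (hZ : IsStableNoise α P Z μ)
    {v : ℕ → ℝ → ℂ} {X : ℕ → Ω → ℂ} (h : ∀ m, IsProbIntegral α P Z μ (v m) (X m))
    (hX : Tendsto (fun m => stableNormPow α P (fun ω => Y ω - X m ω)) atTop (𝓝 0)) :
    ∃ u, IsProbIntegral α P Z μ u Y ∧
      Tendsto (fun m => eLpNorm (fun θ => v m θ - u θ) (ENNReal.ofReal α) μ) atTop (𝓝 0) := by
  have hα := hZ.one_lt
  have := Fact.mk hZ.one_le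
  have hXY := tendstoInMeasure_of_stableNormPow hα hX
  have hdiff : TendstoInMeasure P (fun (p : ℕ × ℕ) ω => X p.1 ω - X p.2 ω) atTop fun _ => 0 := by
    have h1 : TendstoInMeasure P (fun p : ℕ × ℕ => X p.1) atTop Y :=
      hXY.comp (by rw [← prod_atTop_atTop_eq]; exact tendsto_fst)
    have h2 : TendstoInMeasure P (fun p : ℕ × ℕ => X p.2) atTop Y :=
      hXY.comp (by rw [← prod_atTop_atTop_eq]; exact tendsto_snd)
    simpa [sub_eq_add_neg] using tendstoInMeasure_add h1 (tendstoInMeasure_const_mul h2 (-1))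
  have hscale := tendsto_zero_of_rpow hα <| tendsto_scale_zero hα hZ.le_two
    (fun p : ℕ × ℕ => ((h p.1).sub hZ (h p.2)).hasScale hZ) hdiff
  let V : ℕ → Lp ℂ (ENNReal.ofReal α) μ := fun m => (h m).1.toLp (v m)
  have hV : CauchySeq V := by
    rw [EMetric.cauchySeq_iff']
    intro ε hε
    have h1 := hscale.eventually (gt_mem_nhds hε)
    obtain ⟨⟨N, N'⟩, hN⟩ := eventually_atTop.1 h1
    refine ⟨max N N', fun n hn => ?_⟩
    rw [Lp.edist_toLp_toLp]
    exact hN (n, max N N') ⟨(le_max_left N N').trans hn, le_max_right N N'⟩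
  obtain ⟨W, hW⟩ := cauchySeq_tendsto_of_complete hV
  have hconv : Tendsto (fun m => eLpNorm (fun θ => v m θ - W θ) (ENNReal.ofReal α) μ) atTop
      (𝓝 0) := by
    have h1 := (Lp.tendsto_Lp_iff_tendsto_eLpNorm' V W).1 hW
    refine h1.congr fun m => eLpNorm_congr_ae ?_
    filter_upwards [(h m).1.coeFn_toLp] with θ hθ
    simp only [Pi.sub_apply, V, hθ]
  obtain ⟨Y', hY'⟩ := exists_isProbIntegral hZ (Lp.memLp W)
  have h2 : TendstoInMeasure P X atTop Y' := by
    refine tendstoInMeasure_of_stableNormPow hα ?_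
    refine (tendsto_rpow_zero hα hconv).congr fun m => ?_
    rw [hY'.stableNormPow_sub hZ (h m)]
    congr 1
    exact eLpNorm_sub_comm _ _ _ _
  exact ⟨W, hY'.congr (ae_eq_refl _) (tendstoInMeasure_ae_unique h2 hXY), hconv⟩

end Integral

/-! ### The past of the sequence and its optimal estimates -/

section Prediction

variable {Ω : Type*} [MeasurableSpace Ω] {P : Measure Ω} {α : ℝ}
  {Z : Circ → Ω → ℂ} {μ : Measure ℝ} {ξ : ℤ → Ω → ℂ} {A : ℝ → ℂ}
  {X Y : Ω → ℂ}

lemma exists_mem_span_chrLp [IsFiniteMeasure μ] (hZ : IsStableNoise α P Z μ)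
    (hξ : ∀ n, IsProbIntegral α P Z μ (chr n) (ξ n))
    {L : Ω → ℂ} (hL : L ∈ Submodule.span ℂ {X : Ω → ℂ | ∃ k : ℤ, k < 0 ∧ X = ξ k}) :
    ∃ g ∈ Submodule.span ℂ (chrLp (ENNReal.ofReal α) μ '' {k | k < 0}),
      IsProbIntegral α P Z μ g L := by
  induction hL using Submodule.span_induction with
  | mem L hL =>
    obtain ⟨k, hk, rfl⟩ := hL
    exact ⟨chrLp _ μ k, Submodule.subset_span ⟨k, hk, rfl⟩,
      (hξ k).congr (coeFn_chrLp _ μ k).symm (ae_eq_refl _)⟩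
  | zero =>
    exact ⟨0, Submodule.zero_mem _,
      (isProbIntegral_zero hZ).congr (Lp.coeFn_zero _ _ _).symm (ae_eq_refl _)⟩
  | add L L' _ _ ih ih' =>
    obtain ⟨g, hg, h⟩ := ih
    obtain ⟨g', hg', h'⟩ := ih'
    exact ⟨g + g', Submodule.add_mem _ hg hg',
      (h.add hZ h').congr (Lp.coeFn_add g g').symm (ae_eq_refl _)⟩
  | smul c L _ ih =>
    obtain ⟨g, hg, h⟩ := ih
    exact ⟨c • g, Submodule.smul_mem _ c hg,
      (h.const_mul hZ c).congr (Lp.coeFn_smul c g).symm (ae_eq_refl _)⟩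

lemma exists_mem_span_sequence [IsFiniteMeasure μ] (hZ : IsStableNoise α P Z μ)
    (hξ : ∀ n, IsProbIntegral α P Z μ (chr n) (ξ n)) {g : Lp ℂ (ENNReal.ofReal α) μ}
    (hg : g ∈ Submodule.span ℂ (chrLp (ENNReal.ofReal α) μ '' {k | k < 0})) :
    ∃ L ∈ Submodule.span ℂ {X : Ω → ℂ | ∃ k : ℤ, k < 0 ∧ X = ξ k},
      IsProbIntegral α P Z μ g L := by
  induction hg using Submodule.span_induction with
  | mem g hg =>
    obtain ⟨k, hk, rfl⟩ := hg
    exact ⟨ξ k, Submodule.subset_span ⟨k, hk, rfl⟩,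
      (hξ k).congr (coeFn_chrLp _ μ k).symm (ae_eq_refl _)⟩
  | zero =>
    exact ⟨0, Submodule.zero_mem _,
      (isProbIntegral_zero hZ).congr (Lp.coeFn_zero _ _ _).symm (ae_eq_refl _)⟩
  | add g g' _ _ ih ih' =>
    obtain ⟨L, hL, h⟩ := ih
    obtain ⟨L', hL', h'⟩ := ih'
    exact ⟨L + L', Submodule.add_mem _ hL hL',
      (h.add hZ h').congr (Lp.coeFn_add g g').symm (ae_eq_refl _)⟩
  | smul c g _ ih =>
    obtain ⟨L, hL, h⟩ := ih
    exact ⟨c • L, Submodule.smul_mem _ c hL,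
      (h.const_mul hZ c).congr (Lp.coeFn_smul c g).symm (ae_eq_refl _)⟩

/-- The integral maps the closed span of the characters of negative index onto `H⁻(ξ)`. -/
lemma mem_pastSpace_iff [IsProbabilityMeasure P] [IsFiniteMeasure μ]
    [Fact (1 ≤ ENNReal.ofReal α)] (hZ : IsStableNoise α P Z μ)
    (hξ : ∀ n, IsProbIntegral α P Z μ (chr n) (ξ n)) :
    Y ∈ pastSpace α P ξ ↔ ∃ h ∈ pastLp (ENNReal.ofReal α) μ, IsProbIntegral α P Z μ h Y := by
  have hα0 : 0 < α := by linarith [hZ.one_lt]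
  constructor
  · intro hY
    choose L hL hYL using fun m : ℕ => hY ((m : ℝ≥0∞) + 1)⁻¹ (by simp)
    choose g hg hgL using fun m => exists_mem_span_chrLp hZ hξ (hL m)
    have hlim : Tendsto (fun m : ℕ => ((m : ℝ≥0∞) + 1)⁻¹) atTop (𝓝 0) := by
      have := (tendsto_add_atTop_iff_nat 1).2 ENNReal.tendsto_inv_nat_nhds_zero
      simpa using this
    obtain ⟨u, hu, hgu⟩ := exists_isProbIntegral_of_tendsto hZ hgL
      (tendsto_of_tendsto_of_tendsto_of_le_of_le tendsto_const_nhds hlim (fun _ => zero_le)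
        fun m => (hYL m).le)
    refine ⟨hu.1.toLp u, ?_, hu.congr hu.1.coeFn_toLp.symm (ae_eq_refl _)⟩
    refine mem_closure_of_tendsto (f := g) (b := atTop) ?_ (Eventually.of_forall hg)
    rw [Lp.tendsto_Lp_iff_tendsto_eLpNorm']
    refine hgu.congr fun m => eLpNorm_congr_ae ?_
    filter_upwards [hu.1.coeFn_toLp] with θ hθ
    simp only [Pi.sub_apply, hθ]
  · rintro ⟨h, hh, hY⟩ ε hε
    have hδ : 0 < ε ^ α⁻¹ := ENNReal.rpow_pos_of_nonneg hε (by positivity)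
    obtain ⟨g, hg, hgh⟩ := EMetric.mem_closure_iff.1 hh _ hδ
    obtain ⟨L, hL, hgL⟩ := exists_mem_span_sequence hZ hξ hg
    refine ⟨L, hL, ?_⟩
    rw [hY.stableNormPow_sub hZ hgL]
    rw [Lp.edist_def] at hgh
    have h1 := ENNReal.rpow_lt_rpow hgh hα0
    rwa [← ENNReal.rpow_mul, inv_mul_cancel₀ hα0.ne', ENNReal.rpow_one] at h1

lemma stableNormPow_sub_eq_enorm [IsProbabilityMeasure P]
    [Fact (1 ≤ ENNReal.ofReal α)] (hZ : IsStableNoise α P Z μ)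
    (hA : MemLp A (ENNReal.ofReal α) μ) (hX : IsProbIntegral α P Z μ A X)
    {h : Lp ℂ (ENNReal.ofReal α) μ} (hY : IsProbIntegral α P Z μ h Y) :
    stableNormPow α P (fun ω => X ω - Y ω) = ‖hA.toLp A - h‖ₑ ^ α := by
  rw [hX.stableNormPow_sub hZ hY, Lp.enorm_def]
  congr 1
  refine eLpNorm_congr_ae ?_
  filter_upwards [Lp.coeFn_sub (hA.toLp A) h, hA.coeFn_toLp] with θ h1 h2
  rw [h1, Pi.sub_apply, h2]

/-- The optimal estimates of `∫ A dZ` are the integrals of the best approximations of `A`. -/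
lemma isOptimalEstimate_iff [IsProbabilityMeasure P] [IsFiniteMeasure μ]
    [Fact (1 ≤ ENNReal.ofReal α)] (hZ : IsStableNoise α P Z μ)
    (hξ : ∀ n, IsProbIntegral α P Z μ (chr n) (ξ n))
    (hA : MemLp A (ENNReal.ofReal α) μ) (hX : IsProbIntegral α P Z μ A X) :
    IsOptimalEstimate α P ξ X Y ↔ ∃ h ∈ pastLp (ENNReal.ofReal α) μ,
      (∀ g ∈ pastLp (ENNReal.ofReal α) μ, ‖hA.toLp A - h‖ ≤ ‖hA.toLp A - g‖) ∧
        IsProbIntegral α P Z μ h Y := by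
  have hα0 : 0 < α := by linarith [hZ.one_lt]
  constructor
  · rintro ⟨hY, hmin⟩
    obtain ⟨h, hh, hhY⟩ := (mem_pastSpace_iff hZ hξ).1 hY
    refine ⟨h, hh, fun g hg => ?_, hhY⟩
    obtain ⟨W, hW⟩ := exists_isProbIntegral hZ (Lp.memLp g)
    have h1 := hmin W ((mem_pastSpace_iff hZ hξ).2 ⟨g, hg, hW⟩)
    rw [stableNormPow_sub_eq_enorm hZ hA hX hhY, stableNormPow_sub_eq_enorm hZ hA hX hW,
      ENNReal.rpow_le_rpow_iff hα0] at h1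
    exact enorm_le_iff_norm_le.1 h1
  · rintro ⟨h, hh, hmin, hhY⟩
    refine ⟨(mem_pastSpace_iff hZ hξ).2 ⟨h, hh, hhY⟩, fun W hW => ?_⟩
    obtain ⟨g, hg, hgW⟩ := (mem_pastSpace_iff hZ hξ).1 hW
    rw [stableNormPow_sub_eq_enorm hZ hA hX hhY, stableNormPow_sub_eq_enorm hZ hA hX hgW,
      ENNReal.rpow_le_rpow_iff hα0]
    exact enorm_le_iff_norm_le.2 (hmin g hg)

lemma isProbIntegral_partialSum (hZ : IsStableNoise α P Z μ)
    (hξ : ∀ n, IsProbIntegral α P Z μ (chr n) (ξ n)) (a : ℕ → ℂ) (n : ℕ) :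
    IsProbIntegral α P Z μ (fun θ => ∑ j ∈ Finset.range n, a j * chr j θ)
      (fun ω => ∑ j ∈ Finset.range n, a j * ξ j ω) := by
  induction n with
  | zero => simpa using isProbIntegral_zero hZ
  | succ n ih =>
    simp only [Finset.sum_range_succ]
    exact ih.add_const_mul hZ (hξ n) (a n)

lemma tendsto_eLpNorm_partialSum [IsFiniteMeasure μ] {a : ℕ → ℂ}
    (ha : Summable fun j => ‖a j‖) (p : ℝ≥0∞) :
    Tendsto (fun n : ℕ => eLpNorm (fun θ => symbolA a θ - ∑ j ∈ Finset.range n, a j * chr j θ) p μ)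
      atTop (𝓝 0) := by
  have hK : μ Set.univ ^ p.toReal⁻¹ ≠ ⊤ := by
    have := measure_ne_top μ Set.univ
    finiteness
  have htail : Tendsto (fun n : ℕ => ENNReal.ofReal (∑' j, ‖a (j + n)‖)) atTop (𝓝 0) := by
    simpa using ENNReal.tendsto_ofReal (tendsto_sum_nat_add fun j => ‖a j‖)
  have h1 : Tendsto (fun n : ℕ => μ Set.univ ^ p.toReal⁻¹ * ENNReal.ofReal (∑' j, ‖a (j + n)‖))
      atTop (𝓝 0) := by
    simpa using ENNReal.Tendsto.const_mul htail (.inr hK)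
  refine tendsto_of_tendsto_of_tendsto_of_le_of_le tendsto_const_nhds h1 (fun _ => zero_le)
    fun n => eLpNorm_le_of_ae_bound (Eventually.of_forall fun θ => ?_)
  have hn (j : ℕ) : ‖a j * chr j θ‖ = ‖a j‖ := by rw [norm_mul, norm_chr, mul_one]
  have hs : Summable fun j : ℕ => a j * chr j θ := by
    refine Summable.of_norm ?_
    simpa only [hn] using ha
  have h2 : symbolA a θ = ∑' j : ℕ, a j * chr j θ := by simp [symbolA, chr]
  rw [h2, ← hs.sum_add_tsum_nat_add n, add_sub_cancel_left]
  refine (norm_tsum_le_tsum_norm ?_).trans (by simp only [hn]; exact le_rfl)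
  simpa only [hn] using (summable_nat_add_iff n).2 ha

/-- The series `∑ a_j ξ_j` and the integral `∫ A dZ` are the same random variables. -/
lemma isFunctional_iff [IsProbabilityMeasure P] (hZ : IsStableNoise α P Z μ)
    (hξ : ∀ n, IsProbIntegral α P Z μ (chr n) (ξ n)) {a : ℕ → ℂ} (ha : Summable fun j => ‖a j‖) :
    IsFunctional α P ξ a X ↔ IsProbIntegral α P Z μ (symbolA a) X := by
  have := hZ.finite
  have hA := memLp_symbolA ha (ENNReal.ofReal α) μ
  have key {Y : Ω → ℂ} (h : IsProbIntegral α P Z μ (symbolA a) Y) : IsFunctional α P ξ a Y := by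
    refine (tendsto_rpow_zero hZ.one_lt
      (tendsto_eLpNorm_partialSum (μ := μ) ha (ENNReal.ofReal α))).congr fun n => ?_
    exact (h.stableNormPow_sub hZ (isProbIntegral_partialSum hZ hξ a n)).symm
  refine ⟨fun h => ?_, key⟩
  obtain ⟨Y, hY⟩ := exists_isProbIntegral hZ hA
  have h1 := tendstoInMeasure_of_stableNormPow hZ.one_lt (key hY)
  have h2 := tendstoInMeasure_of_stableNormPow hZ.one_lt h
  exact hY.congr (ae_eq_refl _) (tendstoInMeasure_ae_unique h1 h2)

end Prediction

lemma integrable_of_isFiniteMeasure_densityMeasure {f : ℝ → ℝ} (hf : AEMeasurable f arc)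
    (hpos : ∀ᵐ θ ∂arc, 0 < f θ) [h : IsFiniteMeasure (densityMeasure f)] : Integrable f arc := by
  refine ⟨hf.aestronglyMeasurable, ?_⟩
  have h1 := measure_lt_top (densityMeasure f) Set.univ
  rw [densityMeasure, withDensity_apply _ MeasurableSet.univ, Measure.restrict_univ] at h1
  refine (lintegral_congr_ae ?_).trans_lt h1
  filter_upwards [hpos] with θ hθ
  exact Real.enorm_of_nonneg hθ.le

end StableExtrapolation

end

theorem corollary1 {Ω : Type*} [MeasurableSpace Ω] (P : MeasureTheory.Measure Ω)
    [MeasureTheory.IsProbabilityMeasure P] (α : ℝ) (hα1 : 1 < α) (hα2 : α ≤ 2)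
    (f : ℝ → ℝ)
    (hf_meas : AEMeasurable f (volume.restrict (Set.Ioc (-Real.pi) Real.pi)))
    (hf_pos : ∀ᵐ θ ∂(volume.restrict (Set.Ioc (-Real.pi) Real.pi)), 0 < f θ)
    (hf_min : IntegrableOn (fun θ => f θ ^ (-1 / (α - 1))) (Set.Ioc (-Real.pi) Real.pi))
    (ξ : ℤ → Ω → ℂ) (Z : StableExtrapolation.Circ → Ω → ℂ)
    (hξ : StableExtrapolation.IsHarmonizable α P ξ Z (StableExtrapolation.densityMeasure f))
    (a : ℕ → ℂ) (ha : Summable (fun j => ‖a j‖)) :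
    -- the functional `Aξ` is well defined
    (∃ Aξ : Ω → ℂ, StableExtrapolation.IsFunctional α P ξ a Aξ) ∧
    -- the system has one and only one solution
    (∃! c : ℕ → ℂ, ∃ C : ℝ → ℂ, StableExtrapolation.SolvesSystem α f a c C) ∧
    ∀ (c : ℕ → ℂ) (C : ℝ → ℂ), StableExtrapolation.SolvesSystem α f a c C →
      ∀ Aξ : Ω → ℂ, StableExtrapolation.IsFunctional α P ξ a Aξ →
        -- `Aξ = ∫ A dZ`
        StableExtrapolation.IsStableIntegral α P Z (StableExtrapolation.densityMeasure f)
          (StableExtrapolation.symbolA a) Aξ ∧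
        -- the optimal estimate exists and is unique
        (∃ Y : Ω → ℂ, StableExtrapolation.IsOptimalEstimate α P ξ Aξ Y ∧
          ∀ Y' : Ω → ℂ, StableExtrapolation.IsOptimalEstimate α P ξ Aξ Y' → Y' =ᵐ[P] Y) ∧
        -- it is `∫ h dZ`, and `h` is its spectral characteristic
        (∀ Y : Ω → ℂ, StableExtrapolation.IsOptimalEstimate α P ξ Aξ Y →
          ∀ u : ℝ → ℂ,
            StableExtrapolation.IsStableIntegral α P Z (StableExtrapolation.densityMeasure f) u Y ↔
              u =ᵐ[volume.restrict (Set.Ioc (-Real.pi) Real.pi)]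
                StableExtrapolation.spectralChar α f a C) ∧
        -- the error of the optimal estimate
        (∀ Y : Ω → ℂ, StableExtrapolation.IsOptimalEstimate α P ξ Aξ Y →
          StableExtrapolation.stableNormPow α P (fun ω => Aξ ω - Y ω) =
            ENNReal.ofReal (∫ θ in (-Real.pi)..Real.pi,
              ‖StableExtrapolation.errorChar α f C θ‖ ^ α * f θ) ∧
          IntegrableOn (fun θ => ‖StableExtrapolation.errorChar α f C θ‖ ^ α * f θ)
            (Set.Ioc (-Real.pi) Real.pi)) := by
  open StableExtrapolation in
  have hfin := hξ.finite
  have := fact_one_le hα1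
  have hf : IsMinimalDensity α f := ⟨hα1, hf_meas, hf_pos,
    integrable_of_isFiniteMeasure_densityMeasure hf_meas hf_pos, hf_min⟩
  have hZ : IsStableNoise α P Z (densityMeasure f) :=
    ⟨hα1, hα2, hξ.indep, hξ.finite, hξ.carrier, hξ.spectral⟩
  have hrep (n : ℤ) : IsProbIntegral α P Z (densityMeasure f) (chr n) (ξ n) :=
    (hξ.representation n).isProbIntegral hα1
  have hA := memLp_symbolA ha (ENNReal.ofReal α) (densityMeasure f)
  obtain ⟨h, hh, hmin, c₀, C₀, hC₀, hCh⟩ := hf.exists_solvesSystem hA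
  refine ⟨?_, ⟨c₀, ⟨C₀, hC₀⟩, ?_⟩, ?_⟩
  · obtain ⟨X, hX⟩ := exists_isProbIntegral hZ hA
    exact ⟨X, (isFunctional_iff hZ hrep ha).2 hX⟩
  · rintro c ⟨C, hC⟩
    exact (hf.solvesSystem_unique ha hC hC₀).1
  intro c C hC X hX
  replace hX := (isFunctional_iff hZ hrep ha).1 hX
  have hCh' : spectralChar α f a C =ᵐ[densityMeasure f] h :=
    (IsMinimalDensity.ac_arc f).ae_eq ((hf.solvesSystem_unique ha hC hC₀).2.trans hCh)
  have hopt {Y : Ω → ℂ} : IsOptimalEstimate α P ξ X Y ↔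
      IsProbIntegral α P Z (densityMeasure f) (spectralChar α f a C) Y := by
    rw [isOptimalEstimate_iff hZ hrep hA hX]
    refine ⟨?_, fun hY => ⟨h, hh, hmin, hY.congr hCh' (ae_eq_refl _)⟩⟩
    rintro ⟨g, hg, hgmin, hY⟩
    obtain rfl := bestApprox_unique hα1 (uniformlyRotund_Lp hα1) _ hg hh hgmin hmin
    exact hY.congr hCh'.symm (ae_eq_refl _)
  refine ⟨hX.isStableIntegral hZ, ?_, fun Y hY u => ⟨fun hu => ?_, fun hu => ?_⟩, fun Y hY => ?_⟩
  · obtain ⟨Y, hY⟩ := exists_isProbIntegral hZ hC.memLp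
    exact ⟨Y, hopt.2 hY, fun Y' hY' => (hopt.1 hY').ae_unique hZ hY⟩
  · exact hf.arc_ac.ae_eq ((hu.isProbIntegral hα1).ae_eq hZ (hopt.1 hY))
  · exact ((hopt.1 hY).congr ((IsMinimalDensity.ac_arc f).ae_eq hu.symm)
      (ae_eq_refl _)).isStableIntegral hZ
  have he := hf.memLp_errorChar ha hC
  have hsub : (fun θ => symbolA a θ - spectralChar α f a C θ) = errorChar α f C := by
    funext θ; exact sub_sub_cancel _ _
  constructor
  · rw [hX.stableNormPow_sub hZ (hopt.1 hY), hsub, eLpNorm_rpow hα1 he, hf.integral_eq,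
      intervalIntegral.integral_of_le (by linarith [Real.pi_pos])]
    simp only [smul_eq_mul, mul_comm]
  · have h1 := (hf.integrable_iff _).1 (integrable_norm_rpow hα1 he)
    simpa only [IntegrableOn, smul_eq_mul, mul_comm] using h1
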